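/- Let $F>0$, $\nu>0$, and for four-component real vector fields $U=(v,\theta)=(U^1,\dots,U^4)$ on $\mathbb R^3$ put $\Delta_F=\partial_1^2+\partial_2^2+F^2\partial_3^2$, $\Omega(U)=\partial_1v^2-\partial_2v^1-F\partial_3\theta$, $$\mathcal Q U=(-\partial_2,\partial_1,0,-F\partial_3)\,\Delta_F^{-1}\Omega(U),\qquad \mathcal P U=U-\mathcal Q U,\qquad \mathbb P(v,\theta)=(v-\nabla\Delta^{-1}\operatorname{div}v,\ \theta),\qquad U\cdot\nabla U=\sum_{i=1}^3U^i\partial_iU,$$ $$\mathcal A=\begin{pmatrix}0&-1&0&0\\1&0&0&0\\0&0&0&F^{-1}\\0&0&-F^{-1}&0\end{pmatrix}.$$ Let $\dot H^s=\dot H^s(\mathbb R^3)$ be the homogeneous Sobolev spaces, and $\|\cdot\|_{\dot H^a\cap\dot H^b}=\max(\|\cdot\|_{\dot H^a},\|\cdot\|_{\dot H^b})$. Let $0<\delta<1$, let $\widetilde U_{0,QG}\in\dot H^{\frac12}\cap\dot H^{\frac12+\delta}$, and let $\widetilde U_{QG}$ be the solution, on $[0,\widetilde T^*_{QG})$, of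 the quasi-geostrophic system with equal viscosities $$\partial_t\widetilde U_{QG}+\mathcal Q(\widetilde U_{QG}\cdot\nabla\widetilde U_{QG})-\nu\Delta\widetilde U_{QG}=0,\qquad \widetilde U_{QG}=\mathcal Q\widetilde U_{QG},\qquad \widetilde U_{QG}|_{t=0}=\widetilde U_{0,QG},$$ in the class $C([0,t];\dot H^{\frac12})\cap L^2(0,t;\dot H^{\frac32})$ for all $t<\widetilde T^*_{QG}$. Put $G^b=\mathbb P\mathcal P(\widetilde U_{QG}\cdot\nabla\widetilde U_{QG})$ and $\mathbb C_t=\int_0^t\|\widetilde U_{QG}(\tau)\|_{\dot H^{3/2}}^2\,d\tau$. For $\varepsilon>0$ let $W_\varepsilon^{inh}$ be the solution on $[0,\widetilde T^*_{QG})$, continuous in time with values in $\dot H^{\frac12}$, of $$\partial_tW_\varepsilon^{inh}-\nu\Delta W_\varepsilon^{inh}+\tfrac1\varepsilon\mathbb P\mathcal A W_\varepsilon^{inh}=-G^b,\qquad W_\varepsilon^{inh}|_{t=0}=0 .$$ Then there is a constant $C>0$, depending only on $\delta$, such that for all $t\in[0,\widetilde T^*_{QG})$: 1. For all $r\in(1,\infty]$,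 $G^b\in L^r(0,t;\dot H^{-\frac32+\frac2r})$ and $$\|G^b\|_{L^r_t\dot H^{-\frac32+\frac2r}}\le\frac{C}{\nu^{1/r}}\,\|\widetilde U_{0,QG}\|_{\dot H^{\frac12}}^2\,e^{\frac C\nu\mathbb C_t};$$ for all $r\in\big(\tfrac1{1-\delta/2},\infty\big]$, $G^b\in L^r(0,t;\dot H^{-\frac32+\frac2r+2\delta})$ and $$\|G^b\|_{L^r_t\dot H^{-\frac32+\frac2r+2\delta}}\le\frac{C}{\nu^{1/r}}\,\|\widetilde U_{0,QG}\|_{\dot H^{\frac12+\delta}}^2\,e^{\frac C\nu\mathbb C_t}.$$ 2. For all $\varepsilon>0$ and all $s\in[\frac12,\frac12+2\delta]$, $$\|W_\varepsilon^{inh}(t)\|_{\dot H^s}^2+\nu\int_0^t\|W_\varepsilon^{inh}(\tau)\|_{\dot H^{s+1}}^2\,d\tau\le\frac{C}{\nu^2}\,\|\widetilde U_{0,QG}\|^4_{\dot H^{\frac12}\cap\dot H^{\frac12+\delta}}\,e^{\frac{2C}{\nu}\mathbb C_t}.$$ -/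

import Mathlib

open MeasureTheory Filter Topology
open scoped ENNReal SchwartzMap FourierTransform

noncomputable section

namespace QG

/-- The space `ℝ³` with its Euclidean structure. -/
abbrev R3 : Type := EuclideanSpace ℝ (Fin 3)

/-- Real vector fields `U = (v, θ) = (v¹, v², v³, θ)` on `ℝ³`. -/
abbrev Field : Type := R3 → Fin 4 → ℝ

/-! ### Fourier transform and homogeneous Sobolev norms -/

/-- `g` is the Fourier transform of `f` in the sense of tempered distributions, both tempered
distributions being functions: `⟨f, 𝓕 φ⟩ = ⟨g, φ⟩` for every Schwartz function `φ`
(with the normalisation `𝓕 φ ξ = ∫ exp (-2π i x·ξ) φ x dx`). -/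
def IsFourierPair (f g : R3 → ℂ) : Prop :=
  (∀ φ : 𝓢(R3, ℂ), Integrable (fun x => φ x * f x)) ∧
  (∀ φ : 𝓢(R3, ℂ), Integrable (fun ξ => φ ξ * g ξ)) ∧
  ∀ φ : 𝓢(R3, ℂ), ∫ x, (𝓕 φ) x * f x = ∫ ξ, φ ξ * g ξ

open Classical in
/-- The Fourier transform of the tempered distribution `f`, when it is a function (it is then
unique almost everywhere); `0` otherwise. -/
def ft (f : R3 → ℂ) : R3 → ℂ :=
  if h : ∃ g, IsFourierPair f g then h.choose else 0

/-- Componentwise Fourier transform of a vector field. -/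
def fieldFt (u : Field) (ξ : R3) : Fin 4 → ℂ :=
  fun k => ft (fun x => (u x k : ℂ)) ξ

/-- The `Ḣ^s` norm `(∫ |2πξ|^{2s} |g(ξ)|² dξ)^{1/2}`, in terms of the Fourier transform `g`. -/
def hNormHat (s : ℝ) (g : R3 → Fin 4 → ℂ) : ℝ≥0∞ :=
  (∫⁻ ξ, ENNReal.ofReal ((2 * Real.pi * ‖ξ‖) ^ (2 * s)) * ∑ k, ‖g ξ k‖ₑ ^ 2) ^ (1 / 2 : ℝ)

open Classical in
/-- The `Ḣ^s(ℝ³)` norm of a vector field. It is `∞` when the Fourier transform of the field is not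
a function; the field belongs to `Ḣ^s` when the norm is finite. -/
def hNorm (s : ℝ) (u : Field) : ℝ≥0∞ :=
  if ∀ k, ∃ g, IsFourierPair (fun x => (u x k : ℂ)) g then hNormHat s (fieldFt u) else ∞

/-- The interval `[0, T)`, for `T ∈ (0, ∞]`. -/
def timeInterval (T : EReal) : Set ℝ := {t | 0 ≤ t ∧ (t : EReal) < T}

/-- `u ∈ C([0, T); Ḣ^s)`. -/
def ContinuousInH (s : ℝ) (T : EReal) (u : ℝ → Field) : Prop :=
  (∀ t ∈ timeInterval T, hNorm s (u t) < ∞) ∧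
  ∀ t₀ ∈ timeInterval T,
    Tendsto (fun t => hNorm s (u t - u t₀)) (𝓝[timeInterval T] t₀) (𝓝 0)

/-! ### Fourier symbols of the operators -/

/-- Symbol of `∂_j`. -/
def dSymb (j : Fin 3) (ξ : R3) : ℂ := 2 * Real.pi * Complex.I * (ξ j : ℂ)

/-- Symbol of the Laplacian. -/
def lapSymb (ξ : R3) : ℂ := ∑ j, dSymb j ξ ^ 2

/-- Symbol of `Δ_F = ∂₁² + ∂₂² + F² ∂₃²`. -/
def lapFSymb (F : ℝ) (ξ : R3) : ℂ :=
  dSymb 0 ξ ^ 2 + dSymb 1 ξ ^ 2 + (F : ℂ) ^ 2 * dSymb 2 ξ ^ 2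

/-- Symbol of the potential vorticity `Ω(U) = ∂₁ v² - ∂₂ v¹ - F ∂₃ θ`. -/
def pvSymb (F : ℝ) (ξ : R3) (a : Fin 4 → ℂ) : ℂ :=
  dSymb 0 ξ * a 1 - dSymb 1 ξ * a 0 - F * dSymb 2 ξ * a 3

/-- Symbol of the quasi-geostrophic projector `𝒬 U = (-∂₂, ∂₁, 0, -F ∂₃) Δ_F⁻¹ Ω(U)`. -/
def projQG (F : ℝ) (ξ : R3) (a : Fin 4 → ℂ) : Fin 4 → ℂ :=
  ((lapFSymb F ξ)⁻¹ * pvSymb F ξ a) • ![-dSymb 1 ξ, dSymb 0 ξ, 0, -(F * dSymb 2 ξ)]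

/-- Symbol of the oscillating projector `𝒫 U = U - 𝒬 U`. -/
def projOsc (F : ℝ) (ξ : R3) (a : Fin 4 → ℂ) : Fin 4 → ℂ := a - projQG F ξ a

/-- Symbol of the Leray projector `ℙ (v, θ) = (v - ∇ Δ⁻¹ div v, θ)`. -/
def leray (ξ : R3) (a : Fin 4 → ℂ) : Fin 4 → ℂ :=
  a - ((lapSymb ξ)⁻¹ * ∑ j : Fin 3, dSymb j ξ * a j.castSucc) •
    ![dSymb 0 ξ, dSymb 1 ξ, dSymb 2 ξ, 0]

/-- The rotation and stratification matrix `𝒜`. -/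
def matA (F : ℝ) : Matrix (Fin 4) (Fin 4) ℂ :=
  !![0, -1, 0, 0;
     1, 0, 0, 0;
     0, 0, 0, (F : ℂ)⁻¹;
     0, 0, -(F : ℂ)⁻¹, 0]

/-! ### The advection term, the forcing and the two systems -/

/-- Fourier transform of the advection term `U·∇U = ∑_{i ≤ 3} Uⁱ ∂_i U`, written in the divergence
form `∑_{i ≤ 3} ∂_i (Uⁱ U)`; it is only used for quasi-geostrophic fields `U = (v, θ)`, for which
`div v = 0`. -/
def advHat (U : Field) (ξ : R3) : Fin 4 → ℂ :=
  fun k => ∑ i : Fin 3, dSymb i ξ * ft (fun x => ((U x i.castSucc * U x k : ℝ) : ℂ)) ξ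

/-- Fourier transform of the forcing `G^b = ℙ 𝒫 (U·∇U)`. -/
def forceHat (F : ℝ) (U : Field) (ξ : R3) : Fin 4 → ℂ :=
  leray ξ (projOsc F ξ (advHat U ξ))

/-- `U ∈ C([0, T); Ḣ^{1/2}) ∩ L²_loc([0, T); Ḣ^{3/2})` solves the quasi-geostrophic system
`∂_t U + 𝒬(v·∇U) - ν Δ U = 0`, `U = 𝒬 U`, `U(0) = U₀` (equal viscosities `ν = ν'`) on `[0, T)`.
The equation is integrated in time and holds in the sense of tempered distributions, after a
Fourier transform in space. -/
structure IsQGSolution (F ν : ℝ) (T : EReal) (U₀ : Field) (U : ℝ → Field) : Prop where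
  init : U 0 =ᵐ[volume] U₀
  cont : ContinuousInH (1 / 2) T U
  sq_int : ∀ t ∈ timeInterval T, ∫⁻ τ in Set.Ioo 0 t, hNorm (3 / 2) (U τ) ^ 2 < ∞
  qg : ∀ t ∈ timeInterval T, ∀ᵐ ξ, projQG F ξ (fieldFt (U t) ξ) = fieldFt (U t) ξ
  eqn : ∀ t ∈ timeInterval T, ∀ (φ : 𝓢(R3, ℂ)) (k : Fin 4),
    ∫ ξ, φ ξ * fieldFt (U t) ξ k = (∫ ξ, φ ξ * fieldFt U₀ ξ k) +
      ∫ τ in (0 : ℝ)..t, ∫ ξ, φ ξ *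
        (ν * lapSymb ξ * fieldFt (U τ) ξ k - projQG F ξ (advHat (U τ) ξ) k)

/-- `W ∈ C([0, T); Ḣ^{1/2})` solves the linear system
`∂_t W - ν Δ W + ε⁻¹ ℙ 𝒜 W = - G^b`, `W(0) = 0` on `[0, T)`, with `G^b = ℙ 𝒫 (U·∇U)`, in the same
sense. -/
structure IsInhSolution (F ν ε : ℝ) (T : EReal) (U W : ℝ → Field) : Prop where
  init : W 0 =ᵐ[volume] 0
  cont : ContinuousInH (1 / 2) T W
  eqn : ∀ t ∈ timeInterval T, ∀ (φ : 𝓢(R3, ℂ)) (k : Fin 4),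
    ∫ ξ, φ ξ * fieldFt (W t) ξ k =
      ∫ τ in (0 : ℝ)..t, ∫ ξ, φ ξ *
        (ν * lapSymb ξ * fieldFt (W τ) ξ k
          - (ε : ℂ)⁻¹ * leray ξ ((matA F).mulVec (fieldFt (W τ) ξ)) k
          - forceHat F (U τ) ξ k)

/-- `ℂ_t = ∫₀ᵗ ‖U(τ)‖²_{Ḣ^{3/2}} dτ` (finite on the interval of existence of a solution). -/
def bigC (U : ℝ → Field) (t : ℝ) : ℝ :=
  (∫⁻ τ in Set.Ioo 0 t, hNorm (3 / 2) (U τ) ^ 2).toReal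

end QG

end

/-! On the Fourier side every operator involved is a pointwise symbol. `𝒬` and `1 - ℙ` are
orthogonal projections on real lines of `ℂ⁴`, so the forcing, like the nonlinearity of the
quasi-geostrophic equation, is bounded at each frequency by `6 |2πξ| (|û| * |û|)(ξ)`. Everything
then rests on two ingredients: the product law `Ḣ^s · Ḣ^s' → Ḣ^(s+s'-3/2)`, proved by splitting the
convolution according to which factor has the lower frequency, and energy inequalities with
arbitrary weights in frequency.

For the quasi-geostrophic flow `u`, the product law with one factor in `Ḣ^{3/2}`, Young and Gronwall
propagate `Ḣ^{1/2+d}` for `0 ≤ d < 1`, with the factor `exp (C ℂ_t / ν)` (`exists_sobolev_bound`).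
This gives the case `r = ∞` of the forcing bounds: two factors in `Ḣ^{1/2+d}` and one derivative
land in `Ḣ^{-3/2+2d}`.

The other end is `r₀ = 1 / (1 - d/2)`, where the forcing must be in `L^{r₀}` with values in
`Ḣ^{1/2+d}`. The energy space `L^∞ Ḣ^{1/2+d} ∩ L² Ḣ^{3/2+d}` does not suffice, because one factor is
needed at a regularity that parabolic scaling ties to a time exponent below 2. It is replaced by
estimates weighted in time. The integral of `s^(β-1) ‖u‖²` in `Ḣ^{1/2+d+β}` is controlled by
separating frequencies at `ν s |2πξ|² = 1`: above, dissipation pays; below, the energy densities at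
all times are dominated by one finite measure, and the time integral at each frequency is explicit
(`DissEvol.low_estimate`). Feeding this into the energy inequality multiplied by a power of time
gives the stronger smoothing of `exists_high_bound`. Hölder in time, in which the weights cancel,
gives the bound at `r₀`, and interpolation with `r = ∞` gives every larger `r`
(`exists_force_bound`). The first estimate is `d = 0`, the second `d = δ`.

For `W`, the gradient part solves a heat equation with zero data and no source, so `W` is divergence
free; the rotation term, being skew, then disappears from the energy identity whatever `ε` is. What
remains is `‖W‖²_{Ḣ^s} + ν ∫ ‖W‖²_{Ḣ^{s+1}} ≤ (4/ν) ∫ ‖G‖²_{Ḣ^{s-1}}`, and the two forcing bounds at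
`r = 2` cover the ends `s = 1/2` and `s = 1/2 + 2δ` (`DissEvol.energy_le_force`).

The equations hold only in a weak sense, so the energy computations are made on frequency annuli,
where all homogeneous Sobolev norms are comparable and solutions are `C¹` curves in `L²`; the annuli
then exhaust space. Wherever a dissipation integral is absorbed, it must be known to be finite,
which explains the truncated weights. -/

noncomputable section

open scoped NNReal

namespace QG

/-! ### Tempered functions and their Fourier transforms -/

/-- A function that is integrable against every Schwartz function is locally integrable. -/
theorem locallyIntegrable_of_schwartz {g : R3 → ℂ}
    (hg : ∀ φ : 𝓢(R3, ℂ), Integrable (fun ξ => φ ξ * g ξ)) : LocallyIntegrable g := by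
  intro x
  let b : ContDiffBump x := ⟨1, 2, by norm_num, by norm_num⟩
  have hb₁ : HasCompactSupport (Complex.ofRealCLM ∘ b) := b.hasCompactSupport.comp_left rfl
  have hb₂ : ContDiff ℝ (⊤ : ℕ∞) (Complex.ofRealCLM ∘ b) :=
    Complex.ofRealCLM.contDiff.comp b.contDiff
  have h := (hg (hb₁.toSchwartzMap hb₂)).integrableOn (s := Metric.closedBall x 1)
  refine ⟨Metric.closedBall x 1, Metric.closedBall_mem_nhds x one_pos, ?_⟩
  refine h.congr_fun (fun y hy => ?_) measurableSet_closedBall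
  have : b y = 1 := b.one_of_mem_closedBall hy
  simp [this]

/-- A tempered function that annihilates all Schwartz functions vanishes almost everywhere. -/
theorem ae_eq_zero_of_schwartz {g : R3 → ℂ}
    (hg : ∀ φ : 𝓢(R3, ℂ), Integrable (fun ξ => φ ξ * g ξ))
    (h0 : ∀ φ : 𝓢(R3, ℂ), ∫ ξ, φ ξ * g ξ = 0) : g =ᵐ[volume] 0 := by
  refine ae_eq_zero_of_integral_contDiff_smul_eq_zero (locallyIntegrable_of_schwartz hg) ?_
  intro b hb hbc
  have hb₁ : HasCompactSupport (Complex.ofRealCLM ∘ b) := hbc.comp_left rfl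
  have hb₂ : ContDiff ℝ (⊤ : ℕ∞) (Complex.ofRealCLM ∘ b) := Complex.ofRealCLM.contDiff.comp hb
  simpa using h0 (hb₁.toSchwartzMap hb₂)

namespace IsFourierPair

variable {f f' g g' : R3 → ℂ}

theorem aestronglyMeasurable_left (h : IsFourierPair f g) : AEStronglyMeasurable f :=
  (locallyIntegrable_of_schwartz h.1).aestronglyMeasurable

theorem aestronglyMeasurable_right (h : IsFourierPair f g) : AEStronglyMeasurable g :=
  (locallyIntegrable_of_schwartz h.2.1).aestronglyMeasurable

theorem sub (h : IsFourierPair f g) (h' : IsFourierPair f' g') :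
    IsFourierPair (f - f') (g - g') := by
  refine ⟨fun φ => ?_, fun φ => ?_, fun φ => ?_⟩
  · simp only [Pi.sub_apply, mul_sub]
    exact (h.1 φ).sub (h'.1 φ)
  · simp only [Pi.sub_apply, mul_sub]
    exact (h.2.1 φ).sub (h'.2.1 φ)
  · simp only [Pi.sub_apply, mul_sub]
    rw [integral_sub (h.1 _) (h'.1 _), integral_sub (h.2.1 _) (h'.2.1 _), h.2.2, h'.2.2]

theorem unique_right (h : IsFourierPair f g) (h' : IsFourierPair f g') : g =ᵐ[volume] g' := by
  have h0 := h.sub h'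
  have := ae_eq_zero_of_schwartz h0.2.1 (fun φ => by rw [← h0.2.2]; simp)
  filter_upwards [this] with x hx
  simpa [sub_eq_zero] using hx

theorem unique_left (h : IsFourierPair f g) (h' : IsFourierPair f' g) : f =ᵐ[volume] f' := by
  have h0 := h.sub h'
  have := ae_eq_zero_of_schwartz h0.1 (fun φ => by
    have := h0.2.2 (𝓕⁻ φ)
    simpa using this)
  filter_upwards [this] with x hx
  simpa [sub_eq_zero] using hx

theorem congr_left (h : IsFourierPair f g) (hf : f =ᵐ[volume] f') : IsFourierPair f' g := by
  have e : ∀ φ : 𝓢(R3, ℂ), (fun x => φ x * f x) =ᵐ[volume] fun x => φ x * f' x := fun φ => by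
    filter_upwards [hf] with x hx using by rw [hx]
  exact ⟨fun φ => (h.1 φ).congr (e φ), h.2.1,
    fun φ => by rw [← h.2.2 φ]; exact (integral_congr_ae (e _)).symm⟩

theorem ft_ae_eq (h : IsFourierPair f g) : ft f =ᵐ[volume] g := by
  have hex : ∃ g, IsFourierPair f g := ⟨g, h⟩
  rw [ft, dif_pos hex]
  exact hex.choose_spec.unique_right h

end IsFourierPair

theorem isFourierPair_ft {f : R3 → ℂ} (h : ∃ g, IsFourierPair f g) : IsFourierPair f (ft f) := by
  rw [ft, dif_pos h]
  exact h.choose_spec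

/-! ### Fourier pairs for integrable and for square integrable functions. -/

theorem integrable_schwartz_mul_of_memLp {g : R3 → ℂ} (hg : MemLp g 2) (φ : 𝓢(R3, ℂ)) :
    Integrable (fun ξ => φ ξ * g ξ) :=
  (φ.memLp 2).integrable_mul hg

/-- Fubini moves the transform from one factor to the other. The kernel with the opposite sign
`-innerₗ` is used so that the transform of `𝓕 φ` gives back `φ` by inversion. -/
theorem isFourierPair_of_integrable {g : R3 → ℂ} (hg : Integrable g) :
    IsFourierPair (𝓕⁻ g) g := by
  have hc : Continuous (𝓕⁻ g) := by
    have : (𝓕⁻ g) = fun x => 𝓕 g (-x) := by ext x; rw [Real.fourierInv_eq_fourier_neg]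
    rw [this]
    exact (VectorFourier.fourierIntegral_continuous Real.continuous_fourierChar
      (by exact continuous_inner) hg).comp continuous_neg
  have hb : ∀ x, ‖𝓕⁻ g x‖ ≤ ∫ v, ‖g v‖ := fun x => by
    rw [Real.fourierInv_eq_fourier_neg]
    exact VectorFourier.norm_fourierIntegral_le_integral_norm _ _ _ _ _
  refine ⟨fun φ => ?_, fun φ => ?_, fun φ => ?_⟩
  · exact φ.integrable.mul_bdd hc.aestronglyMeasurable (ae_of_all _ hb)
  · obtain ⟨C, hC⟩ := φ.toBoundedContinuousFunction.isBounded_range.exists_norm_le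
    refine hg.bdd_mul (c := C) φ.continuous.aestronglyMeasurable (ae_of_all _ fun x => ?_)
    exact hC _ ⟨x, rfl⟩
  · have h := VectorFourier.integral_fourierIntegral_smul_eq_flip (L := -innerₗ R3)
      (μ := volume) (ν := volume) (f := fun x => 𝓕 φ x) (g := g)
      Real.continuous_fourierChar (by simpa using! continuous_inner.neg)
      (𝓕 φ).integrable hg
    have e1 : ∀ ξ, VectorFourier.fourierIntegral Real.fourierChar volume (-innerₗ R3)
        (fun x => 𝓕 φ x) ξ = φ ξ := by
      intro ξ
      have : (𝓕⁻ (𝓕 φ)) ξ = φ ξ := by simp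
      rw [← this, SchwartzMap.fourierInv_coe, Real.fourierInv_eq]
      simp [VectorFourier.fourierIntegral]
    have e2 : ∀ ξ, VectorFourier.fourierIntegral Real.fourierChar volume (-innerₗ R3).flip
        g ξ = 𝓕⁻ g ξ := by
      intro ξ
      rw [Real.fourierInv_eq]
      simp [VectorFourier.fourierIntegral, real_inner_comm]
    simp only [e1, e2, smul_eq_mul] at h
    exact h.symm

/-- This is Plancherel: `f` is the inverse `L²` transform of `g`, and the pairing identity is the
compatibility of the `L²` transform with that of tempered distributions. -/
theorem exists_isFourierPair_of_memLp {g : R3 → ℂ} (hg : MemLp g 2) :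
    ∃ f : R3 → ℂ, MemLp f 2 ∧ eLpNorm f 2 = eLpNorm g 2 ∧ IsFourierPair f g := by
  let G : Lp (α := R3) ℂ 2 := hg.toLp g
  let H : Lp (α := R3) ℂ 2 := 𝓕⁻ G
  have hH : 𝓕 H = G := FourierTransform.fourier_fourierInv_eq G
  refine ⟨H, Lp.memLp H, ?_, fun φ => integrable_schwartz_mul_of_memLp (Lp.memLp H) φ,
    fun φ => integrable_schwartz_mul_of_memLp hg φ, fun φ => ?_⟩
  · have h1 : ‖H‖ = ‖G‖ := by rw [← hH]; exact (Lp.norm_fourier_eq H).symm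
    rw [Lp.norm_def, Lp.norm_def, ENNReal.toReal_eq_toReal_iff' (Lp.eLpNorm_ne_top _)
      (Lp.eLpNorm_ne_top _)] at h1
    rw [h1]
    exact eLpNorm_congr_ae hg.coeFn_toLp
  · have h := congrArg (fun T : 𝓢'(R3, ℂ) => T φ) (Lp.fourier_toTemperedDistribution_eq H)
    simp only [TemperedDistribution.fourier_apply, Lp.toTemperedDistribution_apply,
      smul_eq_mul, hH] at h
    rw [h]
    refine integral_congr_ae ?_
    filter_upwards [hg.coeFn_toLp] with x hx
    rw [hx]

/-! ### The Fourier transform of a product -/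

/-- Convolution of two functions on `ℝ³`. -/
def conv (a b : R3 → ℂ) (ξ : R3) : ℂ := ∫ ζ, a ζ * b (ξ - ζ)

/-- Fubini after the shear `(ζ, ξ) ↦ (ζ, ξ - ζ)`, which preserves measure. Integrability is assumed
only after testing, since `a` and `b` need not be integrable. -/
theorem integrable_mul_conv {φ a b : R3 → ℂ}
    (h : Integrable (fun p : R3 × R3 => φ (p.1 + p.2) * (a p.1 * b p.2))) :
    Integrable (fun ξ => φ ξ * conv a b ξ) ∧
      ∫ ξ, φ ξ * conv a b ξ = ∫ p : R3 × R3, φ (p.1 + p.2) * (a p.1 * b p.2) := by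
  have hm : MeasurePreserving (fun z : R3 × R3 => (z.1, -z.1 + z.2))
      (volume.prod volume) (volume.prod volume) := measurePreserving_prod_neg_add volume volume
  have h' : Integrable (fun z : R3 × R3 => φ z.2 * (a z.1 * b (z.2 - z.1)))
      (volume.prod volume) := by
    have := hm.integrable_comp_of_integrable h
    refine this.congr (ae_of_all _ fun z => ?_)
    simp [sub_eq_add_neg, add_comm]
  have e : ∀ ξ, ∫ ζ, φ ξ * (a ζ * b (ξ - ζ)) = φ ξ * conv a b ξ := fun ξ => by
    rw [integral_const_mul]; rfl
  have hi := h'.integral_prod_right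
  simp only [e] at hi
  refine ⟨hi, ?_⟩
  have h2 := integral_prod_symm _ h'
  simp only [e] at h2
  rw [← h2]
  have hme : MeasurableEmbedding (fun z : R3 × R3 => (z.1, -z.1 + z.2)) :=
    (MeasurableEquiv.shearAddRight R3).symm.measurableEmbedding
  have := hm.integral_comp hme (fun p : R3 × R3 => φ (p.1 + p.2) * (a p.1 * b p.2))
  rw [Measure.volume_eq_prod, ← this]
  simp [sub_eq_add_neg, add_comm]

theorem fourierInv_conv {a b : R3 → ℂ} (ha : Integrable a) (hb : Integrable b) :
    𝓕⁻ (conv a b) = fun x => 𝓕⁻ a x * 𝓕⁻ b x := by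
  ext x
  simp only [Real.fourierInv_eq_fourier_neg]
  exact Real.fourier_mul_convolution_eq ha hb (-x)

theorem tendsto_eLpNorm_indicator_compl_closedBall {g : R3 → ℂ}
    (hg : MemLp ((Metric.closedBall (0 : R3) 1)ᶜ.indicator g) 2) :
    Tendsto (fun n : ℕ => eLpNorm ((Metric.closedBall (0 : R3) (n + 1))ᶜ.indicator g) 2)
      atTop (𝓝 0) := by
  set G := (Metric.closedBall (0 : R3) 1)ᶜ.indicator g with hG
  have e : ∀ n : ℕ, (Metric.closedBall (0 : R3) (n + 1))ᶜ.indicator g =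
      (Metric.closedBall (0 : R3) (n + 1))ᶜ.indicator G := fun n => by
    rw [hG, Set.indicator_indicator, Set.inter_eq_left.2]
    exact Set.compl_subset_compl.2 (Metric.closedBall_subset_closedBall (by simp))
  simp only [e, eLpNorm_eq_lintegral_rpow_enorm_toReal two_ne_zero ENNReal.ofNat_ne_top]
  have h := tendsto_lintegral_of_dominated_convergence' (μ := volume)
    (F := fun (n : ℕ) x => ‖(Metric.closedBall (0 : R3) (n + 1))ᶜ.indicator G x‖ₑ ^ (2 : ℝ≥0∞).toReal)
    (f := fun _ => 0) (fun x => ‖G x‖ₑ ^ (2 : ℝ≥0∞).toReal)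
    (fun n => ((hg.1.indicator measurableSet_closedBall.compl).enorm.pow_const _))
    (fun n => ae_of_all _ fun x => by
      exact ENNReal.rpow_le_rpow (enorm_indicator_le_enorm_self _ _) (by simp))
    (lintegral_rpow_enorm_lt_top_of_eLpNorm_lt_top two_ne_zero ENNReal.ofNat_ne_top hg.2).ne
    (ae_of_all _ fun x => by
      refine tendsto_const_nhds.congr' ?_
      obtain ⟨N, hN⟩ := exists_nat_ge ‖x‖
      filter_upwards [eventually_ge_atTop N] with n hn
      have : x ∉ (Metric.closedBall (0 : R3) (n + 1))ᶜ := by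
        have : (N : ℝ) ≤ n := by exact_mod_cast hn
        simp only [Set.mem_compl_iff, Metric.mem_closedBall, dist_zero_right, not_not]
        linarith
      simp [Set.indicator_of_notMem this])
  have h2 := (ENNReal.continuous_rpow_const (y := 1 / (2 : ℝ≥0∞).toReal)).tendsto 0 |>.comp
    (by simpa using h)
  simpa [Function.comp_def] using h2

theorem enorm_integral_mul_le {x y : R3 → ℂ} (hx : AEStronglyMeasurable x)
    (hy : AEStronglyMeasurable y) :
    ‖∫ ξ, x ξ * y ξ‖ₑ ≤ eLpNorm x 2 * eLpNorm y 2 := by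
  refine (enorm_integral_le_lintegral_enorm _).trans ?_
  rw [← eLpNorm_one_eq_lintegral_enorm]
  have h : eLpNorm (x • y) 1 ≤ eLpNorm x 2 * eLpNorm y 2 :=
    eLpNorm_smul_le_mul_eLpNorm hy hx
  exact h

theorem eLpNorm_mul_le_top_mul {φ y : R3 → ℂ} (hφ : AEStronglyMeasurable φ)
    (hy : AEStronglyMeasurable y) :
    eLpNorm (fun x => φ x * y x) 2 ≤ eLpNorm φ ∞ * eLpNorm y 2 := by
  have h : eLpNorm (φ • y) 2 ≤ eLpNorm φ ∞ * eLpNorm y 2 := eLpNorm_smul_le_mul_eLpNorm hy hφ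
  exact h

/-- The functions `u` and `v` need not be square integrable, only their distances to the
approximations are. Writing `uₙ vₙ - u v` as `-v (u - uₙ) - u (v - vₙ) + (u - uₙ)(v - vₙ)` leaves in
each term, after multiplication by `ψ`, a product of two square integrable functions. -/
theorem tendsto_integral_mul_mul {ψ u v : R3 → ℂ} {un vn : ℕ → R3 → ℂ} (hψ : MemLp ψ ∞)
    (hlimInt : Integrable (fun x => ψ x * (u x * v x)))
    (hψu : MemLp (fun x => ψ x * u x) 2) (hψv : MemLp (fun x => ψ x * v x) 2)
    (hx : ∀ n, MemLp (u - un n) 2) (hy : ∀ n, MemLp (v - vn n) 2)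
    (hx0 : Tendsto (fun n => eLpNorm (u - un n) 2) atTop (𝓝 0))
    (hy0 : Tendsto (fun n => eLpNorm (v - vn n) 2) atTop (𝓝 0)) :
    Tendsto (fun n => ∫ x, ψ x * (un n x * vn n x)) atTop (𝓝 (∫ x, ψ x * (u x * v x))) := by
  have key : ∀ n, ‖(∫ x, ψ x * (un n x * vn n x)) - ∫ x, ψ x * (u x * v x)‖ₑ ≤
      eLpNorm (fun x => ψ x * v x) 2 * eLpNorm (u - un n) 2 +
      eLpNorm (fun x => ψ x * u x) 2 * eLpNorm (v - vn n) 2 +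
      eLpNorm ψ ∞ * eLpNorm (u - un n) 2 * eLpNorm (v - vn n) 2 := fun n => by
    have hxy : MemLp (fun x => ψ x * (u - un n) x) 2 := (hx n).mul hψ
    have i1 : Integrable (fun x => (ψ x * v x) * (u - un n) x) :=
      memLp_one_iff_integrable.1 ((hx n).mul hψv)
    have i2 : Integrable (fun x => (ψ x * u x) * (v - vn n) x) :=
      memLp_one_iff_integrable.1 ((hy n).mul hψu)
    have i3 : Integrable (fun x => (ψ x * (u - un n) x) * (v - vn n) x) :=
      memLp_one_iff_integrable.1 ((hy n).mul hxy)
    have i4 : Integrable (fun x => ψ x * (u x * v x) - (ψ x * v x) * (u - un n) x) :=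
      hlimInt.sub i1
    have i5 : Integrable (fun x => ψ x * (u x * v x) - (ψ x * v x) * (u - un n) x -
        (ψ x * u x) * (v - vn n) x) := i4.sub i2
    have e' : ∫ x, ψ x * (un n x * vn n x) = ∫ x, (ψ x * (u x * v x) -
        (ψ x * v x) * (u - un n) x - (ψ x * u x) * (v - vn n) x +
        (ψ x * (u - un n) x) * (v - vn n) x) := by
      congr 1
      ext x
      simp only [Pi.sub_apply]
      ring
    have e : (∫ x, ψ x * (un n x * vn n x)) - ∫ x, ψ x * (u x * v x) =
        -(∫ x, (ψ x * v x) * (u - un n) x) - (∫ x, (ψ x * u x) * (v - vn n) x)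
          + ∫ x, (ψ x * (u - un n) x) * (v - vn n) x := by
      rw [e', integral_add i5 i3, integral_sub i4 i2, integral_sub hlimInt i1]
      ring
    rw [e]
    refine (enorm_add_le _ _).trans (add_le_add ((enorm_sub_le).trans (add_le_add ?_ ?_)) ?_)
    · rw [enorm_neg]
      exact enorm_integral_mul_le hψv.1 (hx n).1
    · exact enorm_integral_mul_le hψu.1 (hy n).1
    · refine (enorm_integral_mul_le hxy.1 (hy n).1).trans ?_
      exact mul_le_mul_left (eLpNorm_mul_le_top_mul hψ.1 (hx n).1) _
  rw [tendsto_iff_edist_tendsto_0]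
  simp only [edist_eq_enorm_sub]
  refine tendsto_of_tendsto_of_tendsto_of_le_of_le tendsto_const_nhds ?_ (fun _ => zero_le)
    key
  have t1 := ENNReal.Tendsto.const_mul hx0 (Or.inr hψv.2.ne)
  have t2 := ENNReal.Tendsto.const_mul hy0 (Or.inr hψu.2.ne)
  have t3 := ENNReal.Tendsto.mul (ENNReal.Tendsto.const_mul hx0 (Or.inr hψ.2.ne))
    (Or.inr ENNReal.zero_ne_top) hy0 (Or.inr (by simp))
  simpa using (t1.add t2).add t3

namespace IsFourierPair

variable {u v a b : R3 → ℂ}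

/-- Low frequency truncation of a tempered function with square integrable high frequencies. -/
theorem sub_truncation (hu : IsFourierPair u a)
    (ha : MemLp ((Metric.closedBall (0 : R3) 1)ᶜ.indicator a) 2) (n : ℕ) :
    MemLp (u - 𝓕⁻ ((Metric.closedBall (0 : R3) (n + 1)).indicator a)) 2 ∧
    eLpNorm (u - 𝓕⁻ ((Metric.closedBall (0 : R3) (n + 1)).indicator a)) 2 =
      eLpNorm ((Metric.closedBall (0 : R3) (n + 1))ᶜ.indicator a) 2 := by
  set B := Metric.closedBall (0 : R3) (n + 1)
  have hi : Integrable (B.indicator a) := by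
    rw [integrable_indicator_iff measurableSet_closedBall]
    exact (locallyIntegrable_of_schwartz hu.2.1).integrableOn_isCompact
      (isCompact_closedBall _ _)
  have hm : MemLp (Bᶜ.indicator a) 2 := by
    have : Bᶜ.indicator a = Bᶜ.indicator ((Metric.closedBall (0 : R3) 1)ᶜ.indicator a) := by
      rw [Set.indicator_indicator, Set.inter_eq_left.2]
      exact Set.compl_subset_compl.2 (Metric.closedBall_subset_closedBall (by simp))
    rw [this]
    exact ha.indicator measurableSet_closedBall.compl
  obtain ⟨w, hw, hw', hp⟩ := exists_isFourierPair_of_memLp hm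
  have e : a - B.indicator a = Bᶜ.indicator a := by rw [Set.indicator_compl]
  have h := hu.sub (isFourierPair_of_integrable hi)
  rw [e] at h
  have hae := h.unique_left hp
  exact ⟨hw.ae_eq hae.symm, (eLpNorm_congr_ae hae).trans hw'⟩

theorem memLp_top_truncation (hu : IsFourierPair u a) (n : ℕ) :
    Integrable ((Metric.closedBall (0 : R3) (n + 1)).indicator a) ∧
      MemLp (𝓕⁻ ((Metric.closedBall (0 : R3) (n + 1)).indicator a)) ∞ := by
  set B := Metric.closedBall (0 : R3) (n + 1)
  have hi : Integrable (B.indicator a) := by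
    rw [integrable_indicator_iff measurableSet_closedBall]
    exact (locallyIntegrable_of_schwartz hu.2.1).integrableOn_isCompact
      (isCompact_closedBall _ _)
  have hb : ∀ x, ‖𝓕⁻ (B.indicator a) x‖ ≤ ∫ v, ‖B.indicator a v‖ := fun x => by
    rw [Real.fourierInv_eq_fourier_neg]
    exact VectorFourier.norm_fourierIntegral_le_integral_norm _ _ _ _ _
  exact ⟨hi, memLp_top_of_bound (isFourierPair_of_integrable hi).aestronglyMeasurable_left _
      (ae_of_all _ hb)⟩

/-- The low frequency part of `u` is bounded and the rest is in `L²`; a Schwartz function multiplies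
both into `L²`. -/
theorem memLp_schwartz_mul (hu : IsFourierPair u a)
    (ha : MemLp ((Metric.closedBall (0 : R3) 1)ᶜ.indicator a) 2) (φ : 𝓢(R3, ℂ)) :
    MemLp (fun x => φ x * u x) 2 := by
  obtain ⟨hm, -⟩ := hu.sub_truncation ha 0
  obtain ⟨-, h1⟩ := hu.memLp_top_truncation 0
  set w := 𝓕⁻ ((Metric.closedBall (0 : R3) ((0 : ℕ) + 1)).indicator a)
  have h2 : MemLp (fun x => φ x * w x) 2 := h1.mul (φ.memLp 2)
  have h3 : MemLp (fun x => φ x * (u - w) x) 2 := hm.mul φ.memLp_top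
  refine (h2.add h3).ae_eq (ae_of_all _ fun x => ?_)
  simp only [Pi.add_apply, Pi.sub_apply]
  ring

/-- The Fourier transform of a product is the convolution of the Fourier transforms. -/
theorem mul (hu : IsFourierPair u a) (hv : IsFourierPair v b)
    (ha : MemLp ((Metric.closedBall (0 : R3) 1)ᶜ.indicator a) 2)
    (hb : MemLp ((Metric.closedBall (0 : R3) 1)ᶜ.indicator b) 2)
    (hab : ∀ φ : 𝓢(R3, ℂ),
      Integrable (fun p : R3 × R3 => φ (p.1 + p.2) * (a p.1 * b p.2))) :
    IsFourierPair (fun x => u x * v x) (conv a b) := by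
  have hlimInt : ∀ φ : 𝓢(R3, ℂ), Integrable (fun x => φ x * (u x * v x)) := by
    intro φ
    obtain ⟨hm, -⟩ := hv.sub_truncation hb 0
    obtain ⟨-, h1⟩ := hv.memLp_top_truncation 0
    set w := 𝓕⁻ ((Metric.closedBall (0 : R3) ((0 : ℕ) + 1)).indicator b)
    have h2 : MemLp (fun x => (φ x * u x) * w x) 1 :=
      h1.mul (memLp_one_iff_integrable.2 (hu.1 φ))
    have h3 : MemLp (fun x => (φ x * u x) * (v - w) x) 1 :=
      hm.mul (hu.memLp_schwartz_mul ha φ)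
    refine (memLp_one_iff_integrable.1 (h2.add h3)).congr (ae_of_all _ fun x => ?_)
    simp only [Pi.add_apply, Pi.sub_apply]
    ring
  refine ⟨hlimInt, fun φ => (integrable_mul_conv (hab φ)).1, fun φ => ?_⟩
  rw [(integrable_mul_conv (hab φ)).2]
  set B : ℕ → Set R3 := fun n => Metric.closedBall (0 : R3) (n + 1) with hB
  set un : ℕ → R3 → ℂ := fun n => 𝓕⁻ ((B n).indicator a) with hun
  set vn : ℕ → R3 → ℂ := fun n => 𝓕⁻ ((B n).indicator b) with hvn
  set J : ℕ → ℂ := fun n => ∫ p : R3 × R3, φ (p.1 + p.2) *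
    ((B n).indicator a p.1 * (B n).indicator b p.2) with hJ
  have hBmem : ∀ x : R3, ∀ᶠ n in atTop, x ∈ B n := fun x => by
    obtain ⟨N, hN⟩ := exists_nat_ge ‖x‖
    filter_upwards [eventually_ge_atTop N] with n hn
    have : (N : ℝ) ≤ n := by exact_mod_cast hn
    simp only [hB, Metric.mem_closedBall, dist_zero_right]
    linarith
  have hJlim : Tendsto J atTop (𝓝 (∫ p : R3 × R3, φ (p.1 + p.2) * (a p.1 * b p.2))) := by
    have hind : ∀ n, (fun p : R3 × R3 => φ (p.1 + p.2) *
        ((B n).indicator a p.1 * (B n).indicator b p.2)) =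
        (B n ×ˢ B n).indicator (fun p => φ (p.1 + p.2) * (a p.1 * b p.2)) := fun n => by
      ext p
      by_cases h1 : p.1 ∈ B n <;> by_cases h2 : p.2 ∈ B n <;> simp [Set.indicator, h1, h2]
    simp only [hJ, hind]
    refine tendsto_integral_of_dominated_convergence
      (fun p => ‖φ (p.1 + p.2) * (a p.1 * b p.2)‖)
      (fun n => (hab φ).aestronglyMeasurable.indicator
        (measurableSet_closedBall.prod measurableSet_closedBall)) (hab φ).norm
      (fun n => ae_of_all _ fun p => norm_indicator_le_norm_self _ _) (ae_of_all _ fun p => ?_)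
    refine tendsto_const_nhds.congr' ?_
    filter_upwards [hBmem p.1, hBmem p.2] with n h1 h2
    rw [Set.indicator_of_mem]
    exact ⟨h1, h2⟩
  -- For the truncated transforms, which are integrable, the classical convolution theorem applies.
  -- Both sides then converge: the frequency side by dominated convergence, the space side by
  -- `tendsto_integral_mul_mul`.
  have hJeq : ∀ n, J n = ∫ x, (𝓕 φ) x * (un n x * vn n x) := fun n => by
    have hia := (hu.memLp_top_truncation n).1
    have hib := (hv.memLp_top_truncation n).1
    have hc : Integrable (conv ((B n).indicator a) ((B n).indicator b)) :=
      hia.integrable_convolution (ContinuousLinearMap.mul ℂ ℂ) hib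
    have hpair := isFourierPair_of_integrable hc
    have h1 := hpair.2.2 φ
    rw [fourierInv_conv hia hib] at h1
    rw [h1]
    refine ((integrable_mul_conv ?_).2).symm
    have hprod := hia.mul_prod hib
    obtain ⟨C, hC⟩ := φ.toBoundedContinuousFunction.isBounded_range.exists_norm_le
    exact hprod.bdd_mul (c := C)
      (φ.continuous.comp (continuous_fst.add continuous_snd)).aestronglyMeasurable
      (ae_of_all _ fun p => hC _ ⟨_, rfl⟩)
  refine tendsto_nhds_unique ?_ hJlim
  have hx0 : Tendsto (fun n => eLpNorm (u - un n) 2) atTop (𝓝 0) := by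
    simp only [hun, hB, (hu.sub_truncation ha _).2]
    exact tendsto_eLpNorm_indicator_compl_closedBall ha
  have hy0 : Tendsto (fun n => eLpNorm (v - vn n) 2) atTop (𝓝 0) := by
    simp only [hvn, hB, (hv.sub_truncation hb _).2]
    exact tendsto_eLpNorm_indicator_compl_closedBall hb
  simp only [funext hJeq]
  exact tendsto_integral_mul_mul (𝓕 φ).memLp_top (hlimInt _) (hu.memLp_schwartz_mul ha _)
    (hv.memLp_schwartz_mul hb _) (fun n => (hu.sub_truncation ha n).1)
    (fun n => (hv.sub_truncation hb n).1) hx0 hy0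

end IsFourierPair

/-! ### Weighted bounds for convolutions -/

/-- Cauchy–Schwarz inequality for the lower Lebesgue integral. -/
theorem lintegral_mul_sq_le {α : Type*} [MeasurableSpace α] {μ : Measure α} {f g : α → ℝ≥0∞}
    (hf : AEMeasurable f μ) (hg : AEMeasurable g μ) :
    (∫⁻ x, f x * g x ∂μ) ^ 2 ≤ (∫⁻ x, f x ^ 2 ∂μ) * ∫⁻ x, g x ^ 2 ∂μ := by
  have h := ENNReal.lintegral_mul_le_Lp_mul_Lq μ Real.HolderConjugate.two_two hf hg
  have h2 : ∀ x : ℝ≥0∞, x ^ (2 : ℝ) = x ^ 2 := fun x => by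
    rw [← ENNReal.rpow_natCast]; norm_num
  simp only [h2, Pi.mul_apply] at h
  calc (∫⁻ x, f x * g x ∂μ) ^ 2
      ≤ ((∫⁻ x, f x ^ 2 ∂μ) ^ (1 / 2 : ℝ) * (∫⁻ x, g x ^ 2 ∂μ) ^ (1 / 2 : ℝ)) ^ 2 := by gcongr
    _ = _ := by
      rw [mul_pow, ← h2, ← h2, ← ENNReal.rpow_mul, ← ENNReal.rpow_mul]; norm_num

/-- Converse of the Cauchy–Schwarz inequality. -/
theorem lintegral_sq_le_of_forall_mul {F : R3 → ℝ≥0∞} (hF : AEMeasurable F) {K : ℝ≥0∞}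
    (h : ∀ S : R3 → ℝ≥0∞, AEMeasurable S → (∫⁻ x, F x * S x) ^ 2 ≤ K * ∫⁻ x, S x ^ 2) :
    ∫⁻ x, F x ^ 2 ≤ K := by
  -- Testing with `S = F` would require dividing by a possibly infinite integral. The truncations `S
  -- n ≤ F` have finite `∫ S²`, so `(∫ S²)² ≤ (∫ F S)² ≤ K ∫ S²` can be simplified before passing to
  -- the limit.
  let S : ℕ → R3 → ℝ≥0∞ := fun n => (Metric.closedBall (0 : R3) n).indicator fun x => min (F x) n
  have hS : ∀ n, AEMeasurable (S n) := fun n =>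
    (hF.min aemeasurable_const).indicator measurableSet_closedBall
  have hSF : ∀ n x, S n x ≤ F x := fun n x => by
    by_cases hx : x ∈ Metric.closedBall (0 : R3) n
    · simp [S, Set.indicator_of_mem hx]
    · simp [S, Set.indicator_of_notMem hx]
  have hmono : ∀ x, Monotone fun n => S n x := fun x m n hmn => by
    have hmn' : (m : ℝ) ≤ n := by exact_mod_cast hmn
    by_cases hx : x ∈ Metric.closedBall (0 : R3) m
    · have hx' : x ∈ Metric.closedBall (0 : R3) n := Metric.closedBall_subset_closedBall hmn' hx
      simp only [S, Set.indicator_of_mem hx, Set.indicator_of_mem hx']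
      gcongr
    · simp [S, Set.indicator_of_notMem hx]
  have hlim : ∀ x, Tendsto (fun n => S n x) atTop (𝓝 (F x)) := fun x => by
    have h1 : Tendsto (fun n : ℕ => min (F x) n) atTop (𝓝 (min (F x) ∞)) :=
      tendsto_const_nhds.min ENNReal.tendsto_nat_nhds_top
    simp only [le_top, inf_of_le_left] at h1
    refine h1.congr' ?_
    obtain ⟨N, hN⟩ := exists_nat_ge ‖x‖
    filter_upwards [eventually_ge_atTop N] with n hn
    have : (N : ℝ) ≤ n := by exact_mod_cast hn
    have hx : x ∈ Metric.closedBall (0 : R3) n := by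
      simp only [Metric.mem_closedBall, dist_zero_right]; linarith
    simp [S, Set.indicator_of_mem hx]
  have hfin : ∀ n, ∫⁻ x, S n x ^ 2 ≠ ∞ := fun n => by
    have : ∫⁻ x, S n x ^ 2 ≤ ∫⁻ x in Metric.closedBall (0 : R3) n, (n : ℝ≥0∞) ^ 2 := by
      rw [← lintegral_indicator measurableSet_closedBall]
      refine lintegral_mono fun x => ?_
      by_cases hx : x ∈ Metric.closedBall (0 : R3) n
      · simp only [S, Set.indicator_of_mem hx]
        gcongr
        exact min_le_right _ _
      · simp [S, Set.indicator_of_notMem hx]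
    refine ne_top_of_le_ne_top ?_ this
    rw [setLIntegral_const]
    exact ENNReal.mul_ne_top (by simp) (isCompact_closedBall _ _).measure_lt_top.ne
  have hle : ∀ n, ∫⁻ x, S n x ^ 2 ≤ K := fun n => by
    by_cases h0 : ∫⁻ x, S n x ^ 2 = 0
    · simp [h0]
    have h1 : (∫⁻ x, S n x ^ 2) ^ 2 ≤ K * ∫⁻ x, S n x ^ 2 := by
      refine le_trans ?_ (h (S n) (hS n))
      gcongr with x
      rw [sq]
      gcongr
      exact hSF n x
    rw [sq] at h1
    exact (ENNReal.mul_le_mul_iff_left h0 (hfin n)).1 h1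
  refine le_of_tendsto' (lintegral_tendsto_of_tendsto_of_monotone
    (fun n => (hS n).pow_const 2) (ae_of_all _ fun x m n hmn => ?_)
    (ae_of_all _ fun x => ?_)) hle
  · exact pow_le_pow_left₀ zero_le (hmono x hmn) 2
  · exact (ENNReal.continuous_pow 2).tendsto _ |>.comp (hlim x)

/-- Convolution of nonnegative functions. -/
def convE (A B : R3 → ℝ≥0∞) (ξ : R3) : ℝ≥0∞ := ∫⁻ ζ, A ζ * B (ξ - ζ)

/-- The part of the convolution where the first factor has the lower frequency. -/
def lowHigh (A B : R3 → ℝ≥0∞) (ξ : R3) : ℝ≥0∞ :=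
  ∫⁻ ζ, {ζ : R3 | ‖ζ‖ ≤ ‖ξ - ζ‖}.indicator (fun ζ => A ζ * B (ξ - ζ)) ζ

theorem quasiMeasurePreserving_add : Measure.QuasiMeasurePreserving
    (fun p : R3 × R3 => p.1 + p.2) (volume.prod volume) volume :=
  Measure.quasiMeasurePreserving_snd.comp (measurePreserving_prod_add volume volume).quasiMeasurePreserving

theorem quasiMeasurePreserving_snd_sub : Measure.QuasiMeasurePreserving
    (fun p : R3 × R3 => p.1 - p.2) (volume.prod volume) volume :=
  quasiMeasurePreserving_sub volume volume

theorem aemeasurable_lowHigh {A B : R3 → ℝ≥0∞} (hA : AEMeasurable A) (hB : AEMeasurable B) :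
    AEMeasurable (lowHigh A B) := by
  have : AEMeasurable (fun p : R3 × R3 => {p : R3 × R3 | ‖p.2‖ ≤ ‖p.1 - p.2‖}.indicator
      (fun p => A p.2 * B (p.1 - p.2)) p) (volume.prod volume) := by
    refine AEMeasurable.indicator ?_ ?_
    · exact (hA.comp_quasiMeasurePreserving Measure.quasiMeasurePreserving_snd).mul
        (hB.comp_quasiMeasurePreserving quasiMeasurePreserving_snd_sub)
    · exact measurableSet_le (by fun_prop) (by fun_prop)
  exact this.lintegral_prod_right'

theorem aemeasurable_convE {A B : R3 → ℝ≥0∞} (hA : AEMeasurable A) (hB : AEMeasurable B) :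
    AEMeasurable (convE A B) := by
  have : AEMeasurable (fun p : R3 × R3 => A p.2 * B (p.1 - p.2)) (volume.prod volume) :=
    (hA.comp_quasiMeasurePreserving Measure.quasiMeasurePreserving_snd).mul
        (hB.comp_quasiMeasurePreserving quasiMeasurePreserving_snd_sub)
  exact this.lintegral_prod_right'

theorem convE_le_add (A B : R3 → ℝ≥0∞) (hA : AEMeasurable A) (hB : AEMeasurable B) (ξ : R3) :
    convE A B ξ ≤ lowHigh A B ξ + lowHigh B A ξ := by
  have e : lowHigh B A ξ =
      ∫⁻ ζ, {ζ : R3 | ‖ξ - ζ‖ ≤ ‖ζ‖}.indicator (fun ζ => A ζ * B (ξ - ζ)) ζ := by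
    rw [lowHigh, ← lintegral_sub_left_eq_self _ ξ]
    refine lintegral_congr fun ζ => ?_
    simp only [Set.indicator, Set.mem_ofPred_eq, sub_sub_cancel, mul_comm]
  have hsub : Measure.QuasiMeasurePreserving (fun ζ : R3 => ξ - ζ) volume volume :=
    (volume.measurePreserving_sub_left ξ).quasiMeasurePreserving
  rw [e, lowHigh, ← lintegral_add_left']
  · refine lintegral_mono fun ζ => ?_
    rcases le_total ‖ζ‖ ‖ξ - ζ‖ with h | h
    · refine le_add_right ?_
      rw [Set.indicator_of_mem (by exact h)]
    · refine le_add_left ?_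
      rw [Set.indicator_of_mem (by exact h)]
  · exact (hA.mul (hB.comp_quasiMeasurePreserving hsub)).indicator
      (measurableSet_le (by fun_prop) (by fun_prop))

/-- Schur-type criterion for weighted bounds of the low-high part of a convolution. -/
theorem lintegral_lowHigh_le {M P Q A B : R3 → ℝ≥0∞} {C : ℝ≥0∞}
    (hM : Measurable M) (hP : Measurable P) (hQ : Measurable Q)
    (hA : AEMeasurable A) (hB : AEMeasurable B)
    (hP0 : ∀ᵐ ζ, P ζ ≠ 0 ∧ P ζ ≠ ∞) (hQ0 : ∀ᵐ η, Q η ≠ 0 ∧ Q η ≠ ∞)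
    (hK : ∀ η, ∫⁻ ζ in Metric.closedBall 0 ‖η‖, (M (ζ + η) / P ζ) ^ 2 ≤ C * Q η ^ 2) :
    ∫⁻ ξ, (M ξ * lowHigh A B ξ) ^ 2 ≤
      C * (∫⁻ ξ, (P ξ * A ξ) ^ 2) * ∫⁻ ξ, (Q ξ * B ξ) ^ 2 := by
  have hF : AEMeasurable (fun ξ => M ξ * lowHigh A B ξ) :=
    hM.aemeasurable.mul (aemeasurable_lowHigh hA hB)
  refine lintegral_sq_le_of_forall_mul hF ?_
  intro S hS
  have qadd : ∀ η : R3, Measure.QuasiMeasurePreserving (fun ζ : R3 => ζ + η) volume volume :=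
    fun η => (measurePreserving_add_right volume η).quasiMeasurePreserving
  have qadd' : Measure.QuasiMeasurePreserving (fun p : R3 × R3 => p.2 + p.1)
      (volume.prod volume) volume := by
    simpa [add_comm] using! quasiMeasurePreserving_add
  -- the trilinear form
  have e1 : ∫⁻ ξ, (M ξ * lowHigh A B ξ) * S ξ =
      ∫⁻ η, B η * ∫⁻ ζ in Metric.closedBall 0 ‖η‖, A ζ * (M (ζ + η) * S (ζ + η)) := by
    have hm1 : AEMeasurable (fun p : R3 × R3 => {p : R3 × R3 | ‖p.2‖ ≤ ‖p.1 - p.2‖}.indicator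
        (fun p => A p.2 * B (p.1 - p.2)) p * (M p.1 * S p.1)) (volume.prod volume) := by
      refine AEMeasurable.mul (AEMeasurable.indicator ?_ ?_) ?_
      · exact (hA.comp_quasiMeasurePreserving Measure.quasiMeasurePreserving_snd).mul
          (hB.comp_quasiMeasurePreserving quasiMeasurePreserving_snd_sub)
      · exact measurableSet_le (by fun_prop) (by fun_prop)
      · exact (hM.aemeasurable.mul hS).comp_quasiMeasurePreserving Measure.quasiMeasurePreserving_fst
    have hm2 : AEMeasurable (fun p : R3 × R3 => {p : R3 × R3 | ‖p.1‖ ≤ ‖p.2‖}.indicator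
        (fun p => A p.1 * B p.2) p * (M (p.1 + p.2) * S (p.1 + p.2))) (volume.prod volume) := by
      refine AEMeasurable.mul (AEMeasurable.indicator ?_ ?_) ?_
      · exact (hA.comp_quasiMeasurePreserving Measure.quasiMeasurePreserving_fst).mul
          (hB.comp_quasiMeasurePreserving Measure.quasiMeasurePreserving_snd)
      · exact measurableSet_le (by fun_prop) (by fun_prop)
      · exact (hM.aemeasurable.mul hS).comp_quasiMeasurePreserving quasiMeasurePreserving_add
    calc ∫⁻ ξ, (M ξ * lowHigh A B ξ) * S ξ
        = ∫⁻ ξ, ∫⁻ ζ, {ζ : R3 | ‖ζ‖ ≤ ‖ξ - ζ‖}.indicator (fun ζ => A ζ * B (ξ - ζ)) ζ *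
            (M ξ * S ξ) := by
          refine lintegral_congr fun ξ => ?_
          rw [lintegral_mul_const'', lowHigh]
          · ring
          · have hsub : Measure.QuasiMeasurePreserving (fun ζ : R3 => ξ - ζ) volume volume :=
              (volume.measurePreserving_sub_left ξ).quasiMeasurePreserving
            exact (hA.mul (hB.comp_quasiMeasurePreserving hsub)).indicator
              (measurableSet_le (by fun_prop) (by fun_prop))
      _ = ∫⁻ ζ, ∫⁻ ξ, {ζ : R3 | ‖ζ‖ ≤ ‖ξ - ζ‖}.indicator (fun ζ => A ζ * B (ξ - ζ)) ζ *
            (M ξ * S ξ) := lintegral_lintegral_swap hm1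
      _ = ∫⁻ ζ, ∫⁻ η, {p : R3 × R3 | ‖p.1‖ ≤ ‖p.2‖}.indicator
            (fun p => A p.1 * B p.2) (ζ, η) * (M (ζ + η) * S (ζ + η)) := by
          refine lintegral_congr fun ζ => ?_
          rw [← lintegral_add_left_eq_self _ ζ]
          refine lintegral_congr fun η => ?_
          simp only [Set.indicator, Set.mem_ofPred_eq, add_sub_cancel_left]
      _ = ∫⁻ η, ∫⁻ ζ, {p : R3 × R3 | ‖p.1‖ ≤ ‖p.2‖}.indicator
            (fun p => A p.1 * B p.2) (ζ, η) * (M (ζ + η) * S (ζ + η)) :=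
          lintegral_lintegral_swap hm2
      _ = _ := by
          refine lintegral_congr fun η => ?_
          rw [← lintegral_const_mul'', ← lintegral_indicator measurableSet_closedBall]
          · refine lintegral_congr fun ζ => ?_
            simp only [Set.indicator, Set.mem_ofPred_eq, Metric.mem_closedBall, dist_zero_right]
            split_ifs <;> ring
          · exact (hA.mul (((hM.aemeasurable.mul hS).comp_quasiMeasurePreserving
              (qadd η)))).restrict
  set T : R3 → ℝ≥0∞ := fun η =>
    ∫⁻ ζ in Metric.closedBall 0 ‖η‖, A ζ * (M (ζ + η) * S (ζ + η)) with hT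
  have hTm : AEMeasurable T := by
    have : AEMeasurable (fun p : R3 × R3 => {p : R3 × R3 | ‖p.2‖ ≤ ‖p.1‖}.indicator
        (fun p => A p.2 * (M (p.2 + p.1) * S (p.2 + p.1))) p) (volume.prod volume) := by
      refine AEMeasurable.indicator ?_ ?_
      · exact (hA.comp_quasiMeasurePreserving Measure.quasiMeasurePreserving_snd).mul
          ((hM.aemeasurable.mul hS).comp_quasiMeasurePreserving qadd')
      · exact measurableSet_le (by fun_prop) (by fun_prop)
    have h2 := this.lintegral_prod_right'
    convert h2 using 1
    ext η
    simp only [hT]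
    rw [← lintegral_indicator measurableSet_closedBall]
    refine lintegral_congr fun ζ => ?_
    simp [Set.indicator]
  -- Cauchy–Schwarz in `ζ` at fixed `η`: the kernel `M (ζ + η) / P ζ` is square integrable on the
  -- ball by `hK`.
  have hTsq : ∀ η, T η ^ 2 ≤ C * Q η ^ 2 * ∫⁻ ζ, (P ζ * A ζ) ^ 2 * S (ζ + η) ^ 2 := fun η => by
    have hT' : T η = ∫⁻ ζ in Metric.closedBall 0 ‖η‖,
        (M (ζ + η) / P ζ) * (P ζ * A ζ * S (ζ + η)) := by
      refine lintegral_congr_ae ?_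
      filter_upwards [ae_restrict_of_ae hP0] with ζ hζ
      rw [div_eq_mul_inv]
      calc A ζ * (M (ζ + η) * S (ζ + η))
          = ((P ζ)⁻¹ * P ζ) * (A ζ * (M (ζ + η) * S (ζ + η))) := by
            rw [ENNReal.inv_mul_cancel hζ.1 hζ.2, one_mul]
        _ = _ := by ring
    rw [hT']
    refine (lintegral_mul_sq_le ?_ ?_).trans ?_
    · exact ((hM.comp (measurable_add_const η)).div hP).aemeasurable
    · exact ((hP.aemeasurable.mul hA).mul (hS.comp_quasiMeasurePreserving (qadd η))).restrict
    · refine mul_le_mul' (hK η) ?_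
      simp only [mul_pow]
      exact setLIntegral_le_lintegral _ _
  -- By translation invariance the double integral factors; a second Cauchy–Schwarz, in `η`, then
  -- ends the proof.
  have hdouble : ∫⁻ η, ∫⁻ ζ, (P ζ * A ζ) ^ 2 * S (ζ + η) ^ 2 =
      (∫⁻ ζ, (P ζ * A ζ) ^ 2) * ∫⁻ η, S η ^ 2 := by
    rw [lintegral_lintegral_swap]
    · have hPA : AEMeasurable (fun ζ => (P ζ * A ζ) ^ 2) := (hP.aemeasurable.mul hA).pow_const 2
      rw [← lintegral_mul_const'' _ hPA]
      refine lintegral_congr fun ζ => ?_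
      rw [lintegral_const_mul'']
      · rw [lintegral_add_left_eq_self (fun η => S η ^ 2) ζ]
      · exact (hS.comp_quasiMeasurePreserving
          (measurePreserving_add_left volume ζ).quasiMeasurePreserving).pow_const 2
    · exact (((hP.aemeasurable.mul hA).pow_const 2).comp_quasiMeasurePreserving
        Measure.quasiMeasurePreserving_snd).mul ((hS.pow_const 2).comp_quasiMeasurePreserving qadd')
  rw [e1]
  have e2 : ∫⁻ η, B η * T η = ∫⁻ η, (Q η * B η) * (T η / Q η) := by
    refine lintegral_congr_ae ?_
    filter_upwards [hQ0] with η hη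
    rw [div_eq_mul_inv]
    calc B η * T η = ((Q η)⁻¹ * Q η) * (B η * T η) := by
          rw [ENNReal.inv_mul_cancel hη.1 hη.2, one_mul]
      _ = _ := by ring
  rw [e2]
  refine (lintegral_mul_sq_le (hQ.aemeasurable.mul hB) (hTm.div hQ.aemeasurable)).trans ?_
  have h3 : ∫⁻ η, (T η / Q η) ^ 2 ≤ C * ((∫⁻ ζ, (P ζ * A ζ) ^ 2) * ∫⁻ η, S η ^ 2) := by
    rw [← hdouble, ← lintegral_const_mul'']
    · refine lintegral_mono_ae ?_
      filter_upwards [hQ0] with η hη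
      rw [div_eq_mul_inv, mul_pow]
      refine (mul_le_mul_left (hTsq η) _).trans (le_of_eq ?_)
      rw [← ENNReal.inv_pow]
      calc C * Q η ^ 2 * (∫⁻ ζ, (P ζ * A ζ) ^ 2 * S (ζ + η) ^ 2) * (Q η ^ 2)⁻¹
          = (Q η ^ 2 * (Q η ^ 2)⁻¹) * (C * ∫⁻ ζ, (P ζ * A ζ) ^ 2 * S (ζ + η) ^ 2) := by ring
        _ = _ := by
          rw [ENNReal.mul_inv_cancel (pow_ne_zero 2 hη.1) (ENNReal.pow_ne_top hη.2), one_mul]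
    · have : AEMeasurable (fun p : R3 × R3 => (P p.2 * A p.2) ^ 2 * S (p.2 + p.1) ^ 2)
          (volume.prod volume) :=
        (((hP.aemeasurable.mul hA).pow_const 2).comp_quasiMeasurePreserving
          Measure.quasiMeasurePreserving_snd).mul ((hS.pow_const 2).comp_quasiMeasurePreserving qadd')
      exact this.lintegral_prod_right'
  calc _ ≤ (∫⁻ η, (Q η * B η) ^ 2) * (C * ((∫⁻ ζ, (P ζ * A ζ) ^ 2) * ∫⁻ η, S η ^ 2)) :=
        mul_le_mul' le_rfl h3
    _ = _ := by ring

/-! ### Power weights -/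

/-- The weight `|2πξ|^s`. -/
def wt (s : ℝ) (ξ : R3) : ℝ≥0∞ := ENNReal.ofReal ((2 * Real.pi * ‖ξ‖) ^ s)

theorem measurable_wt (s : ℝ) : Measurable (wt s) := by unfold wt; fun_prop

theorem wt_ne_top (s : ℝ) (ξ : R3) : wt s ξ ≠ ∞ := ENNReal.ofReal_ne_top

theorem two_pi_norm_pos {ξ : R3} (h : ξ ≠ 0) : 0 < 2 * Real.pi * ‖ξ‖ := by
  have := norm_pos_iff.2 h; positivity

theorem wt_ne_zero (s : ℝ) {ξ : R3} (h : ξ ≠ 0) : wt s ξ ≠ 0 := by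
  simpa [wt] using Real.rpow_pos_of_pos (two_pi_norm_pos h) s

theorem ae_ne_zero : ∀ᵐ ξ : R3, ξ ≠ 0 := by
  simp [ae_iff, measure_singleton]

theorem wt_add {s t : ℝ} {ξ : R3} (h : ξ ≠ 0) : wt (s + t) ξ = wt s ξ * wt t ξ := by
  rw [wt, Real.rpow_add (two_pi_norm_pos h), ENNReal.ofReal_mul (by positivity)]; rfl

theorem wt_zero (ξ : R3) : wt 0 ξ = 1 := by simp [wt]

theorem wt_sq (s : ℝ) (ξ : R3) : wt s ξ ^ 2 = wt (2 * s) ξ := by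
  rw [wt, wt, ← ENNReal.ofReal_pow (by positivity), mul_comm 2 s, Real.rpow_mul (by positivity)]
  norm_num

theorem wt_rpow (s : ℝ) {t : ℝ} (ht : 0 ≤ t) (ξ : R3) : wt s ξ ^ t = wt (s * t) ξ := by
  rw [wt, wt, ENNReal.ofReal_rpow_of_nonneg (by positivity) ht, Real.rpow_mul (by positivity)]

theorem lintegral_closedBall_rpow {s : ℝ} (hs : s < 3) (R : ℝ) (hR : 0 ≤ R) :
    ∫⁻ ζ in Metric.closedBall (0 : R3) R, ENNReal.ofReal (‖ζ‖ ^ (-s)) =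
      ENNReal.ofReal (3 * volume.real (Metric.ball (0 : R3) 1) / (3 - s) * R ^ (3 - s)) := by
  have hd : Module.finrank ℝ R3 = 3 := by simp
  have hI : IntegrableOn (fun y : ℝ => y ^ (2 - s)) (Set.Ioc 0 R) := by
    rw [← intervalIntegrable_iff_integrableOn_Ioc_of_le hR]
    exact intervalIntegral.intervalIntegrable_rpow' (by linarith)
  set f : ℝ → ℝ := (Set.Iic R).indicator fun y => y ^ (-s) with hf
  have e1 : ∀ y ∈ Set.Ioi (0 : ℝ), y ^ (Module.finrank ℝ R3 - 1) • f y =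
      (Set.Ioc 0 R).indicator (fun y => y ^ (2 - s)) y := by
    intro y hy
    rw [hd]
    by_cases h : y ≤ R
    · rw [hf, Set.indicator_of_mem (by exact h), Set.indicator_of_mem (show y ∈ Set.Ioc 0 R from ⟨hy, h⟩), smul_eq_mul,
        ← Real.rpow_natCast, ← Real.rpow_add hy]
      norm_num [sub_eq_add_neg]
    · rw [hf, Set.indicator_of_notMem (by exact h), Set.indicator_of_notMem (fun h' => h h'.2)]
      simp
  have hlimInt : Integrable (fun x : R3 => f ‖x‖) := by
    rw [integrable_fun_norm_addHaar volume]
    refine IntegrableOn.congr_fun ?_ (fun y hy => (e1 y hy).symm) measurableSet_Ioi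
    exact (hI.integrable_indicator measurableSet_Ioc).integrableOn
  have hval : ∫ x : R3, f ‖x‖ =
      3 * volume.real (Metric.ball (0 : R3) 1) / (3 - s) * R ^ (3 - s) := by
    rw [integral_fun_norm_addHaar volume, setIntegral_congr_fun measurableSet_Ioi e1,
      setIntegral_indicator measurableSet_Ioc, Set.inter_eq_right.2 Set.Ioc_subset_Ioi_self,
      ← intervalIntegral.integral_of_le hR, integral_rpow (Or.inl (by linarith)), hd]
    have h3 : 2 - s + 1 = 3 - s := by ring
    rw [h3, Real.zero_rpow (by linarith)]
    simp only [nsmul_eq_mul, smul_eq_mul, sub_zero]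
    push_cast
    ring
  rw [← hval, ofReal_integral_eq_lintegral_ofReal hlimInt, ← lintegral_indicator
    measurableSet_closedBall]
  · refine lintegral_congr fun ζ => ?_
    simp only [hf, Set.indicator, Metric.mem_closedBall, dist_zero_right, Set.mem_Iic]
    split_ifs <;> simp
  · refine ae_of_all _ fun x => ?_
    simp only [hf, Set.indicator, Pi.zero_apply]
    split_ifs
    · positivity
    · exact le_rfl

/-- Low-high estimate for weights of moderate growth. -/
theorem exists_lowHigh_moderate {σ : ℝ} (hσ : σ < 3 / 2) : ∃ C : ℝ≥0,
    ∀ (ω A B : R3 → ℝ≥0∞), Measurable ω → AEMeasurable A → AEMeasurable B →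
      (∀ ζ, ζ ≠ 0 → ω ζ ≠ 0 ∧ ω ζ ≠ ∞) →
      (∀ x ζ η : R3, ‖x‖ ≤ 2 * ‖η‖ → ζ ≠ 0 → ‖ζ‖ ≤ ‖η‖ →
        ω x ≤ ENNReal.ofReal (2 ^ σ * (‖η‖ / ‖ζ‖) ^ σ) * ω ζ) →
      ∫⁻ ξ, (ω ξ * lowHigh A B ξ) ^ 2 ≤
        C * (∫⁻ ξ, (ω ξ * A ξ) ^ 2) * ∫⁻ ξ, (wt (3 / 2) ξ * B ξ) ^ 2 := by
  set c := 3 * volume.real (Metric.ball (0 : R3) 1) / (3 - 2 * σ) with hc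
  have hc0 : 0 ≤ c := div_nonneg (by positivity) (by linarith)
  refine ⟨(2 ^ (2 * σ) * c).toNNReal, fun ω A B hω hA hB h0 hmod => ?_⟩
  refine lintegral_lowHigh_le hω hω (measurable_wt _) hA hB
    (ae_ne_zero.mono fun ζ h => h0 ζ h)
    (ae_ne_zero.mono fun ζ h => ⟨wt_ne_zero _ h, wt_ne_top _ _⟩) fun η => ?_
  -- On the ball `‖ζ + η‖ ≤ 2 ‖η‖`, so the moderate growth bounds the kernel by a multiple of `(‖η‖
  -- / ‖ζ‖)^(2σ)`. This is integrable at the origin because `2σ < 3`, and its integral scales like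
  -- `‖η‖³`, the square of the `Ḣ^{3/2}` weight.
  have h1 : ∀ᵐ ζ ∂(volume.restrict (Metric.closedBall (0 : R3) ‖η‖)),
      (ω (ζ + η) / ω ζ) ^ 2 ≤
        ENNReal.ofReal (2 ^ (2 * σ) * ‖η‖ ^ (2 * σ)) * ENNReal.ofReal (‖ζ‖ ^ (-(2 * σ))) := by
    filter_upwards [ae_restrict_mem measurableSet_closedBall, ae_restrict_of_ae ae_ne_zero]
      with ζ hζ hζ0
    have hle : ‖ζ‖ ≤ ‖η‖ := by simpa using hζ
    have hp : 0 < ‖ζ‖ := norm_pos_iff.2 hζ0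
    have h2 := hmod (ζ + η) ζ η ((norm_add_le _ _).trans (by linarith)) hζ0 hle
    have h3 : ω (ζ + η) / ω ζ ≤ ENNReal.ofReal (2 ^ σ * (‖η‖ / ‖ζ‖) ^ σ) :=
      ENNReal.div_le_of_le_mul h2
    calc (ω (ζ + η) / ω ζ) ^ 2 ≤ ENNReal.ofReal (2 ^ σ * (‖η‖ / ‖ζ‖) ^ σ) ^ 2 := by gcongr
      _ = _ := by
        rw [← ENNReal.ofReal_pow (by positivity), ← ENNReal.ofReal_mul (by positivity)]
        congr 1
        rw [mul_pow, Real.div_rpow (by positivity) hp.le, div_pow, Real.rpow_neg hp.le,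
          mul_comm 2 σ, Real.rpow_mul (by positivity), Real.rpow_mul (by positivity),
          Real.rpow_mul hp.le]
        norm_num
        ring
  refine (lintegral_mono_ae h1).trans ?_
  rw [lintegral_const_mul' _ _ ENNReal.ofReal_ne_top,
    lintegral_closedBall_rpow (by linarith) _ (norm_nonneg _), wt_sq, wt,
    ← ENNReal.ofReal_mul (by positivity)]
  rw [show ((2 ^ (2 * σ) * c).toNNReal : ℝ≥0∞) = ENNReal.ofReal (2 ^ (2 * σ) * c) from rfl,
    ← ENNReal.ofReal_mul (by positivity)]
  refine ENNReal.ofReal_le_ofReal ?_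
  rw [← hc]
  rcases eq_or_ne η 0 with rfl | hη
  · simp only [norm_zero]
    rw [Real.zero_rpow (by linarith : 3 - 2 * σ ≠ 0)]
    simp
  have hp : 0 < ‖η‖ := norm_pos_iff.2 hη
  have e : ‖η‖ ^ (2 * σ) * ‖η‖ ^ (3 - 2 * σ) = ‖η‖ ^ (2 * (3 / 2) : ℝ) := by
    rw [← Real.rpow_add hp]; congr 1; ring
  have : ‖η‖ ^ (2 * (3 / 2) : ℝ) ≤ (2 * Real.pi * ‖η‖) ^ (2 * (3 / 2) : ℝ) := by
    refine Real.rpow_le_rpow hp.le ?_ (by norm_num)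
    nlinarith [Real.pi_gt_three]
  calc 2 ^ (2 * σ) * ‖η‖ ^ (2 * σ) * (c * ‖η‖ ^ (3 - 2 * σ))
      = 2 ^ (2 * σ) * c * (‖η‖ ^ (2 * σ) * ‖η‖ ^ (3 - 2 * σ)) := by ring
    _ ≤ _ := by rw [e]; gcongr

/-- Low-high estimate for power weights. -/
theorem exists_lowHigh_power {s t c : ℝ} (hs0 : 0 ≤ s) (hs : s < 3 / 2) (ht : 0 < t)
    (hc : s + t = c + 3 / 2) : ∃ C : ℝ≥0,
    ∀ (A B : R3 → ℝ≥0∞), AEMeasurable A → AEMeasurable B →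
      ∫⁻ ξ, (wt c ξ * lowHigh A B ξ) ^ 2 ≤
        C * (∫⁻ ξ, (wt s ξ * A ξ) ^ 2) * ∫⁻ ξ, (wt t ξ * B ξ) ^ 2 := by
  suffices H : ∃ C : ℝ≥0, ∀ η : R3, ∫⁻ ζ in Metric.closedBall 0 ‖η‖,
      (wt c (ζ + η) / wt s ζ) ^ 2 ≤ C * wt t η ^ 2 by
    obtain ⟨C, hC⟩ := H
    exact ⟨C, fun A B hA hB => lintegral_lowHigh_le (measurable_wt _) (measurable_wt _)
      (measurable_wt _) hA hB (ae_ne_zero.mono fun ζ h => ⟨wt_ne_zero _ h, wt_ne_top _ _⟩)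
      (ae_ne_zero.mono fun ζ h => ⟨wt_ne_zero _ h, wt_ne_top _ _⟩) hC⟩
  have hsq : ∀ {η ζ : R3}, ζ ≠ 0 → (wt c (ζ + η) / wt s ζ) ^ 2 =
      ENNReal.ofReal ((2 * Real.pi * ‖ζ + η‖) ^ (2 * c) * (2 * Real.pi * ‖ζ‖) ^ (-(2 * s))) := by
    intro η ζ hζ
    rw [div_eq_mul_inv, mul_pow, ← ENNReal.inv_pow, wt_sq, wt_sq, wt, wt,
      ← ENNReal.ofReal_inv_of_pos (Real.rpow_pos_of_pos (two_pi_norm_pos hζ) _),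
      ← ENNReal.ofReal_mul (by positivity), Real.rpow_neg (by positivity)]
  have hpi : (0 : ℝ) ≤ 2 * Real.pi := by positivity
  -- For `c ≥ 0` the output weight is largest when `‖ζ + η‖ = 2 ‖η‖`. For `c < 0` it is singular at
  -- `ζ = -η`, and a second singularity has to be integrated.
  rcases le_or_gt 0 c with hc0 | hc0
  · set K := 3 * volume.real (Metric.ball (0 : R3) 1) / (3 - 2 * s) with hK
    have hK0 : 0 ≤ K := div_nonneg (by positivity) (by linarith)
    refine ⟨(2 ^ (2 * c) * (2 * Real.pi) ^ (-3 : ℝ) * K).toNNReal, fun η => ?_⟩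
    have h1 : ∀ᵐ ζ ∂(volume.restrict (Metric.closedBall (0 : R3) ‖η‖)),
        (wt c (ζ + η) / wt s ζ) ^ 2 ≤
          ENNReal.ofReal ((2 * Real.pi * (2 * ‖η‖)) ^ (2 * c) * (2 * Real.pi) ^ (-(2 * s))) *
            ENNReal.ofReal (‖ζ‖ ^ (-(2 * s))) := by
      filter_upwards [ae_restrict_mem measurableSet_closedBall, ae_restrict_of_ae ae_ne_zero]
        with ζ hζ hζ0
      have hle : ‖ζ‖ ≤ ‖η‖ := by simpa using hζ
      rw [hsq hζ0, ← ENNReal.ofReal_mul (by positivity), Real.mul_rpow hpi (norm_nonneg ζ),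
        ← mul_assoc]
      gcongr
      exact (norm_add_le _ _).trans (by linarith)
    refine (lintegral_mono_ae h1).trans ?_
    rw [lintegral_const_mul' _ _ ENNReal.ofReal_ne_top,
      lintegral_closedBall_rpow (by linarith) _ (norm_nonneg _), wt_sq, wt,
      ← ENNReal.ofReal_mul (by positivity), ← hK,
      show ((2 ^ (2 * c) * (2 * Real.pi) ^ (-3 : ℝ) * K).toNNReal : ℝ≥0∞) =
        ENNReal.ofReal (2 ^ (2 * c) * (2 * Real.pi) ^ (-3 : ℝ) * K) from rfl,
      ← ENNReal.ofReal_mul (by positivity)]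
    refine ENNReal.ofReal_le_ofReal ?_
    rcases eq_or_ne η 0 with rfl | hη
    · simp only [norm_zero]
      rw [Real.zero_rpow (by linarith : 3 - 2 * s ≠ 0)]
      simp only [mul_zero]
      positivity
    have hp : 0 < ‖η‖ := norm_pos_iff.2 hη
    have hpi' : 0 < 2 * Real.pi := by positivity
    have e1 : (2 * Real.pi) ^ (2 * c) * (2 * Real.pi) ^ (-(2 * s)) =
        (2 * Real.pi) ^ (-3 : ℝ) * (2 * Real.pi) ^ (2 * t) := by
      rw [← Real.rpow_add hpi', ← Real.rpow_add hpi']; congr 1; linarith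
    have e2 : ‖η‖ ^ (2 * c) * ‖η‖ ^ (3 - 2 * s) = ‖η‖ ^ (2 * t) := by
      rw [← Real.rpow_add hp]; congr 1; linarith
    refine le_of_eq ?_
    rw [Real.mul_rpow hpi (by positivity), Real.mul_rpow (by norm_num) hp.le,
      Real.mul_rpow hpi hp.le, ← e2]
    linear_combination (2 ^ (2 * c) * ‖η‖ ^ (2 * c) * K * ‖η‖ ^ (3 - 2 * s)) * e1
  -- By the scaling relation `q = 3 - 2t`, so `t > 0` is exactly integrability of the merged
  -- singularity.
  · set q := 2 * (s - c) with hq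
    have hq3 : q < 3 := by rw [hq]; linarith
    set K := 3 * volume.real (Metric.ball (0 : R3) 1) / (3 - q) with hK
    have hK0 : 0 ≤ K := div_nonneg (by positivity) (by linarith)
    refine ⟨((2 * Real.pi) ^ (-3 : ℝ) * (K + K * 2 ^ (3 - q))).toNNReal, fun η => ?_⟩
    have h1 : ∀ᵐ ζ ∂(volume.restrict (Metric.closedBall (0 : R3) ‖η‖)),
        (wt c (ζ + η) / wt s ζ) ^ 2 ≤
          ENNReal.ofReal ((2 * Real.pi) ^ (-q)) * (ENNReal.ofReal (‖ζ‖ ^ (-q)) +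
            ENNReal.ofReal (‖ζ + η‖ ^ (-q))) := by
      have hne : ∀ᵐ ζ : R3, ζ + η ≠ 0 :=
        ((measurePreserving_add_right volume η).quasiMeasurePreserving.ae ae_ne_zero)
      filter_upwards [ae_restrict_of_ae hne, ae_restrict_of_ae ae_ne_zero]
        with ζ hζ hζ0
      have p1 : 0 < ‖ζ‖ := norm_pos_iff.2 hζ0
      have p2 : 0 < ‖ζ + η‖ := norm_pos_iff.2 hζ
      rw [hsq hζ0, ← ENNReal.ofReal_add (by positivity) (by positivity),
        ← ENNReal.ofReal_mul (by positivity)]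
      refine ENNReal.ofReal_le_ofReal ?_
      have hpi' : 0 < 2 * Real.pi := by positivity
      rw [Real.mul_rpow hpi p1.le, Real.mul_rpow hpi p2.le]
      have e1 : (2 * Real.pi) ^ (2 * c) * (2 * Real.pi) ^ (-(2 * s)) = (2 * Real.pi) ^ (-q) := by
        rw [← Real.rpow_add hpi']; congr 1; rw [hq]; ring
      -- Both exponents are nonpositive, so replacing the larger of the two norms by the smaller one
      -- increases the product and leaves a single power `-q`.
      have key : ‖ζ + η‖ ^ (2 * c) * ‖ζ‖ ^ (-(2 * s)) ≤ ‖ζ‖ ^ (-q) + ‖ζ + η‖ ^ (-q) := by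
        rcases le_total ‖ζ‖ ‖ζ + η‖ with h | h
        · calc ‖ζ + η‖ ^ (2 * c) * ‖ζ‖ ^ (-(2 * s)) ≤ ‖ζ‖ ^ (2 * c) * ‖ζ‖ ^ (-(2 * s)) := by
                refine mul_le_mul_of_nonneg_right ?_ (by positivity)
                exact Real.rpow_le_rpow_of_nonpos p1 h (by linarith)
            _ = ‖ζ‖ ^ (-q) := by rw [← Real.rpow_add p1]; congr 1; rw [hq]; ring
            _ ≤ _ := le_add_of_nonneg_right (by positivity)
        · calc ‖ζ + η‖ ^ (2 * c) * ‖ζ‖ ^ (-(2 * s))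
              ≤ ‖ζ + η‖ ^ (2 * c) * ‖ζ + η‖ ^ (-(2 * s)) := by
                refine mul_le_mul_of_nonneg_left ?_ (by positivity)
                exact Real.rpow_le_rpow_of_nonpos p2 h (by linarith)
            _ = ‖ζ + η‖ ^ (-q) := by rw [← Real.rpow_add p2]; congr 1; rw [hq]; ring
            _ ≤ _ := le_add_of_nonneg_left (by positivity)
      calc _ = (2 * Real.pi) ^ (-q) * (‖ζ + η‖ ^ (2 * c) * ‖ζ‖ ^ (-(2 * s))) := by
            rw [← e1]; ring
        _ ≤ _ := by gcongr
    -- Translating the ball by `η` puts it inside the centred ball of twice the radius, whence the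
    -- factor `2 ^ (3 - q)` in the constant.
    have h2 : ∫⁻ ζ in Metric.closedBall (0 : R3) ‖η‖, ENNReal.ofReal (‖ζ + η‖ ^ (-q)) ≤
        ∫⁻ ζ in Metric.closedBall (0 : R3) (2 * ‖η‖), ENNReal.ofReal (‖ζ‖ ^ (-q)) := by
      rw [← lintegral_indicator measurableSet_closedBall,
        ← lintegral_indicator measurableSet_closedBall,
        ← lintegral_add_right_eq_self ((Metric.closedBall (0 : R3) (2 * ‖η‖)).indicator _) η]
      refine lintegral_mono fun ζ => ?_
      by_cases h : ζ ∈ Metric.closedBall (0 : R3) ‖η‖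
      · have h' : ζ + η ∈ Metric.closedBall (0 : R3) (2 * ‖η‖) := by
          simp only [Metric.mem_closedBall, dist_zero_right] at h ⊢
          exact (norm_add_le _ _).trans (by linarith)
        rw [Set.indicator_of_mem h, Set.indicator_of_mem h']
      · rw [Set.indicator_of_notMem h]; exact zero_le
    refine (lintegral_mono_ae h1).trans ?_
    rw [lintegral_const_mul' _ _ ENNReal.ofReal_ne_top, lintegral_add_left (by fun_prop)]
    refine (mul_le_mul_right (add_le_add_right h2 _) _).trans ?_
    rw [lintegral_closedBall_rpow hq3 _ (norm_nonneg _),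
      lintegral_closedBall_rpow hq3 _ (by positivity), wt_sq, wt, ← hK,
      ← ENNReal.ofReal_add (by positivity) (by positivity),
      ← ENNReal.ofReal_mul (by positivity),
      show (((2 * Real.pi) ^ (-3 : ℝ) * (K + K * 2 ^ (3 - q))).toNNReal : ℝ≥0∞) =
        ENNReal.ofReal ((2 * Real.pi) ^ (-3 : ℝ) * (K + K * 2 ^ (3 - q))) from rfl,
      ← ENNReal.ofReal_mul (by positivity)]
    refine ENNReal.ofReal_le_ofReal (le_of_eq ?_)
    have hpi' : 0 < 2 * Real.pi := by positivity
    have e3 : 3 - q = 2 * t := by rw [hq]; linarith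
    have e4 : (2 * Real.pi) ^ (-q) = (2 * Real.pi) ^ (-3 : ℝ) * (2 * Real.pi) ^ (2 * t) := by
      rw [← Real.rpow_add hpi']; congr 1; linarith
    rw [Real.mul_rpow hpi (norm_nonneg _), Real.mul_rpow (by norm_num) (norm_nonneg _), e3, e4]
    ring

theorem add_sq_le_two_mul (x y : ℝ≥0∞) : (x + y) ^ 2 ≤ 2 * (x ^ 2 + y ^ 2) := by
  have h := ENNReal.rpow_add_le_mul_rpow_add_rpow x y (p := 2) (by norm_num)
  norm_num at h
  exact_mod_cast h

theorem lintegral_mul_convE_sq_le {M A B : R3 → ℝ≥0∞} (hM : Measurable M) (hA : AEMeasurable A)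
    (hB : AEMeasurable B) :
    ∫⁻ ξ, (M ξ * convE A B ξ) ^ 2 ≤
      2 * ((∫⁻ ξ, (M ξ * lowHigh A B ξ) ^ 2) + ∫⁻ ξ, (M ξ * lowHigh B A ξ) ^ 2) := by
  have h1 : AEMeasurable fun ξ => (M ξ * lowHigh A B ξ) ^ 2 :=
    (hM.aemeasurable.mul (aemeasurable_lowHigh hA hB)).pow_const 2
  rw [← lintegral_add_left' h1, ← lintegral_const_mul' _ _ (by norm_num)]
  refine lintegral_mono fun ξ => ?_
  refine le_trans ?_ (add_sq_le_two_mul _ _)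
  rw [← mul_add]
  gcongr
  exact convE_le_add A B hA hB ξ

theorem exists_convE_moderate {σ : ℝ} (hσ : σ < 3 / 2) : ∃ C : ℝ≥0,
    ∀ (ω A : R3 → ℝ≥0∞), Measurable ω → AEMeasurable A →
      (∀ ζ, ζ ≠ 0 → ω ζ ≠ 0 ∧ ω ζ ≠ ∞) →
      (∀ x ζ η : R3, ‖x‖ ≤ 2 * ‖η‖ → ζ ≠ 0 → ‖ζ‖ ≤ ‖η‖ →
        ω x ≤ ENNReal.ofReal (2 ^ σ * (‖η‖ / ‖ζ‖) ^ σ) * ω ζ) →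
      ∫⁻ ξ, (ω ξ * convE A A ξ) ^ 2 ≤
        C * (∫⁻ ξ, (ω ξ * A ξ) ^ 2) * ∫⁻ ξ, (wt (3 / 2) ξ * A ξ) ^ 2 := by
  obtain ⟨C, hC⟩ := exists_lowHigh_moderate hσ
  refine ⟨4 * C, fun ω A hω hA h0 hmod => ?_⟩
  refine (lintegral_mul_convE_sq_le hω hA hA).trans ?_
  have h := hC ω A A hω hA hA h0 hmod
  calc _ ≤ 2 * (C * (∫⁻ ξ, (ω ξ * A ξ) ^ 2) * (∫⁻ ξ, (wt (3 / 2) ξ * A ξ) ^ 2) +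
        C * (∫⁻ ξ, (ω ξ * A ξ) ^ 2) * ∫⁻ ξ, (wt (3 / 2) ξ * A ξ) ^ 2) := by gcongr
    _ = _ := by push_cast; ring

theorem exists_convE_power {s t c : ℝ} (hs0 : 0 ≤ s) (hs : s < 3 / 2) (ht : 0 < t)
    (hc : s + t = c + 3 / 2) : ∃ C : ℝ≥0,
    ∀ (A B : R3 → ℝ≥0∞), AEMeasurable A → AEMeasurable B →
      ∫⁻ ξ, (wt c ξ * convE A B ξ) ^ 2 ≤
        C * ((∫⁻ ξ, (wt s ξ * A ξ) ^ 2) * (∫⁻ ξ, (wt t ξ * B ξ) ^ 2) +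
          (∫⁻ ξ, (wt s ξ * B ξ) ^ 2) * ∫⁻ ξ, (wt t ξ * A ξ) ^ 2) := by
  obtain ⟨C, hC⟩ := exists_lowHigh_power hs0 hs ht hc
  refine ⟨2 * C, fun A B hA hB => ?_⟩
  refine (lintegral_mul_convE_sq_le (measurable_wt _) hA hB).trans ?_
  refine (mul_le_mul_right (add_le_add (hC A B hA hB) (hC B A hB hA)) _).trans (le_of_eq ?_)
  push_cast
  ring

/-! ### Symbols -/

/-- Squared Euclidean norm of a complex vector. -/
def nsq (a : Fin 4 → ℂ) : ℝ≥0∞ := ∑ k, ‖a k‖ₑ ^ 2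

/-- Euclidean norm of a complex vector. -/
def amp (a : Fin 4 → ℂ) : ℝ≥0∞ := nsq a ^ (1 / 2 : ℝ)

theorem amp_sq (a : Fin 4 → ℂ) : amp a ^ 2 = nsq a := by
  rw [amp, ← ENNReal.rpow_natCast, ← ENNReal.rpow_mul]; norm_num

theorem enorm_le_amp (a : Fin 4 → ℂ) (k : Fin 4) : ‖a k‖ₑ ≤ amp a := by
  rw [← ENNReal.pow_le_pow_left_iff (n := 2) (by norm_num), amp_sq]
  exact Finset.single_le_sum (f := fun k => ‖a k‖ₑ ^ 2) (fun _ _ => zero_le) (Finset.mem_univ k)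

theorem nsq_ne_top (a : Fin 4 → ℂ) : nsq a ≠ ∞ := by simp [nsq, ENNReal.sum_eq_top]

theorem nsq_eq_ofReal (a : Fin 4 → ℂ) : nsq a = ENNReal.ofReal (∑ k, Complex.normSq (a k)) := by
  rw [nsq, ENNReal.ofReal_sum_of_nonneg fun k _ => Complex.normSq_nonneg _]
  refine Finset.sum_congr rfl fun k _ => ?_
  rw [Complex.normSq_eq_norm_sq, ENNReal.ofReal_pow (norm_nonneg _), ofReal_norm]

theorem nsq_le_iff {a b : Fin 4 → ℂ} :
    nsq a ≤ nsq b ↔ ∑ k, Complex.normSq (a k) ≤ ∑ k, Complex.normSq (b k) := by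
  rw [nsq_eq_ofReal, nsq_eq_ofReal, ENNReal.ofReal_le_ofReal_iff]
  exact Finset.sum_nonneg fun k _ => Complex.normSq_nonneg _

/-- Orthogonal projection of a complex vector on the line of a real vector. -/
def lineProj (q : Fin 4 → ℝ) (a : Fin 4 → ℂ) : Fin 4 → ℂ :=
  fun k => ((∑ j, (q j : ℂ) ^ 2)⁻¹ * ∑ j, (q j : ℂ) * a j) * q k

theorem lineProj_sub (q : Fin 4 → ℝ) (a b : Fin 4 → ℂ) :
    lineProj q (a - b) = lineProj q a - lineProj q b := by
  ext k
  simp only [lineProj, Pi.sub_apply, mul_sub, Finset.sum_sub_distrib]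
  ring

/-- Pythagoras. When `q = 0` the inverse of zero makes the projection zero, so no frequency has to
be excluded. -/
theorem sum_normSq_sub_lineProj (q : Fin 4 → ℝ) (a : Fin 4 → ℂ) :
    ∑ k, Complex.normSq (a k - lineProj q a k) + ∑ k, Complex.normSq (lineProj q a k) =
      ∑ k, Complex.normSq (a k) := by
  set Q : ℝ := ∑ j, q j ^ 2 with hQ
  have hQc : (∑ j, (q j : ℂ) ^ 2) = Q := by simp [hQ]
  by_cases h0 : Q = 0
  · have : ∀ k, lineProj q a k = 0 := fun k => by simp [lineProj, hQc, h0]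
    simp [this]
  set c : ℂ := (Q : ℂ)⁻¹ * ∑ j, (q j : ℂ) * a j with hc
  have hP : ∀ k, lineProj q a k = c * q k := fun k => by simp [lineProj, hQc, hc]
  have hS : ∑ j, (q j : ℂ) * a j = Q * c := by
    rw [hc, mul_inv_cancel_left₀ (by exact_mod_cast h0)]
  have hre : ∑ j, q j * (a j).re = Q * c.re := by
    simpa using congrArg Complex.re hS
  have him : ∑ j, q j * (a j).im = Q * c.im := by
    simpa using congrArg Complex.im hS
  simp only [hP, Complex.normSq_apply, Complex.sub_re, Complex.sub_im, Complex.mul_re,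
    Complex.mul_im, Complex.ofReal_re, Complex.ofReal_im, Fin.sum_univ_four] at hre him hQ ⊢
  linear_combination (-2 * c.re) * hre + (-2 * c.im) * him +
    (-2 * (c.re ^ 2 + c.im ^ 2)) * hQ

theorem nsq_lineProj_le (q : Fin 4 → ℝ) (a : Fin 4 → ℂ) : nsq (lineProj q a) ≤ nsq a := by
  rw [nsq_le_iff, ← sum_normSq_sub_lineProj q a]
  exact le_add_of_nonneg_left (Finset.sum_nonneg fun k _ => Complex.normSq_nonneg _)

theorem nsq_sub_lineProj_le (q : Fin 4 → ℝ) (a : Fin 4 → ℂ) :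
    nsq (a - lineProj q a) ≤ nsq a := by
  rw [nsq_le_iff, ← sum_normSq_sub_lineProj q a]
  exact le_add_of_nonneg_right (Finset.sum_nonneg fun k _ => Complex.normSq_nonneg _)

/-- Direction of the range of the quasi-geostrophic projector. -/
def qgDir (F : ℝ) (ξ : R3) : Fin 4 → ℝ := ![-ξ 1, ξ 0, 0, -(F * ξ 2)]

/-- Direction of the range of the gradient. -/
def gradDir (ξ : R3) : Fin 4 → ℝ := ![ξ 0, ξ 1, ξ 2, 0]

/-- The common factor `2πi` of the derivative symbols occurs to total degree zero and cancels. What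
remains is the orthogonal projection on the real vector `qgDir F ξ`, which makes `𝒬` a contraction
at every frequency, uniformly in `F`. -/
theorem projQG_eq (F : ℝ) (ξ : R3) (a : Fin 4 → ℂ) : projQG F ξ a = lineProj (qgDir F ξ) a := by
  set z : ℂ := 2 * Real.pi * Complex.I with hz
  have hz0 : z ≠ 0 := by simp [hz, Real.pi_ne_zero]
  have h1 : lapFSymb F ξ = z ^ 2 * ∑ j, (qgDir F ξ j : ℂ) ^ 2 := by
    simp [lapFSymb, dSymb, qgDir, Fin.sum_univ_four, hz]; ring
  have h2 : pvSymb F ξ a = z * ∑ j, (qgDir F ξ j : ℂ) * a j := by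
    simp [pvSymb, dSymb, qgDir, Fin.sum_univ_four, hz]; ring
  have h3 : ![-dSymb 1 ξ, dSymb 0 ξ, 0, -(F * dSymb 2 ξ)] =
      fun k => z * (qgDir F ξ k : ℂ) := by
    ext k; fin_cases k <;> simp [dSymb, qgDir, hz]; try ring
  rw [projQG, h1, h2, h3]
  ext k
  simp only [Pi.smul_apply, smul_eq_mul, lineProj, mul_inv]
  have : (z ^ 2)⁻¹ * z * z = 1 := by field_simp
  linear_combination ((∑ j, (qgDir F ξ j : ℂ) ^ 2)⁻¹ * (∑ j, (qgDir F ξ j : ℂ) * a j) *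
    (qgDir F ξ k : ℂ)) * this

theorem leray_eq (ξ : R3) (a : Fin 4 → ℂ) : leray ξ a = a - lineProj (gradDir ξ) a := by
  set z : ℂ := 2 * Real.pi * Complex.I with hz
  have hz0 : z ≠ 0 := by simp [hz, Real.pi_ne_zero]
  have h1 : lapSymb ξ = z ^ 2 * ∑ j, (gradDir ξ j : ℂ) ^ 2 := by
    simp [lapSymb, dSymb, gradDir, Fin.sum_univ_four, Fin.sum_univ_three, hz]; ring
  have h2 : ∑ j : Fin 3, dSymb j ξ * a j.castSucc = z * ∑ j, (gradDir ξ j : ℂ) * a j := by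
    simp [dSymb, gradDir, Fin.sum_univ_four, Fin.sum_univ_three, hz]; ring
  have h3 : ![dSymb 0 ξ, dSymb 1 ξ, dSymb 2 ξ, 0] = fun k => z * (gradDir ξ k : ℂ) := by
    ext k; fin_cases k <;> simp [dSymb, gradDir, hz]
  rw [leray, h1, h2, h3]
  ext k
  simp only [Pi.sub_apply, Pi.smul_apply, smul_eq_mul, lineProj, mul_inv]
  have : (z ^ 2)⁻¹ * z * z = 1 := by field_simp
  linear_combination (-(∑ j, (gradDir ξ j : ℂ) ^ 2)⁻¹ * (∑ j, (gradDir ξ j : ℂ) * a j) *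
    (gradDir ξ k : ℂ)) * this

theorem nsq_projQG_le (F : ℝ) (ξ : R3) (a : Fin 4 → ℂ) : nsq (projQG F ξ a) ≤ nsq a := by
  rw [projQG_eq]; exact nsq_lineProj_le _ _

theorem nsq_leray_le (ξ : R3) (a : Fin 4 → ℂ) : nsq (leray ξ a) ≤ nsq a := by
  rw [leray_eq]; exact nsq_sub_lineProj_le _ _

theorem nsq_leray_projOsc_le (F : ℝ) (ξ : R3) (a : Fin 4 → ℂ) :
    nsq (leray ξ (projOsc F ξ a)) ≤ nsq a := by
  refine (nsq_leray_le _ _).trans ?_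
  rw [projOsc, projQG_eq]
  exact nsq_sub_lineProj_le _ _

theorem leray_leray (ξ : R3) (a : Fin 4 → ℂ) : leray ξ (leray ξ a) = leray ξ a := by
  simp only [leray_eq, lineProj_sub]
  have : lineProj (gradDir ξ) (lineProj (gradDir ξ) a) = lineProj (gradDir ξ) a := by
    set q := gradDir ξ
    set Q : ℂ := ∑ j, (q j : ℂ) ^ 2 with hQ
    ext k
    by_cases h0 : Q = 0
    · simp [lineProj, ← hQ, h0]
    · simp only [lineProj, ← hQ]
      congr 1
      have : ∑ j, (q j : ℂ) * (Q⁻¹ * (∑ j, (q j : ℂ) * a j) * q j) =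
          Q * (Q⁻¹ * ∑ j, (q j : ℂ) * a j) := by
        rw [hQ, Finset.sum_mul]
        refine Finset.sum_congr rfl fun j _ => ?_
        ring
      rw [this, inv_mul_cancel_left₀ h0]
  rw [this]
  abel

/-- The direction of the gradient is a real vector, so the projection is Hermitian. -/
theorem sum_conj_mul_leray (ξ : R3) (v w : Fin 4 → ℂ) :
    ∑ k, (starRingEnd ℂ) (w k) * leray ξ v k = ∑ k, (starRingEnd ℂ) (leray ξ w k) * v k := by
  simp only [leray_eq, Pi.sub_apply, mul_sub, map_sub, sub_mul, Finset.sum_sub_distrib]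
  congr 1
  simp only [lineProj, Fin.sum_univ_four, map_mul, map_inv₀, map_add, map_pow,
    Complex.conj_ofReal]
  ring

/-- The rotation and stratification term does not contribute to the energy of a divergence free
field. -/
theorem re_sum_conj_mul_leray_matA (F : ℝ) (ξ : R3) (w : Fin 4 → ℂ) (hw : leray ξ w = w) :
    (∑ k, (starRingEnd ℂ) (w k) * leray ξ ((matA F).mulVec w) k).re = 0 := by
  rw [sum_conj_mul_leray, hw]
  simp [matA, Matrix.mulVec, dotProduct, Fin.sum_univ_four, Matrix.cons_val]
  ring

theorem lapSymb_eq (ξ : R3) : lapSymb ξ = -(((2 * Real.pi * ‖ξ‖) ^ 2 : ℝ) : ℂ) := by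
  have h : ‖ξ‖ ^ 2 = ξ 0 ^ 2 + ξ 1 ^ 2 + ξ 2 ^ 2 := by
    rw [EuclideanSpace.norm_sq_eq, Fin.sum_univ_three]; simp
  have h' : (2 * Real.pi * ‖ξ‖) ^ 2 = (2 * Real.pi) ^ 2 * (ξ 0 ^ 2 + ξ 1 ^ 2 + ξ 2 ^ 2) := by
    rw [mul_pow, h]
  rw [h']
  simp only [lapSymb, dSymb, Fin.sum_univ_three]
  push_cast
  linear_combination (4 * (Real.pi : ℂ) ^ 2 * ((ξ 0 : ℂ) ^ 2 + (ξ 1 : ℂ) ^ 2 + (ξ 2 : ℂ) ^ 2)) *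
    Complex.I_sq

theorem enorm_dSymb_le (j : Fin 3) (ξ : R3) : ‖dSymb j ξ‖ₑ ≤ wt 1 ξ := by
  rw [← ofReal_norm, wt, Real.rpow_one]
  refine ENNReal.ofReal_le_ofReal ?_
  simp only [dSymb, norm_mul, Complex.norm_I, Complex.norm_real, mul_one]
  have h2 : ‖ξ j‖ ≤ ‖ξ‖ := PiLp.norm_apply_le ξ j
  have h3 : ‖Real.pi‖ = Real.pi := by rw [Real.norm_eq_abs, abs_of_pos Real.pi_pos]
  rw [h3]
  simp only [Complex.norm_ofNat]
  gcongr

/-! ### Weighted energies and the advection term -/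

/-- The Fourier transform of every component of the field is a function. -/
def HasFt (u : Field) : Prop := ∀ k, ∃ g, IsFourierPair (fun x => (u x k : ℂ)) g

/-- Weighted energy of a field, in terms of its Fourier transform. -/
def energy (ω : R3 → ℝ≥0∞) (g : R3 → Fin 4 → ℂ) : ℝ≥0∞ := ∫⁻ ξ, ω ξ * nsq (g ξ)

theorem hNormHat_eq (s : ℝ) (g : R3 → Fin 4 → ℂ) :
    hNormHat s g = energy (wt (2 * s)) g ^ (1 / 2 : ℝ) := rfl

theorem hNormHat_sq (s : ℝ) (g : R3 → Fin 4 → ℂ) : hNormHat s g ^ 2 = energy (wt (2 * s)) g := by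
  rw [hNormHat_eq, ← ENNReal.rpow_natCast, ← ENNReal.rpow_mul]; norm_num

theorem hasFt_of_hNorm {s : ℝ} {u : Field} (h : hNorm s u < ∞) : HasFt u := by
  by_contra hc
  unfold HasFt at hc
  rw [hNorm, if_neg hc] at h
  exact lt_irrefl _ h

theorem HasFt.hNorm_eq {u : Field} (h : HasFt u) (s : ℝ) :
    hNorm s u = hNormHat s (fieldFt u) := if_pos h

theorem HasFt.hNorm_sq {u : Field} (h : HasFt u) (s : ℝ) :
    hNorm s u ^ 2 = energy (wt (2 * s)) (fieldFt u) := by rw [h.hNorm_eq, hNormHat_sq]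

theorem HasFt.pair {u : Field} (h : HasFt u) (k : Fin 4) :
    IsFourierPair (fun x => (u x k : ℂ)) (fun ξ => fieldFt u ξ k) := isFourierPair_ft (h k)

theorem HasFt.sub {u v : Field} (hu : HasFt u) (hv : HasFt v) : HasFt (u - v) := fun k => by
  refine ⟨_, ((hu.pair k).sub (hv.pair k)).congr_left ?_⟩
  exact ae_of_all _ fun x => by simp

theorem HasFt.fieldFt_sub {u v : Field} (hu : HasFt u) (hv : HasFt v) :
    ∀ᵐ ξ, fieldFt (u - v) ξ = fieldFt u ξ - fieldFt v ξ := by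
  have h : ∀ k, ∀ᵐ ξ, fieldFt (u - v) ξ k = fieldFt u ξ k - fieldFt v ξ k := fun k =>
    (((hu.pair k).sub (hv.pair k)).congr_left (ae_of_all _ fun x => by simp)).ft_ae_eq
  filter_upwards [ae_all_iff.2 h] with ξ hξ
  ext k
  exact hξ k

theorem HasFt.congr {u v : Field} (hu : HasFt u) (h : u =ᵐ[volume] v) :
    HasFt v ∧ ∀ᵐ ξ, fieldFt v ξ = fieldFt u ξ := by
  have hp : ∀ k, IsFourierPair (fun x => (v x k : ℂ)) (fun ξ => fieldFt u ξ k) := fun k =>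
    (hu.pair k).congr_left (h.mono fun x hx => by simp only [hx])
  refine ⟨fun k => ⟨_, hp k⟩, ?_⟩
  filter_upwards [ae_all_iff.2 fun k => (hp k).ft_ae_eq] with ξ hξ
  ext k
  exact hξ k

theorem energy_congr {ω : R3 → ℝ≥0∞} {g g' : R3 → Fin 4 → ℂ} (h : ∀ᵐ ξ, g ξ = g' ξ) :
    energy ω g = energy ω g' :=
  lintegral_congr_ae (h.mono fun ξ hξ => by simp only [hξ])

/-- Componentwise almost everywhere strong measurability. -/
def CompMeas (g : R3 → Fin 4 → ℂ) : Prop := ∀ k, AEStronglyMeasurable (fun ξ => g ξ k)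

theorem HasFt.compMeas {u : Field} (h : HasFt u) : CompMeas (fieldFt u) :=
  fun k => (h.pair k).aestronglyMeasurable_right

theorem CompMeas.nsq {g : R3 → Fin 4 → ℂ} (h : CompMeas g) : AEMeasurable fun ξ => nsq (g ξ) := by
  unfold QG.nsq
  exact Finset.aemeasurable_fun_sum _ fun k _ => (h k).enorm.pow_const 2

theorem CompMeas.amp {g : R3 → Fin 4 → ℂ} (h : CompMeas g) : AEMeasurable fun ξ => amp (g ξ) :=
  h.nsq.pow_const _

theorem CompMeas.sub {g g' : R3 → Fin 4 → ℂ} (h : CompMeas g) (h' : CompMeas g') :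
    CompMeas fun ξ => g ξ - g' ξ := fun k => (h k).sub (h' k)

theorem CompMeas.lineProj {q : R3 → Fin 4 → ℝ} (hq : ∀ k, Measurable fun ξ => q ξ k)
    {g : R3 → Fin 4 → ℂ} (h : CompMeas g) : CompMeas fun ξ => lineProj (q ξ) (g ξ) := fun k => by
  have hq' : ∀ k, AEStronglyMeasurable fun ξ => ((q ξ k : ℝ) : ℂ) := fun k =>
    (Complex.measurable_ofReal.comp (hq k)).aestronglyMeasurable
  have h1 : AEStronglyMeasurable fun ξ => (∑ j, (q ξ j : ℂ) ^ 2)⁻¹ := by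
    refine Measurable.aestronglyMeasurable (Measurable.inv ?_)
    exact Finset.measurable_fun_sum _ fun j _ => (Complex.measurable_ofReal.comp (hq j)).pow_const 2
  have h2 : AEStronglyMeasurable fun ξ => ∑ j, (q ξ j : ℂ) * g ξ j :=
    Finset.aestronglyMeasurable_fun_sum _ fun j _ => (hq' j).mul (h j)
  exact (h1.mul h2).mul (hq' k)

theorem measurable_coord (j : Fin 3) : Measurable fun ξ : R3 => ξ j :=
  (EuclideanSpace.proj (𝕜 := ℝ) j).continuous.measurable

theorem CompMeas.projQG (F : ℝ) {g : R3 → Fin 4 → ℂ} (h : CompMeas g) :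
    CompMeas fun ξ => projQG F ξ (g ξ) := by
  simp only [projQG_eq]
  refine h.lineProj fun k => ?_
  have := measurable_coord
  fin_cases k <;> simp [qgDir] <;> fun_prop

theorem CompMeas.leray {g : R3 → Fin 4 → ℂ} (h : CompMeas g) :
    CompMeas fun ξ => leray ξ (g ξ) := by
  simp only [leray_eq]
  refine h.sub (h.lineProj fun k => ?_)
  have := measurable_coord
  fin_cases k <;> simp [gradDir] <;> fun_prop

theorem lintegral_wt_mul_amp_sq {g : R3 → Fin 4 → ℂ} (s : ℝ) :
    ∫⁻ ξ, (wt s ξ * amp (g ξ)) ^ 2 = energy (wt (2 * s)) g := by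
  unfold energy
  simp only [mul_pow, wt_sq, amp_sq]

theorem enorm_conv_le {a b : R3 → ℂ} {A B : R3 → ℝ≥0∞} (ha : ∀ ξ, ‖a ξ‖ₑ ≤ A ξ)
    (hb : ∀ ξ, ‖b ξ‖ₑ ≤ B ξ) (ξ : R3) : ‖conv a b ξ‖ₑ ≤ convE A B ξ := by
  refine (enorm_integral_le_lintegral_enorm _).trans (lintegral_mono fun ζ => ?_)
  rw [enorm_mul]
  exact mul_le_mul' (ha _) (hb _)

/-- The product law for two factors in `Ḣ^{1/2}`, the only regularity known at every time. It is
what gives a meaning to the advection term. -/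
theorem exists_convE_half : ∃ C : ℝ≥0, ∀ (A B : R3 → ℝ≥0∞), AEMeasurable A → AEMeasurable B →
    ∫⁻ ξ, (wt (-1 / 2) ξ * convE A B ξ) ^ 2 ≤
      C * ((∫⁻ ξ, (wt (1 / 2) ξ * A ξ) ^ 2) * ∫⁻ ξ, (wt (1 / 2) ξ * B ξ) ^ 2) := by
  obtain ⟨C, hC⟩ := exists_convE_power (s := 1 / 2) (t := 1 / 2) (c := -1 / 2) (by norm_num)
    (by norm_num) (by norm_num) (by norm_num)
  refine ⟨2 * C, fun A B hA hB => (hC A B hA hB).trans (le_of_eq ?_)⟩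
  push_cast
  ring

/-- A Schwartz function is in `Ḣ^{1/2}` and the convolution is in `Ḣ^{-1/2}`, so this is
Cauchy–Schwarz for the duality between the two spaces. It supplies the integrability needed to
identify the transform of a product. -/
theorem lintegral_schwartz_mul_convE_lt_top (φ : 𝓢(R3, ℂ)) {A B : R3 → ℝ≥0∞}
    (hA : AEMeasurable A) (hB : AEMeasurable B) (hA' : ∫⁻ ξ, (wt (1 / 2) ξ * A ξ) ^ 2 < ∞)
    (hB' : ∫⁻ ξ, (wt (1 / 2) ξ * B ξ) ^ 2 < ∞) :
    ∫⁻ ξ, ‖φ ξ‖ₑ * convE A B ξ < ∞ := by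
  obtain ⟨C, hC⟩ := exists_convE_half
  have h1 : ∫⁻ ξ, (wt (1 / 2) ξ * ‖φ ξ‖ₑ) ^ 2 < ∞ := by
    have h2 : ∫⁻ ξ, (wt (1 / 2) ξ * ‖φ ξ‖ₑ) ^ 2 =
        ∫⁻ ξ, ENNReal.ofReal (2 * Real.pi) * (‖(‖ξ‖ ^ 1 * ‖φ ξ‖)‖ₑ * ‖φ ξ‖ₑ) := by
      refine lintegral_congr fun ξ => ?_
      rw [mul_pow, wt_sq, wt, enorm_mul, enorm_norm, pow_one, enorm_norm, sq,
        ← ofReal_norm ξ]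
      rw [show (2 * (1 / 2) : ℝ) = 1 by norm_num, Real.rpow_one,
        ENNReal.ofReal_mul (by positivity)]
      ring
    rw [h2, lintegral_const_mul' _ _ ENNReal.ofReal_ne_top]
    refine ENNReal.mul_lt_top ENNReal.ofReal_lt_top ?_
    have h3 := φ.integrable_pow_mul (volume : Measure R3) 1
    obtain ⟨K, hK⟩ := φ.toBoundedContinuousFunction.isBounded_range.exists_norm_le
    have hK' : ∀ ξ, ‖φ ξ‖ ≤ K := fun ξ => hK _ ⟨ξ, rfl⟩
    calc ∫⁻ ξ, ‖(‖ξ‖ ^ 1 * ‖φ ξ‖)‖ₑ * ‖φ ξ‖ₑ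
        ≤ ∫⁻ ξ, ‖(‖ξ‖ ^ 1 * ‖φ ξ‖)‖ₑ * ENNReal.ofReal K := by
          refine lintegral_mono fun ξ => ?_
          gcongr
          rw [← ofReal_norm]
          exact ENNReal.ofReal_le_ofReal (hK' ξ)
      _ = (∫⁻ ξ, ‖(‖ξ‖ ^ 1 * ‖φ ξ‖)‖ₑ) * ENNReal.ofReal K :=
          lintegral_mul_const' _ _ ENNReal.ofReal_ne_top
      _ < ∞ := ENNReal.mul_lt_top h3.2 ENNReal.ofReal_lt_top
  have e : ∫⁻ ξ, ‖φ ξ‖ₑ * convE A B ξ =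
      ∫⁻ ξ, (wt (1 / 2) ξ * ‖φ ξ‖ₑ) * (wt (-1 / 2) ξ * convE A B ξ) := by
    refine lintegral_congr_ae ?_
    filter_upwards [ae_ne_zero] with ξ hξ
    have h0 : wt (1 / 2) ξ * wt (-1 / 2) ξ = 1 := by
      rw [← wt_add hξ, show (1 / 2 : ℝ) + -1 / 2 = 0 by norm_num, wt_zero]
    calc ‖φ ξ‖ₑ * convE A B ξ = (wt (1 / 2) ξ * wt (-1 / 2) ξ) * (‖φ ξ‖ₑ * convE A B ξ) := by
          rw [h0, one_mul]
      _ = _ := by ring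
  have h := lintegral_mul_sq_le (μ := volume) (f := fun ξ => wt (1 / 2) ξ * ‖φ ξ‖ₑ)
    (g := fun ξ => wt (-1 / 2) ξ * convE A B ξ)
    ((measurable_wt _).aemeasurable.mul φ.continuous.aestronglyMeasurable.enorm)
    ((measurable_wt _).aemeasurable.mul (aemeasurable_convE hA hB))
  rw [← e] at h
  have h4 : (∫⁻ ξ, ‖φ ξ‖ₑ * convE A B ξ) ^ 2 < ∞ := by
    refine h.trans_lt (ENNReal.mul_lt_top h1 ((hC A B hA hB).trans_lt ?_))
    exact ENNReal.mul_lt_top ENNReal.coe_lt_top (ENNReal.mul_lt_top hA' hB')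
  by_contra hcon
  rw [not_lt, top_le_iff] at hcon
  rw [hcon] at h4
  norm_num at h4

theorem integrable_schwartz_add_mul (φ : 𝓢(R3, ℂ)) {a b : R3 → ℂ}
    (ha : AEStronglyMeasurable a) (hb : AEStronglyMeasurable b)
    (ha' : ∫⁻ ξ, (wt (1 / 2) ξ * ‖a ξ‖ₑ) ^ 2 < ∞) (hb' : ∫⁻ ξ, (wt (1 / 2) ξ * ‖b ξ‖ₑ) ^ 2 < ∞) :
    Integrable (fun p : R3 × R3 => φ (p.1 + p.2) * (a p.1 * b p.2)) := by
  have hm : AEStronglyMeasurable (fun p : R3 × R3 => φ (p.1 + p.2) * (a p.1 * b p.2)) :=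
    (φ.continuous.comp (continuous_fst.add continuous_snd)).aestronglyMeasurable.mul
      ((ha.comp_quasiMeasurePreserving Measure.quasiMeasurePreserving_fst).mul
        (hb.comp_quasiMeasurePreserving Measure.quasiMeasurePreserving_snd))
  refine ⟨hm, ?_⟩
  have hfin := lintegral_schwartz_mul_convE_lt_top φ ha.enorm hb.enorm ha' hb'
  refine lt_of_eq_of_lt ?_ hfin
  rw [Measure.volume_eq_prod, lintegral_prod _ hm.enorm]
  have hm1 : AEMeasurable (fun p : R3 × R3 => ‖φ p.1‖ₑ * (‖a p.2‖ₑ * ‖b (p.1 - p.2)‖ₑ))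
      (volume.prod volume) :=
    ((φ.continuous.aestronglyMeasurable.enorm).comp_quasiMeasurePreserving
      Measure.quasiMeasurePreserving_fst).mul
    ((ha.enorm.comp_quasiMeasurePreserving Measure.quasiMeasurePreserving_snd).mul
      (hb.enorm.comp_quasiMeasurePreserving quasiMeasurePreserving_snd_sub))
  calc ∫⁻ ζ, ∫⁻ η, ‖φ (ζ + η) * (a ζ * b η)‖ₑ
      = ∫⁻ ζ, ∫⁻ ξ, ‖φ ξ‖ₑ * (‖a ζ‖ₑ * ‖b (ξ - ζ)‖ₑ) := by
        refine lintegral_congr fun ζ => ?_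
        rw [← lintegral_add_left_eq_self (fun ξ => ‖φ ξ‖ₑ * (‖a ζ‖ₑ * ‖b (ξ - ζ)‖ₑ)) ζ]
        refine lintegral_congr fun η => ?_
        simp [enorm_mul]
    _ = ∫⁻ ξ, ∫⁻ ζ, ‖φ ξ‖ₑ * (‖a ζ‖ₑ * ‖b (ξ - ζ)‖ₑ) := (lintegral_lintegral_swap hm1).symm
    _ = _ := by
        refine lintegral_congr fun ξ => ?_
        rw [lintegral_const_mul' _ _ enorm_ne_top, convE]

theorem memLp_indicator_compl_of_wt {a : R3 → ℂ} (ha : AEStronglyMeasurable a)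
    (ha' : ∫⁻ ξ, (wt (1 / 2) ξ * ‖a ξ‖ₑ) ^ 2 < ∞) :
    MemLp ((Metric.closedBall (0 : R3) 1)ᶜ.indicator a) 2 := by
  refine ⟨ha.indicator measurableSet_closedBall.compl, ?_⟩
  rw [eLpNorm_lt_top_iff_lintegral_rpow_enorm_lt_top two_ne_zero ENNReal.ofNat_ne_top]
  refine lt_of_le_of_lt (lintegral_mono fun ξ => ?_) ha'
  by_cases h : ξ ∈ (Metric.closedBall (0 : R3) 1)ᶜ
  · rw [Set.indicator_of_mem h]
    have h1 : 1 ≤ wt (1 / 2) ξ := by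
      rw [wt, ENNReal.one_le_ofReal]
      refine Real.one_le_rpow ?_ (by norm_num)
      have : 1 < ‖ξ‖ := by simpa using h
      nlinarith [Real.pi_gt_three]
    simp only [ENNReal.toReal_ofNat]
    calc ‖a ξ‖ₑ ^ (2 : ℝ) = (1 * ‖a ξ‖ₑ) ^ 2 := by
          rw [one_mul, ← ENNReal.rpow_natCast]; norm_num
      _ ≤ _ := by gcongr
  · rw [Set.indicator_of_notMem h]
    simp

theorem HasFt.wt_component {u : Field} (h : energy (wt 1) (fieldFt u) < ∞) (k : Fin 4) :
    ∫⁻ ξ, (wt (1 / 2) ξ * ‖fieldFt u ξ k‖ₑ) ^ 2 < ∞ := by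
  have e := lintegral_wt_mul_amp_sq (g := fieldFt u) (1 / 2)
  rw [show (2 * (1 / 2) : ℝ) = 1 by norm_num] at e
  refine lt_of_le_of_lt ?_ (e.trans_lt h)
  refine lintegral_mono fun ξ => ?_
  gcongr
  exact enorm_le_amp _ _

theorem HasFt.pair_mul {u v : Field} (hu : HasFt u) (hv : HasFt v)
    (hu' : energy (wt 1) (fieldFt u) < ∞) (hv' : energy (wt 1) (fieldFt v) < ∞) (i k : Fin 4) :
    IsFourierPair (fun x => (u x i : ℂ) * (v x k : ℂ))
      (conv (fun ξ => fieldFt u ξ i) fun ξ => fieldFt v ξ k) := by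
  have a1 := HasFt.wt_component hu' i
  have b1 := HasFt.wt_component hv' k
  exact (hu.pair i).mul (hv.pair k) (memLp_indicator_compl_of_wt (hu.compMeas i) a1)
    (memLp_indicator_compl_of_wt (hv.compMeas k) b1)
    fun φ => integrable_schwartz_add_mul φ (hu.compMeas i) (hv.compMeas k) a1 b1

theorem HasFt.pair_prod {u : Field} (hu : HasFt u)
    (hu' : energy (wt 1) (fieldFt u) < ∞) (i k : Fin 4) :
    IsFourierPair (fun x => ((u x i * u x k : ℝ) : ℂ))
      (conv (fun ξ => fieldFt u ξ i) fun ξ => fieldFt u ξ k) := by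
  simpa using hu.pair_mul hu hu' hu' i k

theorem HasFt.advHat_compMeas {u : Field} (hu : HasFt u)
    (hu' : energy (wt 1) (fieldFt u) < ∞) : CompMeas (advHat u) := fun k => by
  refine Finset.aestronglyMeasurable_fun_sum _ fun i _ => AEStronglyMeasurable.mul ?_ ?_
  · have := measurable_coord i
    unfold dSymb
    exact Measurable.aestronglyMeasurable (by fun_prop)
  · exact (isFourierPair_ft ⟨_, hu.pair_prod hu' i.castSucc k⟩).aestronglyMeasurable_right

/-- The constant is `36 = 4 · 3²`: four components, each a sum of three derivatives. -/
theorem nsq_le_of_sum_dSymb (ξ : R3) (f : Fin 3 → Fin 4 → ℂ) {c : ℝ≥0∞}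
    (h : ∀ i k, ‖f i k‖ₑ ≤ c) :
    nsq (fun k => ∑ i, dSymb i ξ * f i k) ≤ 36 * (wt 1 ξ * c) ^ 2 := by
  have h1 : ∀ k, ‖∑ i, dSymb i ξ * f i k‖ₑ ≤ 3 * (wt 1 ξ * c) := fun k => by
    refine (enorm_sum_le _ _).trans ?_
    refine (Finset.sum_le_sum (g := fun _ => wt 1 ξ * c) fun i _ => ?_).trans (by simp)
    rw [enorm_mul]
    exact mul_le_mul' (enorm_dSymb_le i ξ) (h i k)
  refine (Finset.sum_le_sum (g := fun _ => (3 * (wt 1 ξ * c)) ^ 2) fun k _ => ?_).trans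
    (le_of_eq ?_)
  · exact pow_le_pow_left₀ zero_le (h1 k) 2
  · simp only [Finset.sum_const, Finset.card_univ, Fintype.card_fin, nsmul_eq_mul]
    push_cast
    ring

theorem HasFt.nsq_advHat_le {u : Field} (hu : HasFt u) (hu' : energy (wt 1) (fieldFt u) < ∞) :
    ∀ᵐ ξ, nsq (advHat u ξ) ≤
      36 * (wt 1 ξ * convE (fun ξ => amp (fieldFt u ξ)) (fun ξ => amp (fieldFt u ξ)) ξ) ^ 2 := by
  have h : ∀ᵐ ξ, ∀ (i : Fin 3) (k : Fin 4),
      ft (fun x => ((u x i.castSucc * u x k : ℝ) : ℂ)) ξ =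
        conv (fun ξ => fieldFt u ξ i.castSucc) (fun ξ => fieldFt u ξ k) ξ :=
    ae_all_iff.2 fun i => ae_all_iff.2 fun k => (hu.pair_prod hu' i.castSucc k).ft_ae_eq
  filter_upwards [h] with ξ hξ
  refine nsq_le_of_sum_dSymb ξ _ fun i k => ?_
  rw [hξ]
  exact enorm_conv_le (fun ξ => enorm_le_amp _ _) (fun ξ => enorm_le_amp _ _) ξ

/-- Bilinearity: `u ⊗ u - v ⊗ v = (u - v) ⊗ u + v ⊗ (u - v)`. This is used for the continuity in
time of the advection term. -/
theorem HasFt.nsq_advHat_sub_le {u v : Field} (hu : HasFt u) (hv : HasFt v)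
    (hu' : energy (wt 1) (fieldFt u) < ∞) (hv' : energy (wt 1) (fieldFt v) < ∞)
    (huv : energy (wt 1) (fieldFt (u - v)) < ∞) :
    ∀ᵐ ξ, nsq (advHat u ξ - advHat v ξ) ≤
      36 * (wt 1 ξ * (convE (fun ξ => amp (fieldFt (u - v) ξ)) (fun ξ => amp (fieldFt u ξ)) ξ +
        convE (fun ξ => amp (fieldFt v ξ)) (fun ξ => amp (fieldFt (u - v) ξ)) ξ)) ^ 2 := by
  have hd := hu.sub hv
  have h : ∀ᵐ ξ, ∀ (i : Fin 3) (k : Fin 4),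
      ft (fun x => ((u x i.castSucc * u x k : ℝ) : ℂ)) ξ -
        ft (fun x => ((v x i.castSucc * v x k : ℝ) : ℂ)) ξ =
      conv (fun ξ => fieldFt (u - v) ξ i.castSucc) (fun ξ => fieldFt u ξ k) ξ +
        conv (fun ξ => fieldFt v ξ i.castSucc) (fun ξ => fieldFt (u - v) ξ k) ξ := by
    refine ae_all_iff.2 fun i => ae_all_iff.2 fun k => ?_
    have p1 := (isFourierPair_ft ⟨_, hu.pair_prod hu' i.castSucc k⟩)
    have p2 := (isFourierPair_ft ⟨_, hv.pair_prod hv' i.castSucc k⟩)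
    have p3 := hd.pair_mul hu huv hu' i.castSucc k
    have p4 := hv.pair_mul hd hv' huv i.castSucc k
    have p5 := ((p1.sub p2).sub p3).congr_left (f' := fun x => (v x i.castSucc : ℂ) *
      (((u - v) x k : ℝ) : ℂ)) (ae_of_all _ fun x => by simp; ring)
    filter_upwards [p5.unique_right p4] with ξ hξ
    rw [← hξ]
    simp
  filter_upwards [h] with ξ hξ
  have e : advHat u ξ - advHat v ξ = fun k => ∑ i, dSymb i ξ *
      (ft (fun x => ((u x (Fin.castSucc i) * u x k : ℝ) : ℂ)) ξ -
        ft (fun x => ((v x (Fin.castSucc i) * v x k : ℝ) : ℂ)) ξ) := by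
    ext k
    simp only [advHat, Pi.sub_apply, ← Finset.sum_sub_distrib, mul_sub]
  rw [e]
  refine nsq_le_of_sum_dSymb ξ _ fun i k => ?_
  rw [hξ]
  exact (enorm_add_le _ _).trans (add_le_add
    (enorm_conv_le (fun ξ => enorm_le_amp _ _) (fun ξ => enorm_le_amp _ _) ξ)
    (enorm_conv_le (fun ξ => enorm_le_amp _ _) (fun ξ => enorm_le_amp _ _) ξ))

/-! ### Square integrable functions depending on time -/

section L2

variable {α : Type*} [MeasurableSpace α] {μ : Measure α} {T : ℝ}

/-- `g ∈ C([0, T]; L²(μ))`. -/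
structure L2Cont (μ : Measure α) (T : ℝ) (g : ℝ → α → ℂ) : Prop where
  memLp : ∀ t ∈ Set.Icc 0 T, MemLp (g t) 2 μ
  tendsto : ∀ t₀ ∈ Set.Icc 0 T,
    Tendsto (fun t => eLpNorm (g t - g t₀) 2 μ) (𝓝[Set.Icc 0 T] t₀) (𝓝 0)

open Classical in
/-- The curve in `L²(μ)` defined by a time dependent function. -/
def lpCurve (μ : Measure α) (g : ℝ → α → ℂ) (t : ℝ) : Lp ℂ 2 μ :=
  if h : MemLp (g t) 2 μ then h.toLp (g t) else 0

theorem L2Cont.lpCurve_eq {g : ℝ → α → ℂ} (hg : L2Cont μ T g) {t : ℝ} (ht : t ∈ Set.Icc 0 T) :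
    lpCurve μ g t = (hg.memLp t ht).toLp (g t) := dif_pos _

theorem L2Cont.coeFn {g : ℝ → α → ℂ} (hg : L2Cont μ T g) {t : ℝ} (ht : t ∈ Set.Icc 0 T) :
    lpCurve μ g t =ᵐ[μ] g t := by
  rw [hg.lpCurve_eq ht]; exact MemLp.coeFn_toLp _

theorem L2Cont.continuousOn {g : ℝ → α → ℂ} (hg : L2Cont μ T g) :
    ContinuousOn (lpCurve μ g) (Set.Icc 0 T) := by
  intro t₀ ht₀
  rw [ContinuousWithinAt, tendsto_iff_edist_tendsto_0]
  refine (hg.tendsto t₀ ht₀).congr' ?_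
  filter_upwards [self_mem_nhdsWithin] with t ht
  rw [hg.lpCurve_eq ht, hg.lpCurve_eq ht₀, Lp.edist_toLp_toLp]

theorem L2Cont.inner_eq {f g : ℝ → α → ℂ} (hf : L2Cont μ T f) (hg : L2Cont μ T g) {t s : ℝ}
    (ht : t ∈ Set.Icc 0 T) (hs : s ∈ Set.Icc 0 T) :
    inner ℂ (lpCurve μ f t) (lpCurve μ g s) = ∫ x, (starRingEnd ℂ) (f t x) * g s x ∂μ := by
  rw [L2.inner_def]
  refine integral_congr_ae ?_
  filter_upwards [hf.coeFn ht, hg.coeFn hs] with x h1 h2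
  rw [h1, h2, RCLike.inner_apply, mul_comm]

theorem L2Cont.continuousOn_integral {f g : ℝ → α → ℂ} (hf : L2Cont μ T f) (hg : L2Cont μ T g) :
    ContinuousOn (fun t => ∫ x, (starRingEnd ℂ) (f t x) * g t x ∂μ) (Set.Icc 0 T) := by
  have h : ContinuousOn (fun t => inner ℂ (lpCurve μ f t) (lpCurve μ g t)) (Set.Icc 0 T) :=
    hf.continuousOn.inner (𝕜 := ℂ) hg.continuousOn
  exact h.congr fun t ht => (hf.inner_eq hg ht ht).symm

theorem L2Cont.integrable {f g : ℝ → α → ℂ} (hf : L2Cont μ T f) (hg : L2Cont μ T g) {t : ℝ}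
    (ht : t ∈ Set.Icc 0 T) : Integrable (fun x => (starRingEnd ℂ) (f t x) * g t x) μ := by
  have h1 : MemLp (fun x => (starRingEnd ℂ) (f t x)) 2 μ := (hf.memLp t ht).star
  exact memLp_one_iff_integrable.1 ((hg.memLp t ht).mul h1)

/-- Continuity in `L²` is inherited under a pointwise Lipschitz bound. Multipliers, finite sums,
differences and Euclidean norms of vectors are all obtained from this one criterion. -/
theorem L2Cont.of_le {ι : Type*} [Fintype ι] {f : ι → ℝ → α → ℂ} {g : ℝ → α → ℂ} {K : ℝ}
    (hf : ∀ i, L2Cont μ T (f i)) (hm : ∀ t ∈ Set.Icc 0 T, AEStronglyMeasurable (g t) μ)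
    (h0 : ∀ t ∈ Set.Icc 0 T, ∀ᵐ x ∂μ, ‖g t x‖ ≤ ∑ i, K * ‖f i t x‖)
    (h : ∀ t ∈ Set.Icc 0 T, ∀ t₀ ∈ Set.Icc 0 T, ∀ᵐ x ∂μ,
      ‖g t x - g t₀ x‖ ≤ ∑ i, K * ‖f i t x - f i t₀ x‖) : L2Cont μ T g := by
  have hK : ∀ F : ι → α → ℂ, (∀ i, MemLp (F i) 2 μ) → ∀ G : α → ℂ,
      (∀ᵐ x ∂μ, ‖G x‖ ≤ ∑ i, K * ‖F i x‖) →
      eLpNorm G 2 μ ≤ ∑ i, ‖K‖ₑ * eLpNorm (F i) 2 μ := by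
    intro F hF G hG
    calc eLpNorm G 2 μ ≤ eLpNorm (∑ i, fun x => K * ‖F i x‖) 2 μ := by
          refine eLpNorm_mono_ae (hG.mono fun x hx => ?_)
          rw [Finset.sum_apply]
          exact hx.trans (le_abs_self _)
      _ ≤ ∑ i, eLpNorm (fun x => K * ‖F i x‖) 2 μ :=
          eLpNorm_sum_le (fun i _ => (hF i).1.norm.const_mul K) (by norm_num)
      _ ≤ ∑ i, ‖K‖ₑ * eLpNorm (F i) 2 μ := by
          refine Finset.sum_le_sum fun i _ => ?_
          rw [← eLpNorm_norm (F i)]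
          exact eLpNorm_const_smul_le (c := K) (f := fun x => ‖F i x‖)
  refine ⟨fun t ht => ⟨hm t ht, ?_⟩, fun t₀ ht₀ => ?_⟩
  · refine (hK _ (fun i => (hf i).memLp t ht) _ (h0 t ht)).trans_lt ?_
    exact ENNReal.sum_lt_top.2 fun i _ =>
      ENNReal.mul_lt_top enorm_lt_top ((hf i).memLp t ht).2
  · have hlim : Tendsto (fun t => ∑ i, ‖K‖ₑ * eLpNorm (f i t - f i t₀) 2 μ)
        (𝓝[Set.Icc 0 T] t₀) (𝓝 0) := by
      have := tendsto_finsetSum (Finset.univ : Finset ι) fun i _ =>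
        ENNReal.Tendsto.const_mul (a := ‖K‖ₑ) ((hf i).tendsto t₀ ht₀) (Or.inr enorm_ne_top)
      simpa using this
    refine tendsto_of_tendsto_of_tendsto_of_le_of_le' tendsto_const_nhds hlim
      (Eventually.of_forall fun _ => zero_le) ?_
    filter_upwards [self_mem_nhdsWithin] with t ht
    exact hK _ (fun i => ((hf i).memLp t ht).sub ((hf i).memLp t₀ ht₀)) _ (h t ht t₀ ht₀)

theorem L2Cont.bdd_mul {f : ℝ → α → ℂ} (hf : L2Cont μ T f) {m : α → ℂ} {K : ℝ}
    (hm : AEStronglyMeasurable m μ) (hK : ∀ᵐ x ∂μ, ‖m x‖ ≤ K) :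
    L2Cont μ T fun t x => m x * f t x := by
  refine L2Cont.of_le (ι := Unit) (K := K) (fun _ => hf)
    (fun t ht => hm.mul (hf.memLp t ht).1)
    (fun t _ => hK.mono fun x hx => ?_) (fun t _ t₀ _ => hK.mono fun x hx => ?_)
  · simp only [Finset.univ_unique, Finset.sum_singleton, norm_mul]
    gcongr
  · simp only [Finset.univ_unique, Finset.sum_singleton, ← mul_sub, norm_mul]
    gcongr

theorem L2Cont.sum {ι : Type*} [Fintype ι] {f : ι → ℝ → α → ℂ} (hf : ∀ i, L2Cont μ T (f i)) :
    L2Cont μ T fun t x => ∑ i, f i t x := by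
  refine L2Cont.of_le (K := 1) hf
    (fun t ht => Finset.aestronglyMeasurable_fun_sum _ fun i _ => ((hf i).memLp t ht).1)
    (fun t _ => ae_of_all _ fun x => ?_) (fun t _ t₀ _ => ae_of_all _ fun x => ?_)
  · simpa using norm_sum_le Finset.univ fun i => f i t x
  · rw [← Finset.sum_sub_distrib]
    simpa using norm_sum_le Finset.univ fun i => f i t x - f i t₀ x

/-- `∂_t u = h` in `L²(μ)`, integrated in time and tested against `L²(μ)`. -/
structure L2Evol (μ : Measure α) (T : ℝ) (u h : ℝ → α → ℂ) : Prop where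
  left : L2Cont μ T u
  right : L2Cont μ T h
  weak : ∀ ψ : α → ℂ, MemLp ψ 2 μ → ∀ t ∈ Set.Icc 0 T,
    ∫ x, ψ x * u t x ∂μ = (∫ x, ψ x * u 0 x ∂μ) + ∫ τ in (0 : ℝ)..t, ∫ x, ψ x * h τ x ∂μ

theorem L2Evol.bdd_mul {u h : ℝ → α → ℂ} (H : L2Evol μ T u h) {m : α → ℂ} {K : ℝ}
    (hm : AEStronglyMeasurable m μ) (hK : ∀ᵐ x ∂μ, ‖m x‖ ≤ K) :
    L2Evol μ T (fun t x => m x * u t x) fun t x => m x * h t x := by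
  refine ⟨H.left.bdd_mul hm hK, H.right.bdd_mul hm hK, fun ψ hψ t ht => ?_⟩
  have hmt : MemLp m ∞ μ := memLp_top_of_bound hm K hK
  have hψm : MemLp (fun x => ψ x * m x) 2 μ := hmt.mul hψ
  simpa only [mul_assoc] using H.weak _ hψm t ht

theorem integrable_mul_of_memLp {ψ g : α → ℂ} (hψ : MemLp ψ 2 μ) (hg : MemLp g 2 μ) :
    Integrable (fun x => ψ x * g x) μ := memLp_one_iff_integrable.1 (hg.mul hψ)

theorem L2Cont.continuousOn_test {g : ℝ → α → ℂ} (hg : L2Cont μ T g) {ψ : α → ℂ}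
    (hψ : MemLp ψ 2 μ) : ContinuousOn (fun t => ∫ x, ψ x * g t x ∂μ) (Set.Icc 0 T) := by
  have hc : L2Cont μ T fun _ x => (starRingEnd ℂ) (ψ x) :=
    ⟨fun _ _ => hψ.star, fun t₀ _ => by simpa using tendsto_const_nhds⟩
  simpa using hc.continuousOn_integral hg

theorem L2Evol.sum {ι : Type*} [Fintype ι] {u h : ι → ℝ → α → ℂ}
    (H : ∀ i, L2Evol μ T (u i) (h i)) :
    L2Evol μ T (fun t x => ∑ i, u i t x) fun t x => ∑ i, h i t x := by
  refine ⟨L2Cont.sum fun i => (H i).left, L2Cont.sum fun i => (H i).right, fun ψ hψ t ht => ?_⟩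
  have h0 : (0 : ℝ) ∈ Set.Icc 0 T := ⟨le_rfl, ht.1.trans ht.2⟩
  have hsub : Set.uIcc 0 t ⊆ Set.Icc 0 T := by
    rw [Set.uIcc_of_le ht.1]; exact Set.Icc_subset_Icc_right ht.2
  have e : ∀ (v : ι → ℝ → α → ℂ), (∀ i, L2Cont μ T (v i)) → ∀ τ ∈ Set.Icc 0 T,
      ∫ x, ψ x * ∑ i, v i τ x ∂μ = ∑ i, ∫ x, ψ x * v i τ x ∂μ := fun v hv τ hτ => by
    simp only [Finset.mul_sum]
    exact integral_finsetSum _ fun i _ => integrable_mul_of_memLp hψ ((hv i).memLp τ hτ)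
  rw [e u (fun i => (H i).left) t ht, e u (fun i => (H i).left) 0 h0,
    intervalIntegral.integral_congr fun τ hτ => e h (fun i => (H i).right) τ (hsub hτ),
    intervalIntegral.integral_finsetSum, ← Finset.sum_add_distrib]
  · exact Finset.sum_congr rfl fun i _ => (H i).weak ψ hψ t ht
  · intro i _
    exact (((H i).right.continuousOn_test hψ).mono hsub).intervalIntegrable

/-- An evolution in `L²(μ)` coincides on `[0, T]` with a differentiable curve. -/
theorem L2Evol.exists_curve {u h : ℝ → α → ℂ} (H : L2Evol μ T u h) (hT : 0 ≤ T) :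
    ∃ U V : ℝ → Lp ℂ 2 μ, Continuous V ∧ (∀ t, HasDerivAt U (V t) t) ∧
      (∀ t ∈ Set.Icc 0 T, U t = lpCurve μ u t) ∧ ∀ t ∈ Set.Icc 0 T, V t = lpCurve μ h t := by
  set V : ℝ → Lp ℂ 2 μ := Set.IccExtend hT ((Set.Icc 0 T).domRestrict (lpCurve μ h)) with hV
  have hVc : Continuous V := (continuousOn_iff_continuous_domRestrict.1 H.right.continuousOn).Icc_extend'
  have hVe : ∀ t ∈ Set.Icc 0 T, V t = lpCurve μ h t := fun t ht => by
    rw [hV, Set.IccExtend_of_mem hT _ ht]; rfl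
  have h0 : (0 : ℝ) ∈ Set.Icc 0 T := ⟨le_rfl, hT⟩
  refine ⟨fun t => lpCurve μ u 0 + ∫ τ in (0 : ℝ)..t, V τ, V, hVc, fun t => ?_, fun t ht => ?_, hVe⟩
  · exact (intervalIntegral.integral_hasDerivAt_right (hVc.intervalIntegrable _ _)
      (hVc.stronglyMeasurableAtFilter _ _) hVc.continuousAt).const_add _
  -- The inner product with `Ψ` passes through the Bochner integral, and the identity becomes the
  -- weak formulation tested against the conjugate of `Ψ`.
  · refine ext_inner_left ℂ fun Ψ => ?_
    have hψ : MemLp (fun x => (starRingEnd ℂ) (Ψ x)) 2 μ := (Lp.memLp Ψ).star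
    have e : ∀ (v : ℝ → α → ℂ), L2Cont μ T v → ∀ τ ∈ Set.Icc 0 T,
        inner ℂ Ψ (lpCurve μ v τ) = ∫ x, (starRingEnd ℂ) (Ψ x) * v τ x ∂μ := fun v hv τ hτ => by
      rw [L2.inner_def]
      refine integral_congr_ae ?_
      filter_upwards [hv.coeFn hτ] with x h2
      rw [h2, RCLike.inner_apply, mul_comm]
    rw [inner_add_right, e u H.left t ht, e u H.left 0 h0, H.weak _ hψ t ht]
    congr 1
    have hI := (innerSL ℂ Ψ).intervalIntegral_comp_comm (hVc.intervalIntegrable (μ := volume) 0 t)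
    simp only [innerSL_apply_apply] at hI
    rw [← hI]
    refine intervalIntegral.integral_congr fun τ hτ => ?_
    rw [Set.uIcc_of_le ht.1] at hτ
    have hτ' : τ ∈ Set.Icc 0 T := ⟨hτ.1, hτ.2.trans ht.2⟩
    simp only [hVe τ hτ', e h H.right τ hτ']

/-- Since the evolution coincides with a differentiable Hilbert space valued curve, the product rule
for the inner product applies; the two terms are conjugate, hence twice a real part. -/
theorem L2Evol.hasDerivAt {u h : ℝ → α → ℂ} (H : L2Evol μ T u h) (hT : 0 ≤ T) {t : ℝ}
    (ht : t ∈ Set.Ioo 0 T) :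
    HasDerivAt (fun t => (∫ x, (starRingEnd ℂ) (u t x) * u t x ∂μ).re)
      (2 * (∫ x, (starRingEnd ℂ) (u t x) * h t x ∂μ).re) t := by
  obtain ⟨U, V, hVc, hUV, hU, hV⟩ := H.exists_curve hT
  have ht' := Set.Ioo_subset_Icc_self ht
  have h1 := (hUV t).inner ℂ (hUV t)
  have h2 := Complex.reCLM.hasFDerivAt.comp_hasDerivAt t h1
  have h3 : HasDerivAt (fun t => (inner ℂ (U t) (U t)).re)
      (2 * (inner ℂ (U t) (V t)).re) t := by
    refine h2.congr_deriv ?_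
    simp only [Complex.reCLM_apply, Complex.add_re]
    rw [← inner_conj_symm (V t) (U t), Complex.conj_re]
    ring
  rw [hU t ht', hV t ht', H.left.inner_eq H.right ht' ht'] at h3
  refine h3.congr_of_eventuallyEq ?_
  filter_upwards [Ioo_mem_nhds ht.1 ht.2] with s hs
  have hs' := Set.Ioo_subset_Icc_self hs
  rw [hU s hs', H.left.inner_eq H.left hs' hs']

end L2

/-- An evolution equation on an open set that holds against smooth compactly supported functions
holds against square integrable functions. -/
theorem L2Evol.of_schwartz {Ω : Set R3} (hΩ : IsOpen Ω) {T : ℝ} {u h : ℝ → R3 → ℂ}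
    (hu : L2Cont (volume.restrict Ω) T u) (hh : L2Cont (volume.restrict Ω) T h)
    (H : ∀ φ : 𝓢(R3, ℂ), HasCompactSupport φ → tsupport φ ⊆ Ω → ∀ t ∈ Set.Icc 0 T,
      ∫ ξ, φ ξ * u t ξ = (∫ ξ, φ ξ * u 0 ξ) + ∫ τ in (0 : ℝ)..t, ∫ ξ, φ ξ * h τ ξ) :
    L2Evol (volume.restrict Ω) T u h := by
  set μ := (volume : Measure R3).restrict Ω with hμ
  refine ⟨hu, hh, fun ψ hψ t ht => ?_⟩
  have hT : 0 ≤ T := ht.1.trans ht.2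
  have h0 : (0 : ℝ) ∈ Set.Icc 0 T := ⟨le_rfl, hT⟩
  set V : ℝ → Lp ℂ 2 μ := Set.IccExtend hT ((Set.Icc 0 T).domRestrict (lpCurve μ h)) with hV
  have hVc : Continuous V := (continuousOn_iff_continuous_domRestrict.1 hh.continuousOn).Icc_extend'
  have hVe : ∀ t ∈ Set.Icc 0 T, V t = lpCurve μ h t := fun t ht => by
    rw [hV, Set.IccExtend_of_mem hT _ ht]; rfl
  have key : ∀ ψ : R3 → ℂ, MemLp ψ 2 μ → ∀ D : Lp ℂ 2 μ,
      D = lpCurve μ u t - lpCurve μ u 0 - ∫ τ in (0 : ℝ)..t, V τ →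
      ∫ x, ψ x * D x ∂μ = (∫ x, ψ x * u t x ∂μ) - (∫ x, ψ x * u 0 x ∂μ) -
        ∫ τ in (0 : ℝ)..t, ∫ x, ψ x * h τ x ∂μ := by
    intro ψ hψ D hD
    have hΨ : MemLp (fun x => (starRingEnd ℂ) (ψ x)) 2 μ := hψ.star
    have e0 : ∀ G : Lp ℂ 2 μ, inner ℂ (hΨ.toLp _) G = ∫ x, ψ x * G x ∂μ := fun G => by
      rw [L2.inner_def]
      refine integral_congr_ae ?_
      filter_upwards [hΨ.coeFn_toLp] with x h1
      rw [h1, RCLike.inner_apply, mul_comm]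
      simp
    have e : ∀ (v : ℝ → R3 → ℂ), L2Cont μ T v → ∀ τ ∈ Set.Icc 0 T,
        inner ℂ (hΨ.toLp _) (lpCurve μ v τ) = ∫ x, ψ x * v τ x ∂μ := fun v hv τ hτ => by
      rw [e0]
      refine integral_congr_ae ?_
      filter_upwards [hv.coeFn hτ] with x h2
      rw [h2]
    rw [← e0, hD, inner_sub_right, inner_sub_right, e u hu t ht, e u hu 0 h0]
    congr 1
    have hI := (innerSL ℂ (hΨ.toLp _)).intervalIntegral_comp_comm
      (hVc.intervalIntegrable (μ := volume) 0 t)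
    simp only [innerSL_apply_apply] at hI
    rw [← hI]
    refine intervalIntegral.integral_congr fun τ hτ => ?_
    rw [Set.uIcc_of_le ht.1] at hτ
    have hτ' : τ ∈ Set.Icc 0 T := ⟨hτ.1, hτ.2.trans ht.2⟩
    simp only [hVe τ hτ', e h hh τ hτ']
  set D : Lp ℂ 2 μ := lpCurve μ u t - lpCurve μ u 0 - ∫ τ in (0 : ℝ)..t, V τ with hD
  -- The defect `D` of the equation is an element of `L²` of the open set. It is orthogonal to all
  -- test functions supported there, hence zero, and then every `L²` function may serve as a test.
  have hD0 : ∀ᵐ x ∂μ, D x = 0 := by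
    refine (ae_restrict_iff' hΩ.measurableSet).2 ?_
    refine hΩ.ae_eq_zero_of_integral_contDiff_smul_eq_zero ?_ ?_
    · have : LocallyIntegrable D μ := (Lp.memLp D).locallyIntegrable (by norm_num)
      rw [locallyIntegrableOn_iff hΩ.isLocallyClosed]
      intro k hk hkc
      have h2 := this.integrableOn_isCompact hkc
      have e : μ.restrict k = volume.restrict k := by
        rw [hμ, Measure.restrict_restrict hkc.measurableSet, Set.inter_eq_left.2 hk]
      rw [IntegrableOn, ← e]
      exact h2
    · intro b hb hbc hbΩ
      have hb₁ : HasCompactSupport (Complex.ofRealCLM ∘ b) := hbc.comp_left rfl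
      have hb₂ : ContDiff ℝ (⊤ : ℕ∞) (Complex.ofRealCLM ∘ b) := Complex.ofRealCLM.contDiff.comp hb
      set φ := hb₁.toSchwartzMap hb₂ with hφ
      have hφe : ∀ x, φ x = (b x : ℂ) := fun x => rfl
      have hφc : HasCompactSupport φ := hb₁
      have hφΩ : tsupport φ ⊆ Ω := by
        refine subset_trans ?_ hbΩ
        exact closure_mono fun x hx => by
          simpa [hφe, Function.mem_support] using hx
      have hsupp : ∀ g : R3 → ℂ, ∫ x, φ x * g x = ∫ x, φ x * g x ∂μ := fun g => by
        rw [hμ, setIntegral_eq_integral_of_forall_compl_eq_zero]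
        intro x hx
        have : x ∉ tsupport φ := fun h => hx (hφΩ h)
        rw [image_eq_zero_of_notMem_tsupport this, zero_mul]
      have h1 := H φ hφc hφΩ t ht
      simp only [hsupp] at h1
      have h2 := key φ ((φ.memLp 2 volume).restrict Ω) D rfl
      rw [h1, add_sub_cancel_left, sub_self, ← hsupp] at h2
      simpa [hφe] using h2
  have h3 := key ψ hψ D rfl
  rw [integral_eq_zero_of_ae (hD0.mono fun x hx => by simp [hx])] at h3
  linear_combination -h3

/-! ### The energy inequality -/

/-- Frequency annuli exhausting `ℝ³ \ {0}`. -/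
def annulus (n : ℕ) : Set R3 := {ξ | 1 / ((n : ℝ) + 1) < ‖ξ‖ ∧ ‖ξ‖ < n + 1}

theorem isOpen_annulus (n : ℕ) : IsOpen (annulus n) :=
  (isOpen_lt continuous_const continuous_norm).inter (isOpen_lt continuous_norm continuous_const)

theorem annulus_mono : Monotone annulus := fun m n hmn ξ hξ => by
  have : (m : ℝ) ≤ n := by exact_mod_cast hmn
  refine ⟨lt_of_le_of_lt ?_ hξ.1, hξ.2.trans_le (by linarith)⟩
  gcongr

theorem iUnion_annulus_ae : ∀ᵐ ξ : R3, ∃ n, ξ ∈ annulus n := by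
  filter_upwards [ae_ne_zero] with ξ hξ
  have hp : 0 < ‖ξ‖ := norm_pos_iff.2 hξ
  obtain ⟨n, hn⟩ := exists_nat_gt (max ‖ξ‖ (1 / ‖ξ‖))
  have h1 := (le_max_left _ _).trans_lt hn
  have h2 := (le_max_right _ _).trans_lt hn
  refine ⟨n, ?_, by linarith⟩
  rw [div_lt_iff₀ hp] at h2
  rw [div_lt_iff₀ (by positivity)]
  nlinarith

theorem ne_zero_of_mem_annulus {n : ℕ} {ξ : R3} (h : ξ ∈ annulus n) : ξ ≠ 0 := by
  have : 0 < ‖ξ‖ := lt_trans (by positivity) h.1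
  exact norm_pos_iff.1 this

/-- Lebesgue measure on an annulus. -/
def annMeas (n : ℕ) : Measure R3 := volume.restrict (annulus n)

/-- A time dependent field that is continuous in time with values in `L²` of every annulus. -/
def VCont (T : ℝ) (g : ℝ → R3 → Fin 4 → ℂ) : Prop :=
  ∀ n k, L2Cont (annMeas n) T fun t ξ => g t ξ k

/-- A weight bounded on every annulus. -/
structure LocBdd (ω : R3 → ℝ≥0∞) : Prop where
  measurable : Measurable ω
  bdd : ∀ n, ∃ K : ℝ≥0, ∀ ξ ∈ annulus n, ω ξ ≤ K

theorem locBdd_wt (s : ℝ) : LocBdd (wt s) := by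
  refine ⟨measurable_wt s, fun n => ?_⟩
  refine ⟨((2 * Real.pi * (n + 1)) ^ s + (2 * Real.pi * (1 / (n + 1))) ^ s).toNNReal,
    fun ξ hξ => ?_⟩
  rw [wt, show ((((2 * Real.pi * (n + 1)) ^ s + (2 * Real.pi * (1 / (n + 1))) ^ s).toNNReal :
    ℝ≥0) : ℝ≥0∞) = ENNReal.ofReal _ from rfl]
  refine ENNReal.ofReal_le_ofReal ?_
  have hpi := Real.pi_pos
  have hp : 0 < ‖ξ‖ := lt_trans (by positivity) hξ.1
  rcases le_total 0 s with hs | hs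
  · refine le_add_of_le_of_nonneg ?_ (by positivity)
    refine Real.rpow_le_rpow (by positivity) ?_ hs
    gcongr
    exact hξ.2.le
  · refine le_add_of_nonneg_of_le (by positivity) ?_
    refine Real.rpow_le_rpow_of_nonpos (by positivity) ?_ hs
    gcongr
    exact hξ.1.le

theorem LocBdd.mul {ω ω' : R3 → ℝ≥0∞} (h : LocBdd ω) (h' : LocBdd ω') :
    LocBdd fun ξ => ω ξ * ω' ξ := by
  refine ⟨h.measurable.mul h'.measurable, fun n => ?_⟩
  obtain ⟨K, hK⟩ := h.bdd n
  obtain ⟨K', hK'⟩ := h'.bdd n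
  exact ⟨K * K', fun ξ hξ => by push_cast; exact mul_le_mul' (hK ξ hξ) (hK' ξ hξ)⟩

theorem LocBdd.indicator {ω : R3 → ℝ≥0∞} (h : LocBdd ω) {B : Set R3} (hB : MeasurableSet B) :
    LocBdd (B.indicator ω) := by
  refine ⟨h.measurable.indicator hB, fun n => ?_⟩
  obtain ⟨K, hK⟩ := h.bdd n
  exact ⟨K, fun ξ hξ => (Set.indicator_le_self B ω ξ).trans (hK ξ hξ)⟩

/-- Square root of a weight, as a complex function. -/
def sqrtW (ω : R3 → ℝ≥0∞) (ξ : R3) : ℂ := (Real.sqrt (ω ξ).toReal : ℂ)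

theorem LocBdd.sqrtW_bdd {ω : R3 → ℝ≥0∞} (h : LocBdd ω) (n : ℕ) :
    AEStronglyMeasurable (sqrtW ω) (annMeas n) ∧
      ∃ K : ℝ, ∀ᵐ ξ ∂(annMeas n), ‖sqrtW ω ξ‖ ≤ K := by
  refine ⟨?_, ?_⟩
  · have := h.measurable
    unfold sqrtW
    exact Measurable.aestronglyMeasurable (by fun_prop)
  · obtain ⟨K, hK⟩ := h.bdd n
    refine ⟨Real.sqrt K, ?_⟩
    refine (ae_restrict_mem (isOpen_annulus n).measurableSet).mono fun ξ hξ => ?_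
    rw [sqrtW, Complex.norm_real, Real.norm_of_nonneg (Real.sqrt_nonneg _)]
    exact Real.sqrt_le_sqrt (ENNReal.toReal_le_coe_of_le_coe (hK ξ hξ))

theorem LocBdd.ofReal_sqrtW {ω : R3 → ℝ≥0∞} (h : LocBdd ω) (n : ℕ) :
    ∀ᵐ ξ ∂(annMeas n), ‖sqrtW ω ξ‖ₑ ^ 2 = ω ξ := by
  obtain ⟨K, hK⟩ := h.bdd n
  refine (ae_restrict_mem (isOpen_annulus n).measurableSet).mono fun ξ hξ => ?_
  have hne : ω ξ ≠ ∞ := ne_top_of_le_ne_top ENNReal.coe_ne_top (hK ξ hξ)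
  rw [sqrtW, ← ofReal_norm, Complex.norm_real, Real.norm_of_nonneg (Real.sqrt_nonneg _),
    ← ENNReal.ofReal_pow (Real.sqrt_nonneg _), Real.sq_sqrt ENNReal.toReal_nonneg,
    ENNReal.ofReal_toReal hne]

theorem L2Cont.lintegral_sq {α : Type*} [MeasurableSpace α] {μ : Measure α} {T : ℝ}
    {f : ℝ → α → ℂ} (hf : L2Cont μ T f) {t : ℝ} (ht : t ∈ Set.Icc 0 T) :
    ∫⁻ x, ‖f t x‖ₑ ^ 2 ∂μ =
      ENNReal.ofReal (∫ x, (starRingEnd ℂ) (f t x) * f t x ∂μ).re := by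
  have hi := hf.integrable hf ht
  have e : ∀ x, (starRingEnd ℂ) (f t x) * f t x = ((‖f t x‖ ^ 2 : ℝ) : ℂ) := fun x => by
    rw [mul_comm, Complex.mul_conj, Complex.normSq_eq_norm_sq]
  have hi2 : Integrable (fun x => ‖f t x‖ ^ 2) μ := by
    have := hi.re
    simp only [e, RCLike.re_to_complex, Complex.ofReal_re] at this
    exact this
  simp only [e]
  rw [integral_complex_ofReal, Complex.ofReal_re, ofReal_integral_eq_lintegral_ofReal hi2
    (ae_of_all _ fun x => by positivity)]
  refine lintegral_congr fun x => ?_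
  rw [ENNReal.ofReal_pow (norm_nonneg _), ofReal_norm]

theorem toReal_amp_eq (a : Fin 4 → ℂ) : (amp a).toReal = ‖WithLp.toLp 2 a‖ := by
  rw [EuclideanSpace.norm_eq, amp, nsq_eq_ofReal, ENNReal.ofReal_rpow_of_nonneg
    (Finset.sum_nonneg fun k _ => Complex.normSq_nonneg _) (by norm_num),
    ENNReal.toReal_ofReal (Real.rpow_nonneg
      (Finset.sum_nonneg fun k _ => Complex.normSq_nonneg _) _), Real.sqrt_eq_rpow]
  simp only [Complex.normSq_eq_norm_sq]

theorem toReal_amp_le (a : Fin 4 → ℂ) : (amp a).toReal ≤ ∑ k, ‖a k‖ := by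
  rw [toReal_amp_eq, EuclideanSpace.norm_eq, Real.sqrt_le_left
    (Finset.sum_nonneg fun k _ => norm_nonneg _)]
  exact Finset.sum_sq_le_sq_sum_of_nonneg fun k _ => norm_nonneg _

theorem abs_toReal_amp_sub_le (a b : Fin 4 → ℂ) :
    |(amp a).toReal - (amp b).toReal| ≤ ∑ k, ‖a k - b k‖ := by
  have h1 := toReal_amp_le (a - b)
  rw [toReal_amp_eq] at h1
  rw [toReal_amp_eq, toReal_amp_eq]
  exact (abs_norm_sub_norm_le _ _).trans h1

theorem amp_ne_top (a : Fin 4 → ℂ) : amp a ≠ ∞ :=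
  ENNReal.rpow_ne_top_of_nonneg (by norm_num) (nsq_ne_top a)

theorem VCont.amp {T : ℝ} {g : ℝ → R3 → Fin 4 → ℂ} (hg : VCont T g) (n : ℕ) :
    L2Cont (annMeas n) T fun t ξ => ((amp (g t ξ)).toReal : ℂ) := by
  refine L2Cont.of_le (K := 1) (fun k => hg n k) (fun t ht => ?_)
    (fun t _ => ae_of_all _ fun ξ => ?_) (fun t _ t₀ _ => ae_of_all _ fun ξ => ?_)
  · have : AEMeasurable (fun ξ => QG.amp (g t ξ)) (annMeas n) := by
      unfold QG.amp nsq
      exact (Finset.aemeasurable_fun_sum _ fun k _ =>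
        ((hg n k).memLp t ht).1.enorm.pow_const 2).pow_const _
    exact (Complex.measurable_ofReal.comp_aemeasurable this.ennreal_toReal).aestronglyMeasurable
  · rw [Complex.norm_real, Real.norm_of_nonneg ENNReal.toReal_nonneg]
    simpa using toReal_amp_le (g t ξ)
  · rw [← Complex.ofReal_sub, Complex.norm_real]
    simpa using abs_toReal_amp_sub_le (g t ξ) (g t₀ ξ)

/-- Weighted energy on an annulus. -/
def annE (ω : R3 → ℝ≥0∞) (n : ℕ) (g : R3 → Fin 4 → ℂ) : ℝ≥0∞ :=
  ∫⁻ ξ in annulus n, ω ξ * nsq (g ξ)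

/-- Weighted pairing of two fields on an annulus. -/
def annP (ω : R3 → ℝ≥0∞) (n : ℕ) (g g' : R3 → Fin 4 → ℂ) : ℝ≥0∞ :=
  ∫⁻ ξ in annulus n, ω ξ * (amp (g ξ) * amp (g' ξ))

theorem VCont.weighted {T : ℝ} {g : ℝ → R3 → Fin 4 → ℂ} (hg : VCont T g) {ω : R3 → ℝ≥0∞}
    (hω : LocBdd ω) (n : ℕ) (k : Fin 4) :
    L2Cont (annMeas n) T fun t ξ => sqrtW ω ξ * g t ξ k := by
  obtain ⟨h1, K, hK⟩ := hω.sqrtW_bdd n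
  exact (hg n k).bdd_mul h1 hK

theorem VCont.weighted_amp {T : ℝ} {g : ℝ → R3 → Fin 4 → ℂ} (hg : VCont T g) {ω : R3 → ℝ≥0∞}
    (hω : LocBdd ω) (n : ℕ) :
    L2Cont (annMeas n) T fun t ξ => sqrtW ω ξ * ((QG.amp (g t ξ)).toReal : ℂ) := by
  obtain ⟨h1, K, hK⟩ := hω.sqrtW_bdd n
  exact (hg.amp n).bdd_mul h1 hK

/-- The weighted energy on an annulus is the square of an `L²` norm. -/
theorem VCont.annE_eq {T : ℝ} {g : ℝ → R3 → Fin 4 → ℂ} (hg : VCont T g) {ω : R3 → ℝ≥0∞}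
    (hω : LocBdd ω) (n : ℕ) {t : ℝ} (ht : t ∈ Set.Icc 0 T) :
    annE ω n (g t) = ENNReal.ofReal (∑ k, (∫ ξ, (starRingEnd ℂ) (sqrtW ω ξ * g t ξ k) *
      (sqrtW ω ξ * g t ξ k) ∂(annMeas n)).re) := by
  have hnn : ∀ k, 0 ≤ (∫ ξ, (starRingEnd ℂ) (sqrtW ω ξ * g t ξ k) *
      (sqrtW ω ξ * g t ξ k) ∂(annMeas n)).re := fun k => by
    rw [← (hg.weighted hω n k).inner_eq (hg.weighted hω n k) ht ht]
    exact inner_self_nonneg (𝕜 := ℂ)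
  rw [ENNReal.ofReal_sum_of_nonneg fun k _ => hnn k]
  simp only [← (hg.weighted hω n _).lintegral_sq ht]
  rw [← lintegral_finsetSum']
  · refine lintegral_congr_ae ?_
    filter_upwards [hω.ofReal_sqrtW n] with ξ hξ
    simp only [enorm_mul, mul_pow, hξ, nsq, Finset.mul_sum]
  · intro k _
    exact ((hg.weighted hω n k).memLp t ht).1.enorm.pow_const 2

theorem VCont.annP_eq {T : ℝ} {g g' : ℝ → R3 → Fin 4 → ℂ} (hg : VCont T g) (hg' : VCont T g')
    {ω : R3 → ℝ≥0∞} (hω : LocBdd ω) (n : ℕ) {t : ℝ} (ht : t ∈ Set.Icc 0 T) :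
    annP ω n (g t) (g' t) = ENNReal.ofReal (∫ ξ, (starRingEnd ℂ)
      (sqrtW ω ξ * ((QG.amp (g t ξ)).toReal : ℂ)) *
      (sqrtW ω ξ * ((QG.amp (g' t ξ)).toReal : ℂ)) ∂(annMeas n)).re := by
  have hi := (hg.weighted_amp hω n).integrable (hg'.weighted_amp hω n) ht
  have e : ∀ ξ, (starRingEnd ℂ) (sqrtW ω ξ * ((QG.amp (g t ξ)).toReal : ℂ)) *
      (sqrtW ω ξ * ((QG.amp (g' t ξ)).toReal : ℂ)) = ((Real.sqrt (ω ξ).toReal ^ 2 *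
        ((QG.amp (g t ξ)).toReal * (QG.amp (g' t ξ)).toReal) : ℝ) : ℂ) := fun ξ => by
    simp only [sqrtW, map_mul, Complex.conj_ofReal]
    push_cast
    ring
  simp only [e] at hi ⊢
  have hi2 := hi.re
  simp only [RCLike.re_to_complex, Complex.ofReal_re] at hi2
  rw [integral_complex_ofReal, Complex.ofReal_re, ofReal_integral_eq_lintegral_ofReal hi2
    (ae_of_all _ fun x => by positivity)]
  refine lintegral_congr_ae ?_
  filter_upwards [hω.ofReal_sqrtW n] with ξ hξ
  rw [ENNReal.ofReal_mul (by positivity), ENNReal.ofReal_mul (by positivity),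
    ENNReal.ofReal_toReal (amp_ne_top _), ENNReal.ofReal_toReal (amp_ne_top _),
    ENNReal.ofReal_pow (by positivity)]
  congr 1
  rw [sqrtW, ← ofReal_norm, Complex.norm_real, Real.norm_of_nonneg (Real.sqrt_nonneg _)] at hξ
  exact hξ.symm

theorem ofReal_intervalIntegral {f : ℝ → ℝ} {t : ℝ} (ht : 0 ≤ t)
    (hi : IntervalIntegrable f volume 0 t) (hf : ∀ τ ∈ Set.Ioo 0 t, 0 ≤ f τ) :
    ENNReal.ofReal (∫ τ in (0 : ℝ)..t, f τ) = ∫⁻ τ in Set.Ioo 0 t, ENNReal.ofReal (f τ) := by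
  rw [intervalIntegral.integral_of_le ht, ← restrict_Ioo_eq_restrict_Ioc,
    ofReal_integral_eq_lintegral_ofReal]
  · rw [intervalIntegrable_iff_integrableOn_Ioo_of_le ht] at hi
    exact hi
  · exact (ae_restrict_mem measurableSet_Ioo).mono hf

/-- Integration of a scalar differential inequality against a power of time. -/
theorem scalar_energy_le {ν T : ℝ} (hν : 0 ≤ ν) {f f' g p : ℝ → ℝ}
    (hf : ContinuousOn f (Set.Icc 0 T)) (hf' : ContinuousOn f' (Set.Icc 0 T))
    (hg : ContinuousOn g (Set.Icc 0 T)) (hp : ContinuousOn p (Set.Icc 0 T))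
    (hf0 : ∀ τ ∈ Set.Icc 0 T, 0 ≤ f τ) (hg0 : ∀ τ ∈ Set.Icc 0 T, 0 ≤ g τ)
    (hp0 : ∀ τ ∈ Set.Icc 0 T, 0 ≤ p τ) (hd : ∀ τ ∈ Set.Ioo 0 T, HasDerivAt f (2 * f' τ) τ)
    (hle : ∀ τ ∈ Set.Icc 0 T, f' τ ≤ -ν * g τ + p τ) {γ : ℝ} (hγ : 0 ≤ γ) {t : ℝ}
    (ht : t ∈ Set.Icc 0 T) :
    ENNReal.ofReal (t ^ γ) * ENNReal.ofReal (f t) +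
        ENNReal.ofReal (2 * ν) *
          ∫⁻ τ in Set.Ioo 0 t, ENNReal.ofReal (τ ^ γ) * ENNReal.ofReal (g τ) ≤
      ENNReal.ofReal (0 ^ γ) * ENNReal.ofReal (f 0) +
        ENNReal.ofReal γ * (∫⁻ τ in Set.Ioo 0 t,
          ENNReal.ofReal (τ ^ (γ - 1)) * ENNReal.ofReal (f τ)) +
        2 * ∫⁻ τ in Set.Ioo 0 t, ENNReal.ofReal (τ ^ γ) * ENNReal.ofReal (p τ) := by
  have hT : 0 ≤ T := ht.1.trans ht.2
  have h0 : (0 : ℝ) ∈ Set.Icc 0 T := ⟨le_rfl, hT⟩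
  have hsub : Set.Icc 0 t ⊆ Set.Icc 0 T := Set.Icc_subset_Icc_right ht.2
  have hsub' : Set.Ioo 0 t ⊆ Set.Icc 0 T := Set.Ioo_subset_Icc_self.trans hsub
  have hu : Set.uIcc 0 t = Set.Icc 0 t := Set.uIcc_of_le ht.1
  have hpow : ContinuousOn (fun τ : ℝ => τ ^ γ) (Set.Icc 0 t) :=
    (Real.continuous_rpow_const hγ).continuousOn
  have hI : ∀ {q : ℝ → ℝ}, ContinuousOn q (Set.Icc 0 T) →
      IntervalIntegrable (fun τ => τ ^ γ * q τ) volume 0 t := fun hq => by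
    refine ContinuousOn.intervalIntegrable ?_
    rw [hu]
    exact hpow.mul (hq.mono hsub)
  -- For `γ = 0` the power `τ⁻¹` is not integrable, but its coefficient `γ` vanishes.
  have hI1 : IntervalIntegrable (fun τ => γ * (τ ^ (γ - 1) * f τ)) volume 0 t := by
    rcases hγ.eq_or_lt with h | h
    · simp [← h]
    · refine ((intervalIntegral.intervalIntegrable_rpow' (by linarith)).mul_continuousOn
        ?_).const_mul γ
      rw [hu]
      exact hf.mono hsub
  have hftc := intervalIntegral.integral_eq_sub_of_hasDerivAt_of_le ht.1
    (f := fun τ => τ ^ γ * f τ)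
    (f' := fun τ => γ * (τ ^ (γ - 1) * f τ) + 2 * (τ ^ γ * f' τ)) (hpow.mul (hf.mono hsub))
    (fun τ hτ => by
      have h1 := (Real.hasDerivAt_rpow_const (x := τ) (p := γ) (Or.inl hτ.1.ne')).mul
        (hd τ ⟨hτ.1, hτ.2.trans_le ht.2⟩)
      exact h1.congr_deriv (by ring))
    (hI1.add ((hI hf').const_mul 2))
  rw [intervalIntegral.integral_add hI1 ((hI hf').const_mul 2),
    intervalIntegral.integral_const_mul, intervalIntegral.integral_const_mul] at hftc
  have hmono : ∫ τ in (0 : ℝ)..t, τ ^ γ * f' τ ≤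
      -ν * (∫ τ in (0 : ℝ)..t, τ ^ γ * g τ) + ∫ τ in (0 : ℝ)..t, τ ^ γ * p τ := by
    rw [← intervalIntegral.integral_const_mul,
      ← intervalIntegral.integral_add ((hI hg).const_mul _) (hI hp)]
    refine intervalIntegral.integral_mono_on ht.1 (hI hf')
      (((hI hg).const_mul _).add (hI hp)) fun τ hτ => ?_
    have := mul_le_mul_of_nonneg_left (hle τ (hsub hτ)) (Real.rpow_nonneg hτ.1 γ)
    linarith
  -- The boundary term at zero carries `0 ^ γ`, which is `1` for `γ = 0` and `0` for `γ > 0`: a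
  -- positive power of time forgets the initial value, at the price of the integral with `τ ^ (γ -
  -- 1)`.
  have key : t ^ γ * f t + 2 * ν * (∫ τ in (0 : ℝ)..t, τ ^ γ * g τ) ≤
      0 ^ γ * f 0 + γ * (∫ τ in (0 : ℝ)..t, τ ^ (γ - 1) * f τ) +
        2 * ∫ τ in (0 : ℝ)..t, τ ^ γ * p τ := by linarith
  have hnn : ∀ {q : ℝ → ℝ}, (∀ τ ∈ Set.Icc 0 T, 0 ≤ q τ) →
      0 ≤ ∫ τ in (0 : ℝ)..t, τ ^ γ * q τ := fun hq =>
    intervalIntegral.integral_nonneg ht.1 fun τ hτ =>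
      mul_nonneg (Real.rpow_nonneg hτ.1 _) (hq τ (hsub hτ))
  have hnn1 : 0 ≤ ∫ τ in (0 : ℝ)..t, τ ^ (γ - 1) * f τ :=
    intervalIntegral.integral_nonneg ht.1 fun τ hτ =>
      mul_nonneg (Real.rpow_nonneg hτ.1 _) (hf0 τ (hsub hτ))
  have e : ∀ {q : ℝ → ℝ}, ContinuousOn q (Set.Icc 0 T) → (∀ τ ∈ Set.Icc 0 T, 0 ≤ q τ) →
      ENNReal.ofReal (∫ τ in (0 : ℝ)..t, τ ^ γ * q τ) =
        ∫⁻ τ in Set.Ioo 0 t, ENNReal.ofReal (τ ^ γ) * ENNReal.ofReal (q τ) := fun hq hq0 => by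
    rw [ofReal_intervalIntegral ht.1 (hI hq) fun τ hτ =>
      mul_nonneg (Real.rpow_nonneg hτ.1.le _) (hq0 τ (hsub' hτ))]
    exact setLIntegral_congr_fun measurableSet_Ioo fun τ hτ =>
      ENNReal.ofReal_mul (Real.rpow_nonneg hτ.1.le _)
  have e1 : ENNReal.ofReal (γ * ∫ τ in (0 : ℝ)..t, τ ^ (γ - 1) * f τ) =
      ENNReal.ofReal γ * (∫⁻ τ in Set.Ioo 0 t,
          ENNReal.ofReal (τ ^ (γ - 1)) * ENNReal.ofReal (f τ)) := by
    rcases hγ.eq_or_lt with h | h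
    · simp [← h]
    · rw [ENNReal.ofReal_mul hγ]
      congr 1
      rw [ofReal_intervalIntegral ht.1 ?_ fun τ hτ =>
        mul_nonneg (Real.rpow_nonneg hτ.1.le _) (hf0 τ (hsub' hτ))]
      · exact setLIntegral_congr_fun measurableSet_Ioo fun τ hτ =>
          ENNReal.ofReal_mul (Real.rpow_nonneg hτ.1.le _)
      · refine (intervalIntegral.intervalIntegrable_rpow' (by linarith)).mul_continuousOn ?_
        rw [hu]
        exact hf.mono hsub
  rw [← e hg hg0, ← e hp hp0, ← e1, ← ENNReal.ofReal_mul (Real.rpow_nonneg ht.1 _),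
    ← ENNReal.ofReal_mul (by positivity), ← ENNReal.ofReal_mul (Real.rpow_nonneg le_rfl _),
    show (2 : ℝ≥0∞) = ENNReal.ofReal 2 by simp, ← ENNReal.ofReal_mul (by norm_num),
    ← ENNReal.ofReal_add (mul_nonneg (Real.rpow_nonneg ht.1 _) (hf0 t ht))
      (mul_nonneg (by positivity) (hnn hg0)),
    ← ENNReal.ofReal_add (mul_nonneg (Real.rpow_nonneg le_rfl _) (hf0 0 h0))
      (mul_nonneg hγ hnn1), ← ENNReal.ofReal_add
      (add_nonneg (mul_nonneg (Real.rpow_nonneg le_rfl _) (hf0 0 h0)) (mul_nonneg hγ hnn1))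
      (mul_nonneg (by norm_num) (hnn hp0))]
  exact ENNReal.ofReal_le_ofReal key

/-- `u` evolves by a dissipative linear equation with viscosity `ν` and forcing `N`, in the sense
that `∂_t |u|² ≤ - 2 ν |2πξ|² |u|² + 2 |u| |N|`. -/
structure DissEvol (ν T : ℝ) (u N : ℝ → R3 → Fin 4 → ℂ) : Prop where
  force : VCont T N
  evol : ∃ h : ℝ → R3 → Fin 4 → ℂ,
    (∀ n k, L2Evol (annMeas n) T (fun t ξ => u t ξ k) fun t ξ => h t ξ k) ∧
    ∀ t ∈ Set.Icc 0 T, ∀ᵐ ξ, (∑ k, (starRingEnd ℂ) (u t ξ k) * h t ξ k).re ≤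
      -ν * ((2 * Real.pi * ‖ξ‖) ^ 2 * ∑ k, Complex.normSq (u t ξ k)) +
        (amp (u t ξ)).toReal * (amp (N t ξ)).toReal

theorem DissEvol.left {ν T : ℝ} {u N : ℝ → R3 → Fin 4 → ℂ} (H : DissEvol ν T u N) : VCont T u := by
  obtain ⟨h, h1, -⟩ := H.evol
  exact fun n k => (h1 n k).left

/-- Real form of the weighted energy on an annulus. -/
def annR (ω : R3 → ℝ≥0∞) (n : ℕ) (g h : R3 → Fin 4 → ℂ) : ℝ :=
  ∑ k, (∫ ξ, (starRingEnd ℂ) (sqrtW ω ξ * g ξ k) * (sqrtW ω ξ * h ξ k) ∂(annMeas n)).re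

theorem VCont.continuousOn_annR {T : ℝ} {g h : ℝ → R3 → Fin 4 → ℂ} (hg : VCont T g)
    (hh : VCont T h) {ω : R3 → ℝ≥0∞} (hω : LocBdd ω) (n : ℕ) :
    ContinuousOn (fun t => annR ω n (g t) (h t)) (Set.Icc 0 T) := by
  unfold annR
  exact continuousOn_finsetSum _ fun k _ => Complex.continuous_re.comp_continuousOn
    ((hg.weighted hω n k).continuousOn_integral (hh.weighted hω n k))

theorem VCont.annR_nonneg {T : ℝ} {g : ℝ → R3 → Fin 4 → ℂ} (hg : VCont T g)
    {ω : R3 → ℝ≥0∞} (hω : LocBdd ω) (n : ℕ) {t : ℝ} (ht : t ∈ Set.Icc 0 T) :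
    0 ≤ annR ω n (g t) (g t) := by
  refine Finset.sum_nonneg fun k _ => ?_
  rw [← (hg.weighted hω n k).inner_eq (hg.weighted hω n k) ht ht]
  exact inner_self_nonneg (𝕜 := ℂ)

theorem VCont.annR_eq_integral {T : ℝ} {g h : ℝ → R3 → Fin 4 → ℂ} (hg : VCont T g)
    (hh : VCont T h) {ω : R3 → ℝ≥0∞} (hω : LocBdd ω) (n : ℕ) {t : ℝ} (ht : t ∈ Set.Icc 0 T) :
    Integrable (fun ξ => (ω ξ).toReal * (∑ k, (starRingEnd ℂ) (g t ξ k) * h t ξ k).re)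
      (annMeas n) ∧
    annR ω n (g t) (h t) =
      ∫ ξ, (ω ξ).toReal * (∑ k, (starRingEnd ℂ) (g t ξ k) * h t ξ k).re ∂(annMeas n) := by
  have hi : ∀ k : Fin 4, Integrable (fun ξ => ((starRingEnd ℂ) (sqrtW ω ξ * g t ξ k) *
      (sqrtW ω ξ * h t ξ k)).re) (annMeas n) := fun k => by
    have := ((hg.weighted hω n k).integrable (hh.weighted hω n k) ht).re
    exact this
  have e : ∀ ξ, (ω ξ).toReal * (∑ k, (starRingEnd ℂ) (g t ξ k) * h t ξ k).re =
      ∑ k, ((starRingEnd ℂ) (sqrtW ω ξ * g t ξ k) * (sqrtW ω ξ * h t ξ k)).re := fun ξ => by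
    rw [Complex.re_sum, Finset.mul_sum]
    refine Finset.sum_congr rfl fun k _ => ?_
    rw [← Complex.re_ofReal_mul, map_mul]
    congr 1
    have : ((ω ξ).toReal : ℂ) = sqrtW ω ξ * sqrtW ω ξ := by
      rw [sqrtW, ← Complex.ofReal_mul, Real.mul_self_sqrt ENNReal.toReal_nonneg]
    rw [this, show (starRingEnd ℂ) (sqrtW ω ξ) = sqrtW ω ξ from Complex.conj_ofReal _]
    ring
  simp only [e]
  refine ⟨integrable_finsetSum _ fun k _ => hi k, ?_⟩
  rw [integral_finsetSum _ fun k _ => hi k, annR]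
  refine Finset.sum_congr rfl fun k _ => ?_
  exact (integral_re ((hg.weighted hω n k).integrable (hh.weighted hω n k) ht)).symm

theorem VCont.continuousOn_annE {T : ℝ} {g : ℝ → R3 → Fin 4 → ℂ} (hg : VCont T g)
    {ω : R3 → ℝ≥0∞} (hω : LocBdd ω) (n : ℕ) :
    ContinuousOn (fun t => annE ω n (g t)) (Set.Icc 0 T) :=
  (ENNReal.continuous_ofReal.comp_continuousOn (hg.continuousOn_annR hg hω n)).congr
    fun _ ht => hg.annE_eq hω n ht

/-- Real form of the pairing on an annulus. -/
def annRP (ω : R3 → ℝ≥0∞) (n : ℕ) (g g' : R3 → Fin 4 → ℂ) : ℝ :=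
  (∫ ξ, (starRingEnd ℂ) (sqrtW ω ξ * ((amp (g ξ)).toReal : ℂ)) *
      (sqrtW ω ξ * ((amp (g' ξ)).toReal : ℂ)) ∂(annMeas n)).re

theorem VCont.continuousOn_annRP {T : ℝ} {g h : ℝ → R3 → Fin 4 → ℂ} (hg : VCont T g)
    (hh : VCont T h) {ω : R3 → ℝ≥0∞} (hω : LocBdd ω) (n : ℕ) :
    ContinuousOn (fun t => annRP ω n (g t) (h t)) (Set.Icc 0 T) :=
  Complex.continuous_re.comp_continuousOn
    ((hg.weighted_amp hω n).continuousOn_integral (hh.weighted_amp hω n))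

theorem VCont.annRP_eq_integral {T : ℝ} {g h : ℝ → R3 → Fin 4 → ℂ} (hg : VCont T g)
    (hh : VCont T h) {ω : R3 → ℝ≥0∞} (hω : LocBdd ω) (n : ℕ) {t : ℝ} (ht : t ∈ Set.Icc 0 T) :
    Integrable (fun ξ => (ω ξ).toReal * ((QG.amp (g t ξ)).toReal * (QG.amp (h t ξ)).toReal))
      (annMeas n) ∧
    annRP ω n (g t) (h t) =
      ∫ ξ, (ω ξ).toReal * ((QG.amp (g t ξ)).toReal * (QG.amp (h t ξ)).toReal) ∂(annMeas n) := by
  have hi := ((hg.weighted_amp hω n).integrable (hh.weighted_amp hω n) ht)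
  have e : ∀ ξ, (starRingEnd ℂ) (sqrtW ω ξ * ((QG.amp (g t ξ)).toReal : ℂ)) *
      (sqrtW ω ξ * ((QG.amp (h t ξ)).toReal : ℂ)) =
      (((ω ξ).toReal * ((QG.amp (g t ξ)).toReal * (QG.amp (h t ξ)).toReal) : ℝ) : ℂ) := fun ξ => by
    have : ((ω ξ).toReal : ℂ) = sqrtW ω ξ * sqrtW ω ξ := by
      rw [sqrtW, ← Complex.ofReal_mul, Real.mul_self_sqrt ENNReal.toReal_nonneg]
    rw [Complex.ofReal_mul, Complex.ofReal_mul, this, map_mul, Complex.conj_ofReal,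
      show (starRingEnd ℂ) (sqrtW ω ξ) = sqrtW ω ξ from Complex.conj_ofReal _]
    ring
  rw [annRP]
  simp only [e] at hi ⊢
  refine ⟨by simpa only [RCLike.re_to_complex, Complex.ofReal_re] using hi.re, ?_⟩
  rw [integral_complex_ofReal, Complex.ofReal_re]

theorem VCont.annRP_nonneg {T : ℝ} {g h : ℝ → R3 → Fin 4 → ℂ} (hg : VCont T g)
    (hh : VCont T h) {ω : R3 → ℝ≥0∞} (hω : LocBdd ω) (n : ℕ) {t : ℝ} (ht : t ∈ Set.Icc 0 T) :
    0 ≤ annRP ω n (g t) (h t) := by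
  rw [(hg.annRP_eq_integral hh hω n ht).2]
  exact integral_nonneg fun ξ => by positivity

theorem VCont.continuousOn_annP {T : ℝ} {g h : ℝ → R3 → Fin 4 → ℂ} (hg : VCont T g)
    (hh : VCont T h) {ω : R3 → ℝ≥0∞} (hω : LocBdd ω) (n : ℕ) :
    ContinuousOn (fun t => annP ω n (g t) (h t)) (Set.Icc 0 T) :=
  (ENNReal.continuous_ofReal.comp_continuousOn (hg.continuousOn_annRP hh hω n)).congr
    fun _ ht => hg.annP_eq hh hω n ht

/-- Energy inequality on an annulus. -/
theorem DissEvol.annulus_energy_le {ν T : ℝ} (hν : 0 ≤ ν) {u N : ℝ → R3 → Fin 4 → ℂ}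
    (H : DissEvol ν T u N) {ω : R3 → ℝ≥0∞} (hω : LocBdd ω) (n : ℕ) {γ : ℝ} (hγ : 0 ≤ γ) {t : ℝ}
    (ht : t ∈ Set.Icc 0 T) :
    ENNReal.ofReal (t ^ γ) * annE ω n (u t) +
        ENNReal.ofReal (2 * ν) * ∫⁻ τ in Set.Ioo 0 t, ENNReal.ofReal (τ ^ γ) *
          annE (fun ξ => ω ξ * wt 2 ξ) n (u τ) ≤
      ENNReal.ofReal (0 ^ γ) * annE ω n (u 0) +
        ENNReal.ofReal γ * (∫⁻ τ in Set.Ioo 0 t, ENNReal.ofReal (τ ^ (γ - 1)) *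
          annE ω n (u τ)) +
        2 * ∫⁻ τ in Set.Ioo 0 t, ENNReal.ofReal (τ ^ γ) * annP ω n (u τ) (N τ) := by
  have hu := H.left
  have hN := H.force
  obtain ⟨h, h1, h2⟩ := H.evol
  have hh : VCont T h := fun n k => (h1 n k).right
  have hT : 0 ≤ T := ht.1.trans ht.2
  have hω2 : LocBdd fun ξ => ω ξ * wt 2 ξ := hω.mul (locBdd_wt 2)
  have hd : ∀ τ ∈ Set.Ioo 0 T, HasDerivAt (fun t => annR ω n (u t) (u t))
      (2 * annR ω n (u τ) (h τ)) τ := fun τ hτ => by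
    obtain ⟨hm, K, hK⟩ := hω.sqrtW_bdd n
    have := HasDerivAt.fun_sum (u := Finset.univ) fun k _ =>
      ((h1 n k).bdd_mul hm hK).hasDerivAt hT hτ
    rw [← Finset.mul_sum] at this
    exact this
  have hle : ∀ τ ∈ Set.Icc 0 T, annR ω n (u τ) (h τ) ≤
      -ν * annR (fun ξ => ω ξ * wt 2 ξ) n (u τ) (u τ) + annRP ω n (u τ) (N τ) := by
    intro τ hτ
    obtain ⟨i1, e1⟩ := hu.annR_eq_integral hh hω n hτ
    obtain ⟨i2, e2⟩ := hu.annR_eq_integral hu hω2 n hτ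
    obtain ⟨i3, e3⟩ := hu.annRP_eq_integral hN hω n hτ
    rw [e1, e2, e3, ← integral_const_mul, ← integral_add (i2.const_mul _) i3]
    refine integral_mono_ae i1 ((i2.const_mul _).add i3) ?_
    filter_upwards [ae_restrict_of_ae (h2 τ hτ)] with ξ hξ
    have hw : (ω ξ * wt 2 ξ).toReal = (ω ξ).toReal * (2 * Real.pi * ‖ξ‖) ^ 2 := by
      rw [ENNReal.toReal_mul, wt, ENNReal.toReal_ofReal (by positivity), Real.rpow_two]
    have hs : (∑ k, (starRingEnd ℂ) (u τ ξ k) * u τ ξ k).re =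
        ∑ k, Complex.normSq (u τ ξ k) := by
      rw [Complex.re_sum]
      refine Finset.sum_congr rfl fun k _ => ?_
      rw [mul_comm, Complex.mul_conj, Complex.ofReal_re]
    have := mul_le_mul_of_nonneg_left hξ (ENNReal.toReal_nonneg (a := ω ξ))
    rw [hw, hs]
    linarith
  have key := scalar_energy_le hν (hu.continuousOn_annR hu hω n) (hu.continuousOn_annR hh hω n)
    (hu.continuousOn_annR hu hω2 n) (hu.continuousOn_annRP hN hω n)
    (fun τ hτ => hu.annR_nonneg hω n hτ) (fun τ hτ => hu.annR_nonneg hω2 n hτ)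
    (fun τ hτ => hu.annRP_nonneg hN hω n hτ) hd hle hγ ht
  have h0 : (0 : ℝ) ∈ Set.Icc 0 T := ⟨le_rfl, hT⟩
  have hsub' : Set.Ioo 0 t ⊆ Set.Icc 0 T :=
    Set.Ioo_subset_Icc_self.trans (Set.Icc_subset_Icc_right ht.2)
  have a1 := setLIntegral_congr_fun (μ := volume) measurableSet_Ioo fun τ hτ =>
    congrArg (ENNReal.ofReal (τ ^ γ) * ·) (hu.annE_eq hω2 n (hsub' hτ))
  have a2 := setLIntegral_congr_fun (μ := volume) measurableSet_Ioo fun τ hτ =>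
    congrArg (ENNReal.ofReal (τ ^ (γ - 1)) * ·) (hu.annE_eq hω n (hsub' hτ))
  have a3 := setLIntegral_congr_fun (μ := volume) measurableSet_Ioo fun τ hτ =>
    congrArg (ENNReal.ofReal (τ ^ γ) * ·) (hu.annP_eq hN hω n (hsub' hτ))
  rw [hu.annE_eq hω n ht, hu.annE_eq hω n h0]
  rw [a1, a2, a3]
  exact key

/-- Weighted pairing of two fields. -/
def pairing (ω : R3 → ℝ≥0∞) (g g' : R3 → Fin 4 → ℂ) : ℝ≥0∞ :=
  ∫⁻ ξ, ω ξ * (amp (g ξ) * amp (g' ξ))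

theorem lintegral_eq_iSup_annulus (f : R3 → ℝ≥0∞) :
    ∫⁻ ξ, f ξ = ⨆ n, ∫⁻ ξ in annulus n, f ξ := by
  rw [← setLIntegral_iUnion_of_directed f
    (annulus_mono.directed_le)]
  rw [Measure.restrict_eq_self_of_ae_mem]
  filter_upwards [iUnion_annulus_ae] with ξ hξ
  exact Set.mem_iUnion.2 hξ

theorem monotone_setLIntegral_annulus (f : R3 → ℝ≥0∞) :
    Monotone fun n => ∫⁻ ξ in annulus n, f ξ :=
  fun _ _ h => lintegral_mono_set (annulus_mono h)

theorem VCont.aemeasurable_energy {T : ℝ} {g : ℝ → R3 → Fin 4 → ℂ} (hg : VCont T g)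
    {ω : R3 → ℝ≥0∞} (hω : LocBdd ω) {t : ℝ} (ht : t ≤ T) :
    AEMeasurable (fun τ => energy ω (g τ)) (volume.restrict (Set.Ioo 0 t)) := by
  simp only [energy, lintegral_eq_iSup_annulus]
  exact AEMeasurable.iSup fun n => ((hg.continuousOn_annE hω n).mono
    (Set.Ioo_subset_Icc_self.trans (Set.Icc_subset_Icc_right ht))).aemeasurable measurableSet_Ioo

theorem VCont.aemeasurable_pairing {T : ℝ} {g h : ℝ → R3 → Fin 4 → ℂ} (hg : VCont T g)
    (hh : VCont T h) {ω : R3 → ℝ≥0∞} (hω : LocBdd ω) {t : ℝ} (ht : t ≤ T) :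
    AEMeasurable (fun τ => pairing ω (g τ) (h τ)) (volume.restrict (Set.Ioo 0 t)) := by
  simp only [pairing, lintegral_eq_iSup_annulus]
  exact AEMeasurable.iSup fun n => ((hg.continuousOn_annP hh hω n).mono
    (Set.Ioo_subset_Icc_self.trans (Set.Icc_subset_Icc_right ht))).aemeasurable measurableSet_Ioo

theorem tendsto_annE (ω : R3 → ℝ≥0∞) (g : R3 → Fin 4 → ℂ) :
    Tendsto (fun n => annE ω n g) atTop (𝓝 (energy ω g)) := by
  rw [energy, lintegral_eq_iSup_annulus]
  exact tendsto_atTop_iSup (monotone_setLIntegral_annulus _)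

theorem VCont.tendsto_lintegral_annE {T : ℝ} {g : ℝ → R3 → Fin 4 → ℂ} (hg : VCont T g)
    {ω : R3 → ℝ≥0∞} (hω : LocBdd ω) {t : ℝ} (ht : t ≤ T) {f : ℝ → ℝ≥0∞} (hf : Measurable f)
    (hf' : ∀ τ, f τ ≠ ∞) :
    Tendsto (fun n => ∫⁻ τ in Set.Ioo 0 t, f τ * annE ω n (g τ)) atTop
      (𝓝 (∫⁻ τ in Set.Ioo 0 t, f τ * energy ω (g τ))) := by
  refine lintegral_tendsto_of_tendsto_of_monotone (fun n => ?_) (ae_of_all _ fun τ => ?_)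
    (ae_of_all _ fun τ => ?_)
  · refine hf.aemeasurable.mul ?_
    exact ((hg.continuousOn_annE hω n).mono (Set.Ioo_subset_Icc_self.trans
      (Set.Icc_subset_Icc_right ht))).aemeasurable measurableSet_Ioo
  · exact fun m n hmn => mul_le_mul_right (monotone_setLIntegral_annulus _ hmn) _
  · exact ENNReal.Tendsto.const_mul (tendsto_annE _ _) (Or.inr (hf' τ))

/-- The weighted energy inequality, with a weight in time. -/
theorem DissEvol.energy_le_rpow {ν T : ℝ} (hν : 0 ≤ ν) {u N : ℝ → R3 → Fin 4 → ℂ}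
    (H : DissEvol ν T u N) {ω : R3 → ℝ≥0∞} (hω : LocBdd ω) {γ : ℝ} (hγ : 0 ≤ γ) {t : ℝ}
    (ht : t ∈ Set.Icc 0 T) :
    ENNReal.ofReal (t ^ γ) * energy ω (u t) +
        ENNReal.ofReal (2 * ν) * ∫⁻ τ in Set.Ioo 0 t, ENNReal.ofReal (τ ^ γ) *
          energy (fun ξ => ω ξ * wt 2 ξ) (u τ) ≤
      ENNReal.ofReal (0 ^ γ) * energy ω (u 0) +
        ENNReal.ofReal γ * (∫⁻ τ in Set.Ioo 0 t, ENNReal.ofReal (τ ^ (γ - 1)) *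
          energy ω (u τ)) +
        2 * ∫⁻ τ in Set.Ioo 0 t, ENNReal.ofReal (τ ^ γ) * pairing ω (u τ) (N τ) := by
  have hle : ∀ ω' n g, annE ω' n g ≤ energy ω' g := fun ω' n g => setLIntegral_le_lintegral _ _
  have hleP : ∀ n g g', annP ω n g g' ≤ pairing ω g g' := fun n g g' =>
    setLIntegral_le_lintegral _ _
  have hlimInt := H.left.tendsto_lintegral_annE (hω.mul (locBdd_wt 2)) ht.2
    (f := fun τ => ENNReal.ofReal (τ ^ γ)) (by fun_prop) fun _ => ENNReal.ofReal_ne_top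
  -- Only the left side needs a limit: on each annulus the right side is already at most its value
  -- on the whole space.
  refine le_of_tendsto (((ENNReal.Tendsto.const_mul (tendsto_annE ω (u t))
    (Or.inr ENNReal.ofReal_ne_top)).add (ENNReal.Tendsto.const_mul hlimInt
    (Or.inr ENNReal.ofReal_ne_top)))) (Eventually.of_forall fun n => ?_)
  refine (H.annulus_energy_le hν hω n hγ ht).trans ?_
  gcongr
  · exact hle _ _ _
  · exact hle _ _ _
  · exact hleP _ _ _

/-! ### Solutions as dissipative evolutions -/

/-- Fields that are continuous in time for a homogeneous Sobolev norm. -/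
structure EnCont (s T : ℝ) (g : ℝ → R3 → Fin 4 → ℂ) : Prop where
  meas : ∀ t ∈ Set.Icc 0 T, CompMeas (g t)
  fin : ∀ t ∈ Set.Icc 0 T, energy (wt s) (g t) < ∞
  tendsto : ∀ t₀ ∈ Set.Icc 0 T,
    Tendsto (fun t => energy (wt s) fun ξ => g t ξ - g t₀ ξ) (𝓝[Set.Icc 0 T] t₀) (𝓝 0)

/-- On an annulus `|2πξ|^(-s)` is bounded, so the weight `|2πξ|^s` is bounded below and the
homogeneous norm controls the `L²` norm. -/
theorem exists_eLpNorm_annMeas_le (s : ℝ) (n : ℕ) : ∃ K : ℝ≥0, ∀ (g : R3 → Fin 4 → ℂ) (k : Fin 4),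
    eLpNorm (fun ξ => g ξ k) 2 (annMeas n) ≤ (K * energy (wt s) g) ^ (1 / 2 : ℝ) := by
  obtain ⟨K, hK⟩ := (locBdd_wt (-s)).bdd n
  refine ⟨K, fun g k => ?_⟩
  rw [eLpNorm_eq_lintegral_rpow_enorm_toReal two_ne_zero ENNReal.ofNat_ne_top]
  simp only [ENNReal.toReal_ofNat, ENNReal.rpow_ofNat]
  refine ENNReal.rpow_le_rpow ?_ (by norm_num)
  rw [energy, ← lintegral_const_mul' _ _ ENNReal.coe_ne_top]
  refine le_trans ?_ (setLIntegral_le_lintegral (annulus n) _)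
  refine setLIntegral_mono' (isOpen_annulus n).measurableSet fun ξ hξ => ?_
  have h1 : 1 ≤ K * wt s ξ := by
    have h2 := mul_le_mul_left (hK ξ hξ) (wt s ξ)
    rwa [← wt_add (ne_zero_of_mem_annulus hξ), neg_add_cancel, wt_zero] at h2
  calc ‖g ξ k‖ₑ ^ 2 ≤ 1 * nsq (g ξ) := by
        rw [one_mul]
        exact Finset.single_le_sum (f := fun k => ‖g ξ k‖ₑ ^ 2) (fun _ _ => zero_le)
          (Finset.mem_univ k)
    _ ≤ K * wt s ξ * nsq (g ξ) := by gcongr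
    _ = _ := by rw [mul_assoc]

theorem EnCont.vCont {s T : ℝ} {g : ℝ → R3 → Fin 4 → ℂ} (hg : EnCont s T g) : VCont T g := by
  intro n k
  obtain ⟨K, hK⟩ := exists_eLpNorm_annMeas_le s n
  refine ⟨fun t ht => ⟨(hg.meas t ht k).restrict, (hK _ k).trans_lt ?_⟩, fun t₀ ht₀ => ?_⟩
  · exact ENNReal.rpow_lt_top_of_nonneg (by norm_num)
      (ENNReal.mul_lt_top ENNReal.coe_lt_top (hg.fin t ht)).ne
  · have h1 : Tendsto (fun t => ((K : ℝ≥0∞) * energy (wt s) fun ξ => g t ξ - g t₀ ξ) ^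
        (1 / 2 : ℝ)) (𝓝[Set.Icc 0 T] t₀) (𝓝 0) := by
      have h2 := ENNReal.Tendsto.const_mul (a := (K : ℝ≥0∞)) (hg.tendsto t₀ ht₀)
        (Or.inr ENNReal.coe_ne_top)
      have h3 := (ENNReal.continuous_rpow_const (y := 1 / 2)).tendsto _ |>.comp h2
      simpa [Function.comp_def] using h3
    exact tendsto_of_tendsto_of_tendsto_of_le_of_le tendsto_const_nhds h1
      (fun _ => zero_le) fun t => hK (fun ξ => g t ξ - g t₀ ξ) k

theorem VCont.sub {T : ℝ} {g h : ℝ → R3 → Fin 4 → ℂ} (hg : VCont T g) (hh : VCont T h) :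
    VCont T fun t ξ => g t ξ - h t ξ := fun n k => by
  refine L2Cont.of_le (K := 1) (f := ![fun t ξ => g t ξ k, fun t ξ => h t ξ k])
    (fun i => by fin_cases i <;> [exact hg n k; exact hh n k])
    (fun t ht => ((hg n k).memLp t ht).1.sub ((hh n k).memLp t ht).1)
    (fun t _ => ae_of_all _ fun ξ => ?_) (fun t _ t₀ _ => ae_of_all _ fun ξ => ?_)
  · simpa [Fin.sum_univ_two] using norm_sub_le (g t ξ k) (h t ξ k)
  · simp only [Fin.sum_univ_two, Pi.sub_apply, one_mul]
    have e : g t ξ k - h t ξ k - (g t₀ ξ k - h t₀ ξ k) =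
      (g t ξ k - g t₀ ξ k) - (h t ξ k - h t₀ ξ k) := by ring
    rw [e]
    exact norm_sub_le _ _

/-! ### Bounded Fourier multipliers and dissipative evolutions. -/

/-- A matrix of bounded measurable symbols. -/
structure BddSymb (m : Fin 4 → Fin 4 → R3 → ℂ) (K : ℝ) : Prop where
  meas : ∀ k j, Measurable (m k j)
  bdd : ∀ k j ξ, ‖m k j ξ‖ ≤ K

theorem VCont.bddSymb {T : ℝ} {g : ℝ → R3 → Fin 4 → ℂ} (hg : VCont T g)
    {m : Fin 4 → Fin 4 → R3 → ℂ} {K : ℝ} (hm : BddSymb m K) :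
    VCont T fun t ξ k => ∑ j, m k j ξ * g t ξ j := fun n k =>
  L2Cont.sum fun j => (hg n j).bdd_mul (hm.meas k j).aestronglyMeasurable
    (ae_of_all _ fun ξ => hm.bdd k j ξ)

/-- The matrix of the orthogonal projection on a line. -/
def lineMat (q : R3 → Fin 4 → ℝ) (k j : Fin 4) (ξ : R3) : ℂ :=
  (∑ i, (q ξ i : ℂ) ^ 2)⁻¹ * q ξ j * q ξ k

theorem sum_lineMat (q : R3 → Fin 4 → ℝ) (ξ : R3) (a : Fin 4 → ℂ) (k : Fin 4) :
    ∑ j, lineMat q k j ξ * a j = lineProj (q ξ) a k := by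
  simp only [lineMat, lineProj, Finset.mul_sum, Finset.sum_mul]
  exact Finset.sum_congr rfl fun j _ => by ring

theorem bddSymb_lineMat {q : R3 → Fin 4 → ℝ} (hq : ∀ k, Measurable fun ξ => q ξ k) :
    BddSymb (lineMat q) 1 := by
  refine ⟨fun k j => ?_, fun k j ξ => ?_⟩
  · unfold lineMat
    refine Measurable.mul (Measurable.mul (Measurable.inv ?_)
      (Complex.measurable_ofReal.comp (hq j))) (Complex.measurable_ofReal.comp (hq k))
    exact Finset.measurable_fun_sum _ fun j _ => (Complex.measurable_ofReal.comp (hq j)).pow_const 2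
  · have e : lineMat q k j ξ = (((∑ i, q ξ i ^ 2)⁻¹ * (q ξ j * q ξ k) : ℝ) : ℂ) := by
      rw [lineMat]; push_cast; ring
    rw [e, Complex.norm_real, Real.norm_eq_abs, abs_mul, abs_inv]
    have h0 : 0 ≤ ∑ i, q ξ i ^ 2 := Finset.sum_nonneg fun i _ => sq_nonneg _
    rw [abs_of_nonneg h0]
    refine inv_mul_le_one_of_le₀ ?_ h0
    have h1 : ∀ i, q ξ i ^ 2 ≤ ∑ i, q ξ i ^ 2 := fun i =>
      Finset.single_le_sum (f := fun i => q ξ i ^ 2) (fun _ _ => sq_nonneg _) (Finset.mem_univ i)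
    have hj := h1 j
    have hk := h1 k
    rw [abs_le]
    constructor <;> nlinarith [sq_nonneg (q ξ j - q ξ k), sq_nonneg (q ξ j + q ξ k)]

theorem measurable_qgDir (F : ℝ) (k : Fin 4) : Measurable fun ξ => qgDir F ξ k := by
  have := measurable_coord
  fin_cases k <;> simp [qgDir] <;> fun_prop

theorem measurable_gradDir (k : Fin 4) : Measurable fun ξ => gradDir ξ k := by
  have := measurable_coord
  fin_cases k <;> simp [gradDir] <;> fun_prop

theorem VCont.projQG {T : ℝ} {g : ℝ → R3 → Fin 4 → ℂ} (hg : VCont T g) (F : ℝ) :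
    VCont T fun t ξ => projQG F ξ (g t ξ) := by
  have := hg.bddSymb (bddSymb_lineMat (measurable_qgDir F))
  simp only [sum_lineMat] at this
  simpa only [projQG_eq] using this

theorem VCont.leray {T : ℝ} {g : ℝ → R3 → Fin 4 → ℂ} (hg : VCont T g) :
    VCont T fun t ξ => leray ξ (g t ξ) := by
  have := hg.bddSymb (bddSymb_lineMat measurable_gradDir)
  simp only [sum_lineMat] at this
  simpa only [leray_eq] using hg.sub this

theorem VCont.mulVec {T : ℝ} {g : ℝ → R3 → Fin 4 → ℂ} (hg : VCont T g)
    (A : Matrix (Fin 4) (Fin 4) ℂ) : VCont T fun t ξ => A.mulVec (g t ξ) := by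
  refine hg.bddSymb (m := fun k j _ => A k j) (K := ∑ k, ∑ j, ‖A k j‖)
    ⟨fun _ _ => measurable_const, fun k j _ => ?_⟩
  exact (Finset.single_le_sum (f := fun j => ‖A k j‖) (fun _ _ => norm_nonneg _)
    (Finset.mem_univ j)).trans (Finset.single_le_sum (f := fun k => ∑ j, ‖A k j‖)
    (fun _ _ => Finset.sum_nonneg fun _ _ => norm_nonneg _) (Finset.mem_univ k))

theorem VCont.smul {T : ℝ} {g : ℝ → R3 → Fin 4 → ℂ} (hg : VCont T g) (c : ℂ) :
    VCont T fun t ξ => c • g t ξ := fun n k =>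
  (hg n k).bdd_mul (m := fun _ => c) aestronglyMeasurable_const (ae_of_all _ fun _ => le_rfl)

theorem neg_re_sum_conj_mul_le (a b : Fin 4 → ℂ) :
    -(∑ k, (starRingEnd ℂ) (a k) * b k).re ≤ (amp a).toReal * (amp b).toReal := by
  have h := norm_inner_le_norm (𝕜 := ℂ) (WithLp.toLp 2 a) (WithLp.toLp 2 b)
  rw [← toReal_amp_eq, ← toReal_amp_eq, EuclideanSpace.inner_eq_star_dotProduct] at h
  have e : (∑ k, (starRingEnd ℂ) (a k) * b k) = b ⬝ᵥ star a := by
    simp only [dotProduct, Pi.star_apply]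
    exact Finset.sum_congr rfl fun k _ => mul_comm _ _
  rw [e]
  exact (neg_le_abs _).trans ((Complex.abs_re_le_norm _).trans h)

theorem L2Cont.lapSymb_mul {T : ℝ} {n : ℕ} {u : ℝ → R3 → ℂ} (hu : L2Cont (annMeas n) T u) (ν : ℝ) :
    L2Cont (annMeas n) T fun t ξ => ν * lapSymb ξ * u t ξ := by
  refine hu.bdd_mul (K := |ν| * (2 * Real.pi * (n + 1)) ^ 2) ?_ ?_
  · simp only [lapSymb_eq]
    exact Measurable.aestronglyMeasurable (by fun_prop)
  · refine (ae_restrict_mem (isOpen_annulus n).measurableSet).mono fun ξ hξ => ?_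
    rw [lapSymb_eq, norm_mul, norm_neg, Complex.norm_real, Complex.norm_real, Real.norm_eq_abs,
      Real.norm_of_nonneg (by positivity)]
    have := hξ.2.le
    gcongr

/-- A weak formulation of the heat equation with a source yields an evolution in `L²` of
annuli. -/
theorem VCont.evol {T ν : ℝ} {u M : ℝ → R3 → Fin 4 → ℂ} (hu : VCont T u) (hM : VCont T M)
    (H : ∀ (φ : 𝓢(R3, ℂ)) (k : Fin 4), ∀ t ∈ Set.Icc 0 T,
      ∫ ξ, φ ξ * u t ξ k = (∫ ξ, φ ξ * u 0 ξ k) +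
        ∫ τ in (0 : ℝ)..t, ∫ ξ, φ ξ * (ν * lapSymb ξ * u τ ξ k - M τ ξ k)) (n : ℕ) (k : Fin 4) :
    L2Evol (annMeas n) T (fun t ξ => u t ξ k) fun t ξ => ν * lapSymb ξ * u t ξ k - M t ξ k := by
  have h1 : VCont T fun t ξ k => ν * lapSymb ξ * u t ξ k := fun n k => (hu n k).lapSymb_mul ν
  exact L2Evol.of_schwartz (isOpen_annulus n) (hu n k) (h1.sub hM n k)
    fun φ _ _ t ht => H φ k t ht

theorem re_sum_conj_mul_lapSymb (ν : ℝ) (ξ : R3) (a : Fin 4 → ℂ) :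
    (∑ k, (starRingEnd ℂ) (a k) * (ν * lapSymb ξ * a k)).re =
      -ν * ((2 * Real.pi * ‖ξ‖) ^ 2 * ∑ k, Complex.normSq (a k)) := by
  rw [Complex.re_sum, Finset.mul_sum, Finset.mul_sum]
  refine Finset.sum_congr rfl fun k _ => ?_
  have e : (starRingEnd ℂ) (a k) * (ν * lapSymb ξ * a k) =
      ((-ν * ((2 * Real.pi * ‖ξ‖) ^ 2 * Complex.normSq (a k)) : ℝ) : ℂ) := by
    rw [lapSymb_eq]
    push_cast
    rw [Complex.normSq_eq_conj_mul_self]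
    ring
  rw [e, Complex.ofReal_re]

/-- The source `M` of the equation may differ from the forcing `N` kept in the energy inequality,
provided both have the same real pairing with `u`. This is how the skew rotation term is discarded.
-/
theorem DissEvol.of_evol {T ν : ℝ} {u M N : ℝ → R3 → Fin 4 → ℂ} (hN : VCont T N)
    (H : ∀ n k, L2Evol (annMeas n) T (fun t ξ => u t ξ k)
      fun t ξ => ν * lapSymb ξ * u t ξ k - M t ξ k)
    (hM : ∀ t ∈ Set.Icc 0 T, ∀ᵐ ξ, (∑ k, (starRingEnd ℂ) (u t ξ k) * M t ξ k).re =
      (∑ k, (starRingEnd ℂ) (u t ξ k) * N t ξ k).re) : DissEvol ν T u N := by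
  refine ⟨hN, _, H, fun t ht => (hM t ht).mono fun ξ hξ => ?_⟩
  have h := neg_re_sum_conj_mul_le (u t ξ) (N t ξ)
  simp only [mul_sub, Finset.sum_sub_distrib, Complex.sub_re]
  rw [re_sum_conj_mul_lapSymb, hξ]
  linarith

theorem EnCont.of_continuousInH {T : EReal} {U : ℝ → Field} (hU : ContinuousInH (1 / 2) T U)
    {t : ℝ} (ht : t ∈ timeInterval T) : EnCont 1 t fun τ => fieldFt (U τ) := by
  have hsub : Set.Icc 0 t ⊆ timeInterval T := fun τ hτ =>
    ⟨hτ.1, lt_of_le_of_lt (by exact_mod_cast hτ.2) ht.2⟩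
  have hft : ∀ τ ∈ timeInterval T, HasFt (U τ) := fun τ hτ => hasFt_of_hNorm (hU.1 τ hτ)
  have e : ∀ {u : Field}, HasFt u → energy (wt 1) (fieldFt u) = hNorm (1 / 2) u ^ 2 := fun hu => by
    rw [hu.hNorm_sq]; norm_num
  refine ⟨fun τ hτ => (hft τ (hsub hτ)).compMeas, fun τ hτ => ?_, fun τ₀ hτ₀ => ?_⟩
  · rw [e (hft τ (hsub hτ))]
    exact ENNReal.pow_lt_top (hU.1 τ (hsub hτ))
  · have h1 := (hU.2 τ₀ (hsub hτ₀)).mono_left (nhdsWithin_mono _ hsub)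
    have h2 := (ENNReal.continuous_pow 2).tendsto _ |>.comp h1
    have h3 : Tendsto (fun τ => hNorm (1 / 2) (U τ - U τ₀) ^ 2) (𝓝[Set.Icc 0 t] τ₀) (𝓝 0) := by
      simpa [Function.comp_def] using h2
    refine h3.congr' ?_
    filter_upwards [self_mem_nhdsWithin] with τ hτ
    have a := hft τ (hsub hτ)
    have b := hft τ₀ (hsub hτ₀)
    rw [← e (a.sub b)]
    exact energy_congr (a.fieldFt_sub b)

theorem energy_wt_eq_of_le {g : R3 → Fin 4 → ℂ} {c : ℝ} {f : R3 → ℝ≥0∞}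
    (h : ∀ᵐ ξ, nsq (g ξ) ≤ 36 * (wt 1 ξ * f ξ) ^ 2) :
    energy (wt (2 * c)) g ≤ 36 * ∫⁻ ξ, (wt (c + 1) ξ * f ξ) ^ 2 := by
  rw [energy, ← lintegral_const_mul' _ _ (by norm_num)]
  refine lintegral_mono_ae ?_
  filter_upwards [h, ae_ne_zero] with ξ hξ h0
  calc wt (2 * c) ξ * nsq (g ξ) ≤ wt (2 * c) ξ * (36 * (wt 1 ξ * f ξ) ^ 2) := by gcongr
    _ = 36 * (wt (c + 1) ξ * f ξ) ^ 2 := by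
      rw [wt_add h0, ← wt_sq]; ring

theorem energy_add_le {ω : R3 → ℝ≥0∞} (hω : Measurable ω) {g g' : R3 → Fin 4 → ℂ}
    (hg : CompMeas g) :
    energy ω (fun ξ => g ξ + g' ξ) ≤ 2 * (energy ω g + energy ω g') := by
  rw [energy, energy, energy, ← lintegral_add_left' (f := fun ξ => ω ξ * nsq (g ξ))
      (hω.aemeasurable.mul hg.nsq),
    ← lintegral_const_mul' _ _ (by norm_num)]
  refine lintegral_mono fun ξ => ?_
  have h : nsq (g ξ + g' ξ) ≤ 2 * (nsq (g ξ) + nsq (g' ξ)) := by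
    simp only [nsq, ← Finset.sum_add_distrib, Finset.mul_sum]
    refine Finset.sum_le_sum fun k _ => ?_
    refine (pow_le_pow_left₀ zero_le (enorm_add_le (g ξ k) (g' ξ k)) 2).trans ?_
    exact add_sq_le_two_mul _ _
  calc ω ξ * nsq (g ξ + g' ξ) ≤ ω ξ * (2 * (nsq (g ξ) + nsq (g' ξ))) := by gcongr
    _ = _ := by ring

/-- `EnCont` takes the exponent of the squared norm, so `1` is `Ḣ^{1/2}` and `-3` is `Ḣ^{-3/2}`: two
factors in `Ḣ^{1/2}` multiply into `Ḣ^{-1/2}`, and the divergence costs one derivative. -/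
theorem EnCont.advHat {T : ℝ} {U : ℝ → Field} (hft : ∀ t ∈ Set.Icc 0 T, HasFt (U t))
    (hU : EnCont 1 T fun τ => fieldFt (U τ)) : EnCont (-3) T fun τ => advHat (U τ) := by
  obtain ⟨C, hC⟩ := exists_convE_half
  have e1 : ∀ u : Field, ∫⁻ ξ, (wt (1 / 2) ξ * amp (fieldFt u ξ)) ^ 2 =
      energy (wt 1) (fieldFt u) := fun u => by
    rw [lintegral_wt_mul_amp_sq]; norm_num
  refine ⟨fun t ht => (hft t ht).advHat_compMeas (hU.fin t ht), fun t ht => ?_, fun t₀ ht₀ => ?_⟩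
  · have h1 := energy_wt_eq_of_le (c := -3 / 2) ((hft t ht).nsq_advHat_le (hU.fin t ht))
    norm_num at h1
    refine h1.trans_lt (ENNReal.mul_lt_top (by norm_num) ?_)
    have h2 := hC _ _ (hft t ht).compMeas.amp (hft t ht).compMeas.amp
    rw [e1] at h2
    norm_num at h2
    refine h2.trans_lt (ENNReal.mul_lt_top ENNReal.coe_lt_top (ENNReal.mul_lt_top ?_ ?_)) <;>
    exact hU.fin t ht
  · set E := energy (wt 1) (fieldFt (U t₀)) with hE
    set D := fun t => energy (wt 1) fun ξ => fieldFt (U t) ξ - fieldFt (U t₀) ξ with hD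
    have hlim := hU.tendsto t₀ ht₀
    have hfin : ∀ᶠ t in 𝓝[Set.Icc 0 T] t₀, D t < ∞ :=
      hlim.eventually_lt_const (by norm_num)
    -- Here `72 = 36 · 2`, the `2` coming from the square of a sum of two convolutions, and `2 * (D
    -- t + E)` bounds the squared norm of `U t`.
    have hup : Tendsto (fun t => 72 * (C * (D t * (2 * (D t + E)) + E * D t)))
        (𝓝[Set.Icc 0 T] t₀) (𝓝 0) := by
      have hEt : E ≠ ∞ := (hU.fin t₀ ht₀).ne
      have a1 : Tendsto (fun t => 2 * (D t + E)) (𝓝[Set.Icc 0 T] t₀) (𝓝 (2 * (0 + E))) :=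
        ENNReal.Tendsto.const_mul (hlim.add tendsto_const_nhds) (Or.inr (by norm_num))
      have a2 := ENNReal.Tendsto.mul hlim (Or.inr (ENNReal.mul_ne_top (by norm_num)
        (by simpa using hEt))) a1 (Or.inr (by norm_num))
      have a3 := ENNReal.Tendsto.const_mul (a := E) hlim (Or.inr hEt)
      have a4 := ENNReal.Tendsto.const_mul (a := (72 : ℝ≥0∞)) (ENNReal.Tendsto.const_mul
        (a := (C : ℝ≥0∞)) (a2.add a3) (Or.inr ENNReal.coe_ne_top)) (Or.inr (by norm_num))
      simpa using a4
    refine tendsto_of_tendsto_of_tendsto_of_le_of_le' tendsto_const_nhds hup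
      (Eventually.of_forall fun _ => zero_le) ?_
    filter_upwards [self_mem_nhdsWithin, hfin] with t ht hDt
    have a := hft t ht
    have b := hft t₀ ht₀
    have hd : energy (wt 1) (fieldFt (U t - U t₀)) = D t := energy_congr (a.fieldFt_sub b)
    have h1 := energy_wt_eq_of_le (c := -3 / 2)
      (a.nsq_advHat_sub_le b (hU.fin t ht) (hU.fin t₀ ht₀) (hd.trans_lt hDt))
    norm_num at h1
    refine h1.trans ?_
    have m1 : AEMeasurable (fun ξ => wt (-1 / 2) ξ * convE (fun ξ => amp (fieldFt (U t - U t₀) ξ))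
        (fun ξ => amp (fieldFt (U t) ξ)) ξ) := (measurable_wt _).aemeasurable.mul
      (aemeasurable_convE (a.sub b).compMeas.amp a.compMeas.amp)
    have h2 := hC _ _ (a.sub b).compMeas.amp a.compMeas.amp
    have h3 := hC _ _ b.compMeas.amp (a.sub b).compMeas.amp
    rw [e1, e1, hd] at h2
    rw [e1, e1, hd] at h3
    have hEt : energy (wt 1) (fieldFt (U t)) ≤ 2 * (D t + E) := by
      have := energy_add_le (measurable_wt 1) (g := fun ξ => fieldFt (U t) ξ - fieldFt (U t₀) ξ)
        (g' := fieldFt (U t₀)) (a.compMeas.sub b.compMeas)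
      simpa using this
    calc 36 * ∫⁻ ξ, (wt (-(1 / 2)) ξ * (convE (fun ξ => amp (fieldFt (U t - U t₀) ξ))
          (fun ξ => amp (fieldFt (U t) ξ)) ξ + convE (fun ξ => amp (fieldFt (U t₀) ξ))
          (fun ξ => amp (fieldFt (U t - U t₀) ξ)) ξ)) ^ 2
        ≤ 36 * ∫⁻ ξ, 2 * ((wt (-1 / 2) ξ * (convE (fun ξ => amp (fieldFt (U t - U t₀) ξ))
          (fun ξ => amp (fieldFt (U t) ξ)) ξ)) ^ 2 +
          (wt (-1 / 2) ξ * convE (fun ξ => amp (fieldFt (U t₀) ξ))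
          (fun ξ => amp (fieldFt (U t - U t₀) ξ)) ξ) ^ 2) := by
          gcongr with ξ
          rw [mul_add, show (-(1 / 2) : ℝ) = -1 / 2 by norm_num]
          exact add_sq_le_two_mul _ _
      _ ≤ 36 * (2 * (C * (D t * (2 * (D t + E))) + C * (E * D t))) := by
          rw [lintegral_const_mul' _ _ (by norm_num), lintegral_add_left' (m1.pow_const 2)]
          gcongr
          exact h2.trans (by gcongr)
      _ = _ := by ring

section solutions

variable {F ν : ℝ} {T : EReal} {U₀ : Field} {U : ℝ → Field}

theorem IsQGSolution.hasFt (H : IsQGSolution F ν T U₀ U) {t : ℝ} (ht : t ∈ timeInterval T) :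
    HasFt (U t) := hasFt_of_hNorm (H.cont.1 t ht)

theorem Icc_subset_timeInterval {t : ℝ} (ht : t ∈ timeInterval T) :
    Set.Icc 0 t ⊆ timeInterval T := fun _ hτ =>
  ⟨hτ.1, lt_of_le_of_lt (by exact_mod_cast hτ.2) ht.2⟩

theorem IsQGSolution.enCont (H : IsQGSolution F ν T U₀ U) {t : ℝ} (ht : t ∈ timeInterval T) :
    EnCont 1 t fun τ => fieldFt (U τ) := EnCont.of_continuousInH H.cont ht

theorem IsQGSolution.vCont_adv (H : IsQGSolution F ν T U₀ U) {t : ℝ} (ht : t ∈ timeInterval T) :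
    VCont t fun τ => advHat (U τ) :=
  (EnCont.advHat (fun _ hτ => H.hasFt (Icc_subset_timeInterval ht hτ)) (H.enCont ht)).vCont

theorem IsQGSolution.vCont_force (H : IsQGSolution F ν T U₀ U) {t : ℝ}
    (ht : t ∈ timeInterval T) : VCont t fun τ => forceHat F (U τ) :=
  ((H.vCont_adv ht).sub ((H.vCont_adv ht).projQG F)).leray

theorem IsQGSolution.fieldFt_zero (H : IsQGSolution F ν T U₀ U) (h0 : 0 ∈ timeInterval T) :
    ∀ᵐ ξ, fieldFt U₀ ξ = fieldFt (U 0) ξ := ((H.hasFt h0).congr H.init).2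

/-- The weak formulation uses the transform of `U₀`, whereas the evolution starts from that of `U
0`; they agree almost everywhere because a Fourier pair depends only on almost everywhere classes.
-/
theorem IsQGSolution.dissEvol (H : IsQGSolution F ν T U₀ U) {t : ℝ} (ht : t ∈ timeInterval T) :
    DissEvol ν t (fun τ => fieldFt (U τ)) fun τ ξ => projQG F ξ (advHat (U τ) ξ) := by
  have h0 : 0 ∈ timeInterval T := Icc_subset_timeInterval ht ⟨le_rfl, ht.1⟩
  refine DissEvol.of_evol (M := fun τ ξ => projQG F ξ (advHat (U τ) ξ))
    ((H.vCont_adv ht).projQG F) ((H.enCont ht).vCont.evol ((H.vCont_adv ht).projQG F)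
      fun φ k τ hτ => ?_) fun _ _ => ae_of_all _ fun _ => rfl
  rw [H.eqn τ (Icc_subset_timeInterval ht hτ) φ k]
  congr 1
  refine integral_congr_ae ?_
  filter_upwards [H.fieldFt_zero h0] with ξ hξ
  rw [hξ]

end solutions

/-! ### A Gronwall inequality -/

theorem two_pow_ceil_le {x : ℝ} (hx : 0 ≤ x) : (2 : ℝ) ^ ⌈x⌉₊ ≤ 2 * Real.exp x := by
  have h1 : (⌈x⌉₊ : ℝ) ≤ x + 1 := (Nat.ceil_lt_add_one hx).le
  calc (2 : ℝ) ^ ⌈x⌉₊ = (2 : ℝ) ^ (⌈x⌉₊ : ℝ) := (Real.rpow_natCast _ _).symm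
    _ ≤ 2 ^ (x + 1) := Real.rpow_le_rpow_of_exponent_le (by norm_num) h1
    _ = 2 * 2 ^ x := by rw [Real.rpow_add (by norm_num), Real.rpow_one, mul_comm]
    _ ≤ 2 * Real.exp x := by
      gcongr
      rw [Real.rpow_def_of_pos (by norm_num)]
      refine Real.exp_le_exp.2 ?_
      nlinarith [Real.log_two_lt_d9]

/-- The primitive of an integrable function is continuous, so the intermediate value theorem finds
the time at which it reaches `x`. -/
theorem exists_lintegral_Ioc_split {t : ℝ} {a : ℝ → ℝ≥0∞}
    (ha : AEMeasurable a (volume.restrict (Set.Ioc 0 t)))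
    (hA : ∫⁻ τ in Set.Ioc 0 t, a τ ≠ ∞) {τ : ℝ} (hτ : τ ∈ Set.Icc 0 t) {x : ℝ≥0} {y : ℝ≥0∞}
    (h : ∫⁻ s in Set.Ioc 0 τ, a s ≤ x + y) :
    ∃ s ∈ Set.Icc 0 τ, ∫⁻ r in Set.Ioc 0 s, a r ≤ x ∧ ∫⁻ r in Set.Ioc s τ, a r ≤ y := by
  rcases le_total (∫⁻ s in Set.Ioc 0 τ, a s) x with hx | hx
  · exact ⟨τ, ⟨hτ.1, le_rfl⟩, hx, by simp⟩
  have hsub : ∀ s ≤ t, Set.Ioc 0 s ⊆ Set.Ioc 0 t := fun s hs => Set.Ioc_subset_Ioc_right hs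
  have e : ∀ s ≤ t, ∫ r in Set.Ioc 0 s, (a r).toReal = (∫⁻ r in Set.Ioc 0 s, a r).toReal :=
    fun s hs => integral_toReal (ha.mono_measure (Measure.restrict_mono (hsub s hs) le_rfl))
      (ae_lt_top' (ha.mono_measure (Measure.restrict_mono (hsub s hs) le_rfl))
        (ne_top_of_le_ne_top hA (lintegral_mono_set (hsub s hs))))
  have hlimInt : IntegrableOn (fun r => (a r).toReal) (Set.Icc 0 t) := by
    rw [integrableOn_Icc_iff_integrableOn_Ioc]
    exact integrable_toReal_of_lintegral_ne_top ha hA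
  have hc := (intervalIntegral.continuousOn_primitive hlimInt).mono
    (Set.Icc_subset_Icc_right hτ.2)
  have hfin : ∀ s ≤ t, ∫⁻ r in Set.Ioc 0 s, a r ≠ ∞ := fun s hs =>
    ne_top_of_le_ne_top hA (lintegral_mono_set (hsub s hs))
  have hmem : (x : ℝ) ∈ Set.Icc (∫ r in Set.Ioc 0 0, (a r).toReal)
      (∫ r in Set.Ioc 0 τ, (a r).toReal) := by
    refine ⟨by simp, ?_⟩
    rw [e τ hτ.2, ← ENNReal.coe_toReal]
    exact ENNReal.toReal_mono (hfin τ hτ.2) hx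
  obtain ⟨s, hs, hsx⟩ := intermediate_value_Icc hτ.1 hc hmem
  simp only [] at hsx
  rw [e s (hs.2.trans hτ.2), ← ENNReal.coe_toReal,
    ENNReal.toReal_eq_toReal_iff' (hfin s (hs.2.trans hτ.2)) ENNReal.coe_ne_top] at hsx
  refine ⟨s, hs, hsx.le, ?_⟩
  rw [← Set.Ioc_union_Ioc_eq_Ioc hs.1 hs.2, lintegral_union measurableSet_Ioc
    (Set.Ioc_disjoint_Ioc_of_le le_rfl), hsx] at h
  exact (ENNReal.add_le_add_iff_left ENNReal.coe_ne_top).1 h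

/-- No continuity of `φ` is needed, only an a priori bound. The interval is cut where `∫ a`
increases by one half; on each piece the right side at most doubles. The conclusion bounds this
right side and not merely `φ`, so that it also controls a dissipation integral standing next to `φ`.
-/
theorem gronwall_le {t : ℝ} {a φ : ℝ → ℝ≥0∞} {K B : ℝ≥0∞}
    (ha : AEMeasurable a (volume.restrict (Set.Ioo 0 t)))
    (hA : ∫⁻ τ in Set.Ioo 0 t, a τ ≠ ∞) (hB : B ≠ ∞) (hφB : ∀ τ ∈ Set.Icc 0 t, φ τ ≤ B)
    (h : ∀ τ ∈ Set.Icc 0 t, φ τ ≤ K + ∫⁻ s in Set.Ioo 0 τ, φ s * a s) {τ : ℝ}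
    (hτ : τ ∈ Set.Icc 0 t) :
    K + ∫⁻ s in Set.Ioo 0 τ, φ s * a s ≤
      2 * ENNReal.ofReal (Real.exp (2 * (∫⁻ τ in Set.Ioo 0 t, a τ).toReal)) * K := by
  rcases eq_or_ne K ∞ with rfl | hK
  · rw [ENNReal.mul_top]
    · exact le_top
    · simp [Real.exp_pos]
  simp only [restrict_Ioo_eq_restrict_Ioc] at *
  set y : ℝ → ℝ≥0∞ := fun τ => K + ∫⁻ s in Set.Ioc 0 τ, φ s * a s with hy
  have hle : ∀ r s, s ∈ Set.Icc 0 t → 0 ≤ r → ∀ M, (∀ z ∈ Set.Ioc r s, φ z ≤ M) → M ≠ ∞ →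
      ∫⁻ z in Set.Ioc r s, φ z * a z ≤ M * ∫⁻ z in Set.Ioc r s, a z := by
    intro r s hs hr M hM hMt
    rw [← lintegral_const_mul' _ _ hMt]
    exact setLIntegral_mono' measurableSet_Ioc fun z hz => mul_le_mul_left (hM z hz) _
  have hyt : ∀ s ∈ Set.Icc 0 t, y s ≠ ∞ := fun s hs => by
    refine ENNReal.add_ne_top.2 ⟨hK, ne_top_of_le_ne_top (ENNReal.mul_ne_top hB hA) ?_⟩
    refine (hle 0 s hs le_rfl B (fun z hz => hφB z ⟨hz.1.le, hz.2.trans hs.2⟩) hB).trans ?_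
    gcongr
    exact hs.2
  have hmono : ∀ r s, r ≤ s → y r ≤ y s := fun r s hrs => by
    simp only [hy]
    gcongr
  -- The induction is on the number of half units of `∫ a` used up to time `s`.
  have main : ∀ n : ℕ, ∀ s ∈ Set.Icc 0 t, ∫⁻ z in Set.Ioc 0 s, a z ≤ ((n / 2 : ℝ≥0) : ℝ≥0∞) →
      y s ≤ 2 ^ n * K := by
    intro n
    induction n with
    | zero =>
      intro s hs h0
      have h1 := hle 0 s hs le_rfl B (fun z hz => hφB z ⟨hz.1.le, hz.2.trans hs.2⟩) hB
      have h2 : ∫⁻ z in Set.Ioc 0 s, a z = 0 := by simpa using h0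
      rw [h2, mul_zero] at h1
      simp only [hy, le_antisymm h1 zero_le, pow_zero, one_mul, add_zero, le_refl]
    | succ n ih =>
      intro s hs h0
      obtain ⟨r, hr, h1, h2⟩ := exists_lintegral_Ioc_split ha hA hs (x := (n / 2 : ℝ≥0))
        (y := ((1 / 2 : ℝ≥0) : ℝ≥0∞)) (h0.trans (le_of_eq (by
          rw [← ENNReal.coe_add]; congr 1; push_cast; ring)))
      have h3 := ih r ⟨hr.1, hr.2.trans hs.2⟩ h1
      -- The last piece contributes at most `y s / 2`, which can be subtracted because `y s` is
      -- finite.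
      have h4 : y s ≤ y r + y s * ((1 / 2 : ℝ≥0) : ℝ≥0∞) := by
        have e : y s = y r + ∫⁻ z in Set.Ioc r s, φ z * a z := by
          simp only [hy]
          rw [← Set.Ioc_union_Ioc_eq_Ioc hr.1 hr.2, lintegral_union measurableSet_Ioc
            (Set.Ioc_disjoint_Ioc_of_le le_rfl), add_assoc]
        calc y s = y r + ∫⁻ z in Set.Ioc r s, φ z * a z := e
          _ ≤ y r + y s * ∫⁻ z in Set.Ioc r s, a z := by
            gcongr
            refine hle r s hs hr.1 (y s) (fun z hz => ?_) (hyt s hs)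
            exact (h z ⟨hr.1.trans hz.1.le, hz.2.trans hs.2⟩).trans (hmono z s hz.2)
          _ ≤ _ := by gcongr
      have h5 : y s = y s * ((1 / 2 : ℝ≥0) : ℝ≥0∞) + y s * ((1 / 2 : ℝ≥0) : ℝ≥0∞) := by
        rw [← mul_add, ← ENNReal.coe_add]; norm_num
      nth_rewrite 1 [h5] at h4
      have h6 := (ENNReal.add_le_add_iff_right
        (ENNReal.mul_ne_top (hyt s hs) ENNReal.coe_ne_top)).1 h4
      calc y s = 2 * (y s * ((1 / 2 : ℝ≥0) : ℝ≥0∞)) := by rw [two_mul]; exact h5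
        _ ≤ 2 * (2 ^ n * K) := mul_le_mul_right (h6.trans h3) 2
        _ = 2 ^ (n + 1) * K := by ring
  set A := (∫⁻ τ in Set.Ioc 0 t, a τ).toReal with hAdef
  -- A total of `A` is covered by `⌈2A⌉` half units, and `2 ^ ⌈2A⌉ ≤ 2 e^(2A)`.
  have h1 := main ⌈2 * A⌉₊ τ hτ (by
    refine (lintegral_mono_set (Set.Ioc_subset_Ioc_right hτ.2)).trans ?_
    rw [← ENNReal.ofReal_toReal hA, ← hAdef, ENNReal.ofReal]
    refine ENNReal.coe_le_coe.2 (Real.toNNReal_le_iff_le_coe.2 ?_)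
    push_cast
    have := Nat.le_ceil (2 * A)
    linarith)
  refine h1.trans ?_
  gcongr
  have h2 := ENNReal.ofReal_le_ofReal (two_pow_ceil_le (x := 2 * A) (by positivity))
  rw [ENNReal.ofReal_pow (by norm_num), ENNReal.ofReal_mul (by norm_num)] at h2
  simpa using h2

/-! ### Quadratic evolutions and the absorption of the nonlinear term. -/

theorem le_add_of_sq_le_mul {x y z : ℝ≥0∞} (h : x ^ 2 ≤ y * z) : x ≤ y + z := by
  by_contra hc
  push Not at hc
  have h1 : y < x := le_self_add.trans_lt hc
  have h2 : z < x := le_add_self.trans_lt hc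
  have h3 := ENNReal.mul_lt_mul h1 h2
  rw [← sq] at h3
  exact absurd h (not_le.2 h3)

/-- Young's inequality. -/
theorem two_mul_le_of_sq_le {x y z : ℝ≥0∞} {ν : ℝ} (hν : 0 < ν) (h : x ^ 2 ≤ y * z) :
    2 * x ≤ ENNReal.ofReal ν * y + ENNReal.ofReal (4 / ν) * z := by
  refine le_add_of_sq_le_mul ?_
  calc (2 * x) ^ 2 = 4 * x ^ 2 := by ring
    _ ≤ 4 * (y * z) := by gcongr
    _ = (ENNReal.ofReal ν * ENNReal.ofReal (4 / ν)) * (y * z) := by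
      rw [← ENNReal.ofReal_mul hν.le, mul_div_cancel₀ _ hν.ne']
      norm_num
    _ = _ := by ring

/-- A dissipative evolution whose forcing is quadratic, such as the Fourier transform of a
quasi-geostrophic flow. -/
structure QuadEvol (ν t : ℝ) (u N : ℝ → R3 → Fin 4 → ℂ) : Prop where
  ν_pos : 0 < ν
  t_nonneg : 0 ≤ t
  diss : DissEvol ν t u N
  cont : EnCont 1 t u
  meas : ∀ τ ∈ Set.Icc 0 t, CompMeas (N τ)
  quad : ∀ τ ∈ Set.Icc 0 t, ∀ᵐ ξ, nsq (N τ ξ) ≤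
    36 * (wt 1 ξ * convE (fun ξ => amp (u τ ξ)) (fun ξ => amp (u τ ξ)) ξ) ^ 2
  fin : ∫⁻ τ in Set.Ioo 0 t, energy (wt 3) (u τ) ≠ ∞

/-- `ν⁻¹ ∫₀ᵗ ‖u‖²_{Ḣ^{3/2}}`. -/
def expo (ν t : ℝ) (u : ℝ → R3 → Fin 4 → ℂ) : ℝ :=
  (∫⁻ τ in Set.Ioo 0 t, energy (wt 3) (u τ)).toReal / ν

/-- Weights for which the product law with one factor in `Ḣ^{3/2}` holds. -/
structure ModerateWeight (σ : ℝ) (w : R3 → ℝ≥0∞) : Prop where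
  measurable : Measurable w
  ne : ∀ ζ, ζ ≠ 0 → w ζ ≠ 0 ∧ w ζ ≠ ∞
  le : ∀ x ζ η : R3, ‖x‖ ≤ 2 * ‖η‖ → ζ ≠ 0 → ‖ζ‖ ≤ ‖η‖ →
    w x ≤ ENNReal.ofReal (2 ^ σ * (‖η‖ / ‖ζ‖) ^ σ) * w ζ

/-- Cauchy–Schwarz with the weight `w |2πξ|` on `u` and `w |2πξ|⁻¹` on `N` transfers the derivative
in `N` to `u`. The product law with one factor in `Ḣ^{3/2}` bounds the second norm, and Young leaves
only half of the available dissipation. -/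
theorem exists_pairing_le {σ : ℝ} (hσ : σ < 3 / 2) : ∃ C : ℝ≥0, ∀ {ν t : ℝ}
    {u N : ℝ → R3 → Fin 4 → ℂ}, QuadEvol ν t u N → ∀ {w : R3 → ℝ≥0∞}, ModerateWeight σ w →
    ∀ τ ∈ Set.Icc 0 t, 2 * pairing (fun ξ => w ξ ^ 2) (u τ) (N τ) ≤
      ENNReal.ofReal ν * energy (fun ξ => w ξ ^ 2 * wt 2 ξ) (u τ) +
        ENNReal.ofReal (C / ν) * (energy (fun ξ => w ξ ^ 2) (u τ) * energy (wt 3) (u τ)) := by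
  obtain ⟨C, hC⟩ := exists_convE_moderate hσ
  -- The `36` is that of the quadratic bound on `N`, the `4` that of Young's inequality.
  refine ⟨4 * (36 * C), fun {ν t u N} H w hw τ hτ => ?_⟩
  have hum := H.cont.meas τ hτ
  have key : pairing (fun ξ => w ξ ^ 2) (u τ) (N τ) ^ 2 ≤
      energy (fun ξ => w ξ ^ 2 * wt 2 ξ) (u τ) *
        (36 * C * (energy (fun ξ => w ξ ^ 2) (u τ) * energy (wt 3) (u τ))) := by
    have h1 := lintegral_mul_sq_le (μ := volume) (f := fun ξ => w ξ * wt 1 ξ * amp (u τ ξ))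
      (g := fun ξ => w ξ * wt (-1) ξ * amp (N τ ξ))
      ((hw.measurable.mul (measurable_wt 1)).aemeasurable.mul hum.amp)
      ((hw.measurable.mul (measurable_wt (-1))).aemeasurable.mul (H.meas τ hτ).amp)
    have e1 : ∫⁻ ξ, w ξ * wt 1 ξ * amp (u τ ξ) * (w ξ * wt (-1) ξ * amp (N τ ξ)) =
        pairing (fun ξ => w ξ ^ 2) (u τ) (N τ) := by
      refine lintegral_congr_ae ?_
      filter_upwards [ae_ne_zero] with ξ hξ
      have h0 : wt 1 ξ * wt (-1) ξ = 1 := by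
        rw [← wt_add hξ, show (1 : ℝ) + -1 = 0 by norm_num, wt_zero]
      calc _ = (wt 1 ξ * wt (-1) ξ) * (w ξ ^ 2 * (amp (u τ ξ) * amp (N τ ξ))) := by ring
        _ = _ := by rw [h0, one_mul]
    have e2 : ∫⁻ ξ, (w ξ * wt 1 ξ * amp (u τ ξ)) ^ 2 =
        energy (fun ξ => w ξ ^ 2 * wt 2 ξ) (u τ) := by
      refine lintegral_congr fun ξ => ?_
      rw [mul_pow, mul_pow, wt_sq, amp_sq, mul_one]
    rw [e1, e2] at h1
    refine h1.trans (mul_le_mul_right ?_ _)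
    have h2 := hC w _ hw.measurable hum.amp hw.ne hw.le
    have e3 : ∫⁻ ξ, (w ξ * amp (u τ ξ)) ^ 2 = energy (fun ξ => w ξ ^ 2) (u τ) := by
      refine lintegral_congr fun ξ => ?_
      rw [mul_pow, amp_sq]
    rw [e3, lintegral_wt_mul_amp_sq, show (2 * (3 / 2) : ℝ) = 3 by norm_num] at h2
    calc ∫⁻ ξ, (w ξ * wt (-1) ξ * amp (N τ ξ)) ^ 2
        ≤ ∫⁻ ξ, 36 * (w ξ * convE (fun ξ => amp (u τ ξ)) (fun ξ => amp (u τ ξ)) ξ) ^ 2 := by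
          refine lintegral_mono_ae ?_
          filter_upwards [ae_ne_zero, H.quad τ hτ] with ξ hξ hq
          have h0 : wt (-1) ξ * wt 1 ξ = 1 := by
            rw [← wt_add hξ, show (-1 : ℝ) + 1 = 0 by norm_num, wt_zero]
          rw [mul_pow, amp_sq]
          calc (w ξ * wt (-1) ξ) ^ 2 * nsq (N τ ξ) ≤ (w ξ * wt (-1) ξ) ^ 2 * (36 * (wt 1 ξ *
                convE (fun ξ => amp (u τ ξ)) (fun ξ => amp (u τ ξ)) ξ) ^ 2) := by gcongr
            _ = 36 * ((wt (-1) ξ * wt 1 ξ) * (w ξ *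
                convE (fun ξ => amp (u τ ξ)) (fun ξ => amp (u τ ξ)) ξ)) ^ 2 := by ring
            _ = _ := by rw [h0, one_mul]
      _ = 36 * ∫⁻ ξ, (w ξ * convE (fun ξ => amp (u τ ξ)) (fun ξ => amp (u τ ξ)) ξ) ^ 2 :=
          lintegral_const_mul' _ _ (by norm_num)
      _ ≤ 36 * (C * energy (fun ξ => w ξ ^ 2) (u τ) * energy (wt 3) (u τ)) := by gcongr
      _ = _ := by ring
  refine (two_mul_le_of_sq_le H.ν_pos key).trans (le_of_eq ?_)
  congr 1
  rw [← mul_assoc, show (36 * (C : ℝ≥0∞)) = ENNReal.ofReal (36 * C) by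
      rw [ENNReal.ofReal_mul (by norm_num), ENNReal.ofReal_coe_nnreal]; simp,
    ← ENNReal.ofReal_mul (by have := H.ν_pos; positivity)]
  congr 2
  push_cast
  ring

/-- Local boundedness, which follows from continuity, becomes a uniform bound by compactness of the
time interval. -/
theorem EnCont.exists_bound {s T : ℝ} {g : ℝ → R3 → Fin 4 → ℂ} (hg : EnCont s T g) :
    ∃ B : ℝ≥0, ∀ t ∈ Set.Icc 0 T, energy (wt s) (g t) ≤ B := by
  suffices H : ∃ B : ℝ≥0, ∀ t ∈ Set.Icc 0 T ∩ Set.Icc 0 T, energy (wt s) (g t) ≤ B by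
    simpa using H
  refine isCompact_Icc.induction_on
    (p := fun S => ∃ B : ℝ≥0, ∀ t ∈ S ∩ Set.Icc 0 T, energy (wt s) (g t) ≤ B) ⟨0, by simp⟩ ?_ ?_ ?_
  · rintro S S' hS ⟨B, hB⟩
    exact ⟨B, fun t ht => hB t ⟨hS ht.1, ht.2⟩⟩
  · rintro S S' ⟨B, hB⟩ ⟨B', hB'⟩
    refine ⟨max B B', fun t ht => ?_⟩
    rcases ht.1 with h | h
    · exact (hB t ⟨h, ht.2⟩).trans (by exact_mod_cast le_max_left _ _)
    · exact (hB' t ⟨h, ht.2⟩).trans (by exact_mod_cast le_max_right _ _)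
  · intro t₀ ht₀
    have h1 : ∀ᶠ t in 𝓝[Set.Icc 0 T] t₀, energy (wt s) (fun ξ => g t ξ - g t₀ ξ) < 1 :=
      (hg.tendsto t₀ ht₀).eventually_lt_const (by norm_num)
    refine ⟨{t | energy (wt s) (fun ξ => g t ξ - g t₀ ξ) < 1}, h1,
      (2 * (1 + energy (wt s) (g t₀))).toNNReal, fun t ht => ?_⟩
    have hne : 2 * (1 + energy (wt s) (g t₀)) ≠ ∞ :=
      ENNReal.mul_ne_top (by norm_num) (ENNReal.add_ne_top.2 ⟨by norm_num, (hg.fin t₀ ht₀).ne⟩)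
    rw [ENNReal.coe_toNNReal hne]
    have h2 := energy_add_le (measurable_wt s) (g := fun ξ => g t ξ - g t₀ ξ) (g' := g t₀)
      ((hg.meas t ht.2).sub (hg.meas t₀ ht₀))
    simp only [sub_add_cancel] at h2
    refine h2.trans ?_
    have h3 := ht.1
    simp only [Set.mem_ofPred_eq] at h3
    gcongr

/-! ### Sobolev bounds with a weight in time -/

theorem energy_mono_weight {ω ω' : R3 → ℝ≥0∞} (h : ∀ ξ, ξ ≠ 0 → ω ξ ≤ ω' ξ)
    (g : R3 → Fin 4 → ℂ) : energy ω g ≤ energy ω' g := by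
  refine lintegral_mono_ae ?_
  filter_upwards [ae_ne_zero] with ξ hξ
  exact mul_le_mul_left (h ξ hξ) _

theorem energy_congr_weight {ω ω' : R3 → ℝ≥0∞} (h : ∀ ξ, ξ ≠ 0 → ω ξ = ω' ξ)
    (g : R3 → Fin 4 → ℂ) : energy ω g = energy ω' g :=
  le_antisymm (energy_mono_weight (fun ξ hξ => (h ξ hξ).le) g)
    (energy_mono_weight (fun ξ hξ => (h ξ hξ).ge) g)

theorem energy_const_mul {K : ℝ≥0∞} (hK : K ≠ ∞) (ω : R3 → ℝ≥0∞) (g : R3 → Fin 4 → ℂ) :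
    energy (fun ξ => K * ω ξ) g = K * energy ω g := by
  simp only [energy, mul_assoc]
  exact lintegral_const_mul' _ _ hK

/-- The bound of `w ^ 2` by the `Ḣ^{1/2}` weight makes all terms finite, so that absorption and
Gronwall are legitimate. The resulting constant depends on `σ` only and not on `K`, which allows the
truncation to be removed afterwards. -/
theorem exists_truncated_bound {σ : ℝ} (hσ : σ < 3 / 2) : ∃ c : ℝ≥0, ∀ {ν t : ℝ}
    {u N : ℝ → R3 → Fin 4 → ℂ}, QuadEvol ν t u N → ∀ {w : R3 → ℝ≥0∞}, ModerateWeight σ w →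
    ∀ {K : ℝ≥0}, (∀ ξ, w ξ ^ 2 ≤ K * wt 1 ξ) → ∀ {γ : ℝ}, 0 ≤ γ → ∀ τ ∈ Set.Icc 0 t,
    ENNReal.ofReal (τ ^ γ) * energy (fun ξ => w ξ ^ 2) (u τ) +
        ENNReal.ofReal ν * (∫⁻ s in Set.Ioo 0 τ, ENNReal.ofReal (s ^ γ) *
          energy (fun ξ => w ξ ^ 2 * wt 2 ξ) (u s)) ≤
      2 * ENNReal.ofReal (Real.exp (c * expo ν t u)) *
        (ENNReal.ofReal (0 ^ γ) * energy (fun ξ => w ξ ^ 2) (u 0) +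
          ENNReal.ofReal γ * ∫⁻ s in Set.Ioo 0 t, ENNReal.ofReal (s ^ (γ - 1)) *
            energy (fun ξ => w ξ ^ 2) (u s)) := by
  obtain ⟨C, hC⟩ := exists_pairing_le hσ
  refine ⟨2 * C, fun {ν t u N} H w hw K hK γ hγ => ?_⟩
  have hν := H.ν_pos
  have hlb : LocBdd fun ξ => w ξ ^ 2 := by
    refine ⟨hw.measurable.pow_const 2, fun n => ?_⟩
    obtain ⟨K', hK'⟩ := (locBdd_wt 1).bdd n
    refine ⟨K * K', fun ξ hξ => (hK ξ).trans ?_⟩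
    push_cast
    exact mul_le_mul_right (hK' ξ hξ) _
  have hlb2 := hlb.mul (locBdd_wt 2)
  set f : ℝ → ℝ≥0∞ := fun s => energy (fun ξ => w ξ ^ 2) (u s) with hf
  set g : ℝ → ℝ≥0∞ := fun s => energy (fun ξ => w ξ ^ 2 * wt 2 ξ) (u s) with hg
  set a : ℝ → ℝ≥0∞ := fun s => ENNReal.ofReal (C / ν) * energy (wt 3) (u s) with ha
  have hgle : ∀ s, g s ≤ K * energy (wt 3) (u s) := fun s => by
    simp only [hg]
    rw [← energy_const_mul ENNReal.coe_ne_top]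
    refine energy_mono_weight (fun ξ hξ => ?_) _
    rw [show (3 : ℝ) = 1 + 2 by norm_num, wt_add hξ, ← mul_assoc]
    exact mul_le_mul_left (hK ξ) _
  have hgm : AEMeasurable g (volume.restrict (Set.Ioo 0 t)) :=
    H.cont.vCont.aemeasurable_energy hlb2 le_rfl
  have ham : AEMeasurable a (volume.restrict (Set.Ioo 0 t)) :=
    (H.cont.vCont.aemeasurable_energy (locBdd_wt 3) le_rfl).const_mul _
  have haA : ∫⁻ s in Set.Ioo 0 t, a s = ENNReal.ofReal (C / ν) *
      ∫⁻ s in Set.Ioo 0 t, energy (wt 3) (u s) := lintegral_const_mul' _ _ ENNReal.ofReal_ne_top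
  set Kc := ENNReal.ofReal (0 ^ γ) * f 0 + ENNReal.ofReal γ *
    ∫⁻ s in Set.Ioo 0 t, ENNReal.ofReal (s ^ (γ - 1)) * f s with hKc
  have key : ∀ τ ∈ Set.Icc 0 t, ENNReal.ofReal (τ ^ γ) * f τ +
      ENNReal.ofReal ν * (∫⁻ s in Set.Ioo 0 τ, ENNReal.ofReal (s ^ γ) * g s) ≤
      Kc + ∫⁻ s in Set.Ioo 0 τ, ENNReal.ofReal (s ^ γ) * f s * a s := by
    intro τ hτ
    have hsub : Set.Ioo 0 τ ⊆ Set.Ioo 0 t := Set.Ioo_subset_Ioo_right hτ.2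
    have hsub' : Set.Ioo 0 τ ⊆ Set.Icc 0 t := hsub.trans Set.Ioo_subset_Icc_self
    have h1 := H.diss.energy_le_rpow hν.le hlb hγ hτ
    set I := ∫⁻ s in Set.Ioo 0 τ, ENNReal.ofReal (s ^ γ) * g s with hI
    -- The truncated dissipation is at most a multiple of the integral of `‖u‖²` in `Ḣ^{3/2}`, which
    -- is finite by assumption.
    have hIfin : ENNReal.ofReal ν * I ≠ ∞ := by
      refine ENNReal.mul_ne_top ENNReal.ofReal_ne_top ?_
      refine ne_top_of_le_ne_top (ENNReal.mul_ne_top (ENNReal.mul_ne_top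
        (ENNReal.ofReal_ne_top (r := t ^ γ)) (ENNReal.coe_ne_top (r := K))) H.fin) ?_
      rw [← lintegral_const_mul' _ _ (ENNReal.mul_ne_top ENNReal.ofReal_ne_top ENNReal.coe_ne_top)]
      refine le_trans ?_ (lintegral_mono_set hsub)
      refine setLIntegral_mono' measurableSet_Ioo fun s hs => ?_
      rw [mul_assoc]
      refine mul_le_mul' (ENNReal.ofReal_le_ofReal ?_) (hgle s)
      exact Real.rpow_le_rpow hs.1.le (hs.2.le.trans hτ.2) hγ
    have h2 : 2 * ∫⁻ s in Set.Ioo 0 τ, ENNReal.ofReal (s ^ γ) *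
        pairing (fun ξ => w ξ ^ 2) (u s) (N s) ≤
        ENNReal.ofReal ν * I + ∫⁻ s in Set.Ioo 0 τ, ENNReal.ofReal (s ^ γ) * f s * a s := by
      rw [← lintegral_const_mul' _ _ (by norm_num), hI, ← lintegral_const_mul' _ _
        ENNReal.ofReal_ne_top, ← lintegral_add_left']
      · refine setLIntegral_mono' measurableSet_Ioo fun s hs => ?_
        calc 2 * (ENNReal.ofReal (s ^ γ) * pairing (fun ξ => w ξ ^ 2) (u s) (N s))
            = ENNReal.ofReal (s ^ γ) * (2 * pairing (fun ξ => w ξ ^ 2) (u s) (N s)) := by ring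
          _ ≤ ENNReal.ofReal (s ^ γ) * (ENNReal.ofReal ν * g s +
              ENNReal.ofReal (C / ν) * (f s * energy (wt 3) (u s))) := by
              gcongr
              exact hC H hw s (hsub' hs)
          _ = _ := by simp only [ha]; ring
      · refine AEMeasurable.const_mul (AEMeasurable.mul (by fun_prop) ?_) _
        exact hgm.mono_measure (Measure.restrict_mono hsub le_rfl)
    have h3 : ENNReal.ofReal (τ ^ γ) * f τ + ENNReal.ofReal (2 * ν) * I ≤ Kc +
        (ENNReal.ofReal ν * I + ∫⁻ s in Set.Ioo 0 τ, ENNReal.ofReal (s ^ γ) * f s * a s) := by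
      refine h1.trans (add_le_add ?_ h2)
      simp only [hKc]
      gcongr
    rw [two_mul, ENNReal.ofReal_add hν.le hν.le, add_mul, ← add_assoc,
      add_comm (ENNReal.ofReal ν * I) (∫⁻ s in Set.Ioo 0 τ, _), ← add_assoc] at h3
    exact (ENNReal.add_le_add_iff_right hIfin).1 h3
  obtain ⟨B, hB⟩ := H.cont.exists_bound
  intro τ hτ
  refine (key τ hτ).trans ?_
  have hfin : ∫⁻ s in Set.Ioo 0 t, a s ≠ ∞ := by
    rw [haA]; exact ENNReal.mul_ne_top ENNReal.ofReal_ne_top H.fin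
  -- Gronwall is applied to the first summand of `key` alone; since it bounds the right side of
  -- `key`, both summands are controlled.
  have hg := gronwall_le (φ := fun s => ENNReal.ofReal (s ^ γ) * f s) (K := Kc)
    (B := ENNReal.ofReal (t ^ γ) * (K * B)) ham hfin
    (ENNReal.mul_ne_top ENNReal.ofReal_ne_top (ENNReal.mul_ne_top ENNReal.coe_ne_top
      ENNReal.coe_ne_top)) (fun s hs => ?_) (fun s hs => le_self_add.trans (key s hs)) hτ
  · refine hg.trans (le_of_eq ?_)
    congr 4
    rw [haA, ENNReal.toReal_mul, ENNReal.toReal_ofReal (by positivity), expo]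
    push_cast
    ring
  · refine mul_le_mul' (ENNReal.ofReal_le_ofReal (Real.rpow_le_rpow hs.1 hs.2 hγ)) ?_
    refine le_trans ?_ (mul_le_mul_right (hB s hs) _)
    rw [← energy_const_mul ENNReal.coe_ne_top]
    exact energy_mono_weight (fun ξ _ => hK ξ) _

/-- A Sobolev weight truncated at high frequencies. -/
def truncW (e : ℝ) (M : ℕ) (ξ : R3) : ℝ≥0∞ :=
  wt (1 / 2) ξ * ENNReal.ofReal (min (2 * Real.pi * ‖ξ‖) (M + 1) ^ e)

theorem truncW_sq (e : ℝ) (M : ℕ) (ξ : R3) :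
    truncW e M ξ ^ 2 = wt 1 ξ * ENNReal.ofReal (min (2 * Real.pi * ‖ξ‖) (M + 1) ^ e) ^ 2 := by
  rw [truncW, mul_pow, wt_sq]
  norm_num

/-- If `‖x‖ ≤ l ‖ζ‖` with `l ≥ 1`, the same inequality survives truncation of both sides at level `M
+ 1`. Hence the growth exponent is `1/2 + e`, with a constant uniform in `M`. -/
theorem truncW_moderate {e : ℝ} (he : 0 ≤ e) (M : ℕ) :
    ModerateWeight (1 / 2 + e) (truncW e M) := by
  have hpi := Real.pi_pos
  refine ⟨?_, fun ζ hζ => ?_, fun x ζ η hx hζ hη => ?_⟩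
  · exact (measurable_wt _).mul (by fun_prop)
  · have h1 := two_pi_norm_pos hζ
    have h2 : 0 < min (2 * Real.pi * ‖ζ‖) ((M : ℝ) + 1) := lt_min h1 (by positivity)
    refine ⟨mul_ne_zero (wt_ne_zero _ hζ) ?_, ENNReal.mul_ne_top (wt_ne_top _ _)
      ENNReal.ofReal_ne_top⟩
    simpa using Real.rpow_pos_of_pos h2 e
  · have hζ0 : 0 < ‖ζ‖ := norm_pos_iff.2 hζ
    have hη0 : 0 < ‖η‖ := hζ0.trans_le hη
    set l := 2 * (‖η‖ / ‖ζ‖) with hl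
    have hl1 : 1 ≤ l := by
      have : 1 ≤ ‖η‖ / ‖ζ‖ := (one_le_div hζ0).2 hη
      linarith
    have hxl : ‖x‖ ≤ l * ‖ζ‖ := by
      rw [hl, mul_assoc, div_mul_cancel₀ _ hζ0.ne']; exact hx
    have hmin : min (2 * Real.pi * ‖x‖) ((M : ℝ) + 1) ≤
        l * min (2 * Real.pi * ‖ζ‖) ((M : ℝ) + 1) := by
      rw [mul_min_of_nonneg _ _ (by linarith)]
      refine min_le_min ?_ ?_
      · calc 2 * Real.pi * ‖x‖ ≤ 2 * Real.pi * (l * ‖ζ‖) := by gcongr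
          _ = _ := by ring
      · nlinarith [(Nat.cast_nonneg M : (0 : ℝ) ≤ M)]
    have hm0 : ∀ z : R3, 0 ≤ min (2 * Real.pi * ‖z‖) ((M : ℝ) + 1) := fun z =>
      le_min (by positivity) (by positivity)
    have e1 : (2 : ℝ) ^ (1 / 2 + e) * (‖η‖ / ‖ζ‖) ^ (1 / 2 + e) = l ^ (1 / 2 : ℝ) * l ^ e := by
      rw [← Real.mul_rpow (by norm_num) (by positivity), ← hl, Real.rpow_add (by linarith)]
    rw [e1, truncW, truncW, wt, wt, ← ENNReal.ofReal_mul (by positivity),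
      ← ENNReal.ofReal_mul (by positivity), ← ENNReal.ofReal_mul (by positivity)]
    refine ENNReal.ofReal_le_ofReal ?_
    calc (2 * Real.pi * ‖x‖) ^ (1 / 2 : ℝ) * min (2 * Real.pi * ‖x‖) ((M : ℝ) + 1) ^ e
        ≤ (l * (2 * Real.pi * ‖ζ‖)) ^ (1 / 2 : ℝ) *
          (l * min (2 * Real.pi * ‖ζ‖) ((M : ℝ) + 1)) ^ e := by
          refine mul_le_mul (Real.rpow_le_rpow (by positivity) ?_ (by norm_num))
            (Real.rpow_le_rpow (hm0 x) hmin he) (Real.rpow_nonneg (hm0 x) _) (by positivity)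
          calc 2 * Real.pi * ‖x‖ ≤ 2 * Real.pi * (l * ‖ζ‖) := by gcongr
            _ = _ := by ring
      _ = _ := by
          rw [Real.mul_rpow (by linarith) (by positivity), Real.mul_rpow (by linarith) (hm0 ζ)]
          ring

theorem truncW_sq_le {e : ℝ} (he : 0 ≤ e) (M : ℕ) (ξ : R3) :
    truncW e M ξ ^ 2 ≤ (((((M : ℝ) + 1) ^ e) ^ 2).toNNReal : ℝ≥0) * wt 1 ξ := by
  have hpi := Real.pi_pos
  have h0 : 0 ≤ min (2 * Real.pi * ‖ξ‖) ((M : ℝ) + 1) := le_min (by positivity) (by positivity)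
  rw [truncW_sq, mul_comm]
  refine mul_le_mul_left ?_ _
  rw [← ENNReal.ofReal_pow (Real.rpow_nonneg h0 _)]
  refine ENNReal.ofReal_le_ofReal ?_
  gcongr
  exact min_le_right _ _

theorem truncW_sq_le_wt {e : ℝ} (he : 0 ≤ e) (M : ℕ) {ξ : R3} (hξ : ξ ≠ 0) :
    truncW e M ξ ^ 2 ≤ wt (1 + 2 * e) ξ := by
  have hpi := Real.pi_pos
  have h0 : 0 ≤ min (2 * Real.pi * ‖ξ‖) ((M : ℝ) + 1) := le_min (by positivity) (by positivity)
  rw [truncW_sq, wt_add hξ, ← wt_sq e]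
  gcongr
  refine ENNReal.ofReal_le_ofReal (Real.rpow_le_rpow h0 (min_le_left _ _) he)

theorem truncW_mono {e : ℝ} (he : 0 ≤ e) (ξ : R3) : Monotone fun M => truncW e M ξ ^ 2 := by
  intro M M' h
  have hpi := Real.pi_pos
  have h0 : 0 ≤ min (2 * Real.pi * ‖ξ‖) ((M : ℝ) + 1) := le_min (by positivity) (by positivity)
  have h' : (M : ℝ) ≤ M' := by exact_mod_cast h
  simp only [truncW_sq]
  gcongr

theorem truncW_tendsto (e : ℝ) {ξ : R3} (hξ : ξ ≠ 0) :
    Tendsto (fun M => truncW e M ξ ^ 2) atTop (𝓝 (wt (1 + 2 * e) ξ)) := by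
  refine tendsto_const_nhds.congr' ?_
  obtain ⟨n, hn⟩ := exists_nat_ge (2 * Real.pi * ‖ξ‖)
  filter_upwards [eventually_ge_atTop n] with M hM
  have : (n : ℝ) ≤ M := by exact_mod_cast hM
  rw [truncW_sq, min_eq_left (by linarith), wt_add hξ, ← wt_sq e, wt, wt]

theorem energy_truncW_tendsto {e : ℝ} (he : 0 ≤ e) {g : R3 → Fin 4 → ℂ} (hg : CompMeas g) :
    Tendsto (fun M => energy (fun ξ => truncW e M ξ ^ 2) g) atTop
      (𝓝 (energy (wt (1 + 2 * e)) g)) := by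
  refine lintegral_tendsto_of_tendsto_of_monotone (fun M => ?_) (ae_of_all _ fun ξ => ?_) ?_
  · exact ((truncW_moderate he M).measurable.pow_const 2).aemeasurable.mul hg.nsq
  · exact fun M M' h => mul_le_mul_left (truncW_mono he ξ h) _
  · filter_upwards [ae_ne_zero] with ξ hξ
    exact ENNReal.Tendsto.mul_const (truncW_tendsto e hξ) (Or.inr (nsq_ne_top _))

theorem energy_truncW_wt_tendsto {e : ℝ} (he : 0 ≤ e) {g : R3 → Fin 4 → ℂ} (hg : CompMeas g) :
    Tendsto (fun M => energy (fun ξ => truncW e M ξ ^ 2 * wt 2 ξ) g) atTop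
      (𝓝 (energy (wt (3 + 2 * e)) g)) := by
  refine lintegral_tendsto_of_tendsto_of_monotone (fun M => ?_) (ae_of_all _ fun ξ => ?_) ?_
  · exact (((truncW_moderate he M).measurable.pow_const 2).mul
      (measurable_wt 2)).aemeasurable.mul hg.nsq
  · exact fun M M' h => mul_le_mul_left (mul_le_mul_left (truncW_mono he ξ h) _) _
  · filter_upwards [ae_ne_zero] with ξ hξ
    rw [show 3 + 2 * e = (1 + 2 * e) + 2 by ring, wt_add hξ]
    exact ENNReal.Tendsto.mul_const (ENNReal.Tendsto.mul_const (truncW_tendsto e hξ)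
      (Or.inr (wt_ne_top _ _))) (Or.inr (nsq_ne_top _))

/-- Propagation of Sobolev regularity, with a weight in time. -/
theorem exists_sobolev_bound {e : ℝ} (he : 0 ≤ e) (he1 : e < 1) : ∃ c : ℝ≥0, ∀ {ν t : ℝ}
    {u N : ℝ → R3 → Fin 4 → ℂ}, QuadEvol ν t u N → ∀ {γ : ℝ}, 0 ≤ γ → ∀ τ ∈ Set.Icc 0 t,
    ENNReal.ofReal (τ ^ γ) * energy (wt (1 + 2 * e)) (u τ) +
        ENNReal.ofReal ν * (∫⁻ s in Set.Ioo 0 τ, ENNReal.ofReal (s ^ γ) *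
          energy (wt (3 + 2 * e)) (u s)) ≤
      2 * ENNReal.ofReal (Real.exp (c * expo ν t u)) *
        (ENNReal.ofReal (0 ^ γ) * energy (wt (1 + 2 * e)) (u 0) +
          ENNReal.ofReal γ * ∫⁻ s in Set.Ioo 0 t, ENNReal.ofReal (s ^ (γ - 1)) *
            energy (wt (1 + 2 * e)) (u s)) := by
  obtain ⟨c, hc⟩ := exists_truncated_bound (σ := 1 / 2 + e) (by linarith)
  refine ⟨c, fun {ν t u N} H γ hγ τ hτ => ?_⟩
  have hsub : Set.Ioo 0 τ ⊆ Set.Icc 0 t :=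
    Set.Ioo_subset_Icc_self.trans (Set.Icc_subset_Icc_right hτ.2)
  have hlb : ∀ M, LocBdd fun ξ => truncW e M ξ ^ 2 * wt 2 ξ := fun M => by
    refine LocBdd.mul ⟨(truncW_moderate he M).measurable.pow_const 2, fun n => ?_⟩ (locBdd_wt 2)
    obtain ⟨K', hK'⟩ := (locBdd_wt (1 + 2 * e)).bdd n
    exact ⟨K', fun ξ hξ => (truncW_sq_le_wt he M (ne_zero_of_mem_annulus hξ)).trans (hK' ξ hξ)⟩
  have hlimInt : Tendsto (fun M => ∫⁻ s in Set.Ioo 0 τ, ENNReal.ofReal (s ^ γ) *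
      energy (fun ξ => truncW e M ξ ^ 2 * wt 2 ξ) (u s)) atTop
      (𝓝 (∫⁻ s in Set.Ioo 0 τ, ENNReal.ofReal (s ^ γ) * energy (wt (3 + 2 * e)) (u s))) := by
    refine lintegral_tendsto_of_tendsto_of_monotone (fun M => ?_) (ae_of_all _ fun s => ?_) ?_
    · exact AEMeasurable.mul (by fun_prop) (H.cont.vCont.aemeasurable_energy (hlb M) hτ.2)
    · intro M M' h
      refine mul_le_mul_right (energy_mono_weight (fun ξ _ => ?_) _) _
      exact mul_le_mul_left (truncW_mono he ξ h) _
    · refine (ae_restrict_mem measurableSet_Ioo).mono fun s hs => ?_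
      exact ENNReal.Tendsto.const_mul (energy_truncW_wt_tendsto he (H.cont.meas s (hsub hs)))
        (Or.inr ENNReal.ofReal_ne_top)
  -- The constant does not see `M`, so monotone convergence removes the truncation.
  refine le_of_tendsto ((ENNReal.Tendsto.const_mul (energy_truncW_tendsto he
    (H.cont.meas τ hτ)) (Or.inr ENNReal.ofReal_ne_top)).add (ENNReal.Tendsto.const_mul hlimInt
    (Or.inr ENNReal.ofReal_ne_top))) (Eventually.of_forall fun M => ?_)
  refine (hc H (truncW_moderate he M) (truncW_sq_le he M) hγ τ hτ).trans ?_
  gcongr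
  · exact energy_mono_weight (fun ξ hξ => truncW_sq_le_wt he M hξ) _
  · exact energy_mono_weight (fun ξ hξ => truncW_sq_le_wt he M hξ) _

/-- The exponential constants `c e^{c x}`. -/
def eb (x : ℝ) (c : ℝ≥0) : ℝ≥0∞ := c * ENNReal.ofReal (Real.exp (c * x))

theorem eb_ne_top (x : ℝ) (c : ℝ≥0) : eb x c ≠ ∞ :=
  ENNReal.mul_ne_top ENNReal.coe_ne_top ENNReal.ofReal_ne_top

theorem eb_mono {x : ℝ} (hx : 0 ≤ x) {c c' : ℝ≥0} (h : c ≤ c') : eb x c ≤ eb x c' := by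
  unfold eb
  gcongr

/-- Constants of the form `c e^(c x)` are stable under products and sums after enlarging `c`; this
avoids tracking exponents through the estimates below. -/
theorem eb_mul_le {x : ℝ} (hx : 0 ≤ x) (c c' : ℝ≥0) :
    eb x c * eb x c' ≤ eb x ((c + 1) * (c' + 1)) := by
  have e : eb x c * eb x c' = ((c * c' : ℝ≥0) : ℝ≥0∞) *
      ENNReal.ofReal (Real.exp ((c + c' : ℝ≥0) * x)) := by
    have : Real.exp ((c + c' : ℝ≥0) * x) = Real.exp (c * x) * Real.exp (c' * x) := by
      rw [← Real.exp_add]; push_cast; ring_nf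
    rw [this, ENNReal.ofReal_mul (by positivity), eb, eb]
    push_cast
    ring
  have h1 : c * c' ≤ (c + 1) * (c' + 1) := by gcongr <;> exact le_self_add
  have h2 : c + c' ≤ (c + 1) * (c' + 1) := by
    calc c + c' ≤ c + c' + (c * c' + 1) := le_self_add
      _ = _ := by ring
  rw [e, eb]
  gcongr

theorem coe_mul_eb_le {x : ℝ} (hx : 0 ≤ x) (c₀ c : ℝ≥0) :
    (c₀ : ℝ≥0∞) * eb x c ≤ eb x ((c₀ + 1) * (c + 1)) := by
  refine le_trans ?_ (eb_mul_le hx c₀ c)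
  gcongr
  rw [eb]
  refine le_mul_of_one_le_right zero_le ?_
  rw [ENNReal.one_le_ofReal]
  exact Real.one_le_exp (by positivity)

theorem eb_add_le {x : ℝ} (hx : 0 ≤ x) (c c' : ℝ≥0) : eb x c + eb x c' ≤ eb x (c + c') := by
  have h1 : ENNReal.ofReal (Real.exp (c * x)) ≤
      ENNReal.ofReal (Real.exp ((c + c' : ℝ≥0) * x)) := by
    gcongr; exact le_self_add
  have h2 : ENNReal.ofReal (Real.exp (c' * x)) ≤
      ENNReal.ofReal (Real.exp ((c + c' : ℝ≥0) * x)) := by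
    gcongr; exact le_add_self
  unfold eb
  rw [ENNReal.coe_add, add_mul]
  gcongr

theorem ofReal_exp_le_eb {x : ℝ} (hx : 0 ≤ x) (c : ℝ≥0) :
    ENNReal.ofReal (Real.exp (c * x)) ≤ eb x (c + 1) := by
  calc ENNReal.ofReal (Real.exp (c * x)) = ((1 : ℝ≥0) : ℝ≥0∞) *
        ENNReal.ofReal (Real.exp (c * x)) := by simp
    _ ≤ _ := by
      unfold eb
      gcongr <;> [exact le_add_self; exact le_self_add]

theorem expo_nonneg {ν t : ℝ} (hν : 0 < ν) (u : ℝ → R3 → Fin 4 → ℂ) : 0 ≤ expo ν t u := by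
  unfold expo; positivity

theorem moderateWeight_wt {σ : ℝ} (hσ : 0 ≤ σ) : ModerateWeight σ (wt σ) := by
  have hpi := Real.pi_pos
  refine ⟨measurable_wt σ, fun ζ hζ => ⟨wt_ne_zero σ hζ, wt_ne_top σ ζ⟩, fun x ζ η hx hζ hη => ?_⟩
  have hζ0 : 0 < ‖ζ‖ := norm_pos_iff.2 hζ
  rw [wt, wt, ← ENNReal.ofReal_mul (by positivity), ← Real.mul_rpow (by norm_num) (by positivity),
    ← Real.mul_rpow (by positivity) (by positivity)]
  refine ENNReal.ofReal_le_ofReal (Real.rpow_le_rpow (by positivity) ?_ hσ)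
  calc 2 * Real.pi * ‖x‖ ≤ 2 * Real.pi * (2 * ‖η‖) := by gcongr
    _ = 2 * (‖η‖ / ‖ζ‖) * (2 * Real.pi * ‖ζ‖) := by field_simp

/-- Propagation of the initial Sobolev regularity. -/
theorem exists_level_bound {d : ℝ} (hd : 0 ≤ d) (hd1 : d < 1) : ∃ c : ℝ≥0, ∀ {ν t : ℝ}
    {u N : ℝ → R3 → Fin 4 → ℂ}, QuadEvol ν t u N →
    (∀ τ ∈ Set.Icc 0 t, energy (wt (1 + 2 * d)) (u τ) ≤
      eb (expo ν t u) c * energy (wt (1 + 2 * d)) (u 0)) ∧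
    ENNReal.ofReal ν * (∫⁻ s in Set.Ioo 0 t, energy (wt (3 + 2 * d)) (u s)) ≤
      eb (expo ν t u) c * energy (wt (1 + 2 * d)) (u 0) := by
  obtain ⟨c, hc⟩ := exists_sobolev_bound hd hd1
  refine ⟨(2 + 1) * (c + 1 + 1), fun {ν t u N} H => ?_⟩
  have hx := expo_nonneg (t := t) H.ν_pos u
  have h1 : ∀ τ ∈ Set.Icc 0 t, energy (wt (1 + 2 * d)) (u τ) +
      ENNReal.ofReal ν * (∫⁻ s in Set.Ioo 0 τ, energy (wt (3 + 2 * d)) (u s)) ≤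
      eb (expo ν t u) ((2 + 1) * (c + 1 + 1)) * energy (wt (1 + 2 * d)) (u 0) := fun τ hτ => by
    have h := hc H le_rfl τ hτ
    simp only [Real.rpow_zero, ENNReal.ofReal_one, one_mul, ENNReal.ofReal_zero, zero_mul,
      add_zero] at h
    refine h.trans ?_
    gcongr
    refine le_trans ?_ (coe_mul_eb_le hx 2 (c + 1))
    exact mul_le_mul_right (ofReal_exp_le_eb hx c) _
  exact ⟨fun τ hτ => le_self_add.trans (h1 τ hτ),
    le_add_self.trans (h1 t ⟨H.t_nonneg, le_rfl⟩)⟩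

/-! ### Time-independent domination of the energy densities, and smoothing at low frequencies. -/

/-- The energy brought in by the initial data and by the forcing. -/
def mass (ω : R3 → ℝ≥0∞) (t : ℝ) (u N : ℝ → R3 → Fin 4 → ℂ) : ℝ≥0∞ :=
  energy ω (u 0) + ∫⁻ s in Set.Ioo 0 t, 2 * pairing ω (u s) (N s)

/-- The work of the nonlinearity in absolute value is bounded by the dissipation and by
`‖u‖²_{Ḣ^{1/2+d}} ‖u‖²_{Ḣ^{3/2}} / ν`, both already controlled by the propagation of regularity. -/
theorem exists_mass_le {d : ℝ} (hd : 0 ≤ d) (hd1 : d < 1) : ∃ c : ℝ≥0, ∀ {ν t : ℝ}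
    {u N : ℝ → R3 → Fin 4 → ℂ}, QuadEvol ν t u N →
    mass (wt (1 + 2 * d)) t u N ≤ eb (expo ν t u) c * energy (wt (1 + 2 * d)) (u 0) := by
  obtain ⟨c, hc⟩ := exists_level_bound hd hd1
  obtain ⟨C, hC⟩ := exists_pairing_le (σ := 1 / 2 + d) (by linarith)
  refine ⟨1 + (c + (C + 1 + 1) * (c + 1)), fun {ν t u N} H => ?_⟩
  have hν := H.ν_pos
  set x := expo ν t u with hxdef
  have hx : 0 ≤ x := expo_nonneg hν u
  obtain ⟨h1, h2⟩ := hc H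
  set E := eb x c * energy (wt (1 + 2 * d)) (u 0) with hE
  have e1 : (fun ξ => wt (1 / 2 + d) ξ ^ 2) = wt (1 + 2 * d) := by
    funext ξ; rw [wt_sq]; congr 1; ring
  have hgm : AEMeasurable (fun s => energy (wt (3 + 2 * d)) (u s))
      (volume.restrict (Set.Ioo 0 t)) := H.cont.vCont.aemeasurable_energy (locBdd_wt _) le_rfl
  have h3 : ∫⁻ s in Set.Ioo 0 t, 2 * pairing (wt (1 + 2 * d)) (u s) (N s) ≤
      E + ENNReal.ofReal (C / ν) * (E * ∫⁻ s in Set.Ioo 0 t, energy (wt 3) (u s)) := by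
    calc ∫⁻ s in Set.Ioo 0 t, 2 * pairing (wt (1 + 2 * d)) (u s) (N s)
        ≤ ∫⁻ s in Set.Ioo 0 t, (ENNReal.ofReal ν * energy (wt (3 + 2 * d)) (u s) +
          ENNReal.ofReal (C / ν) * (energy (wt (1 + 2 * d)) (u s) * energy (wt 3) (u s))) := by
          refine setLIntegral_mono' measurableSet_Ioo fun s hs => ?_
          have h := hC H (moderateWeight_wt (by linarith)) s (Set.Ioo_subset_Icc_self hs)
          rw [e1] at h
          refine h.trans (le_of_eq ?_)
          congr 2
          refine energy_congr_weight (fun ξ hξ => ?_) _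
          rw [wt_sq, ← wt_add hξ]; congr 1; ring
      _ = ENNReal.ofReal ν * (∫⁻ s in Set.Ioo 0 t, energy (wt (3 + 2 * d)) (u s)) +
          ENNReal.ofReal (C / ν) * ∫⁻ s in Set.Ioo 0 t,
            energy (wt (1 + 2 * d)) (u s) * energy (wt 3) (u s) := by
          rw [lintegral_add_left' (hgm.const_mul _), lintegral_const_mul' _ _ ENNReal.ofReal_ne_top,
            lintegral_const_mul' _ _ ENNReal.ofReal_ne_top]
      _ ≤ _ := by
          gcongr
          rw [← lintegral_const_mul'' _ (H.cont.vCont.aemeasurable_energy (locBdd_wt 3) le_rfl)]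
          refine setLIntegral_mono' measurableSet_Ioo fun s hs => ?_
          exact mul_le_mul_left (h1 s (Set.Ioo_subset_Icc_self hs)) _
  -- The integral produces the factor `C x` with `x` the exponent `expo`, and `C x ≤ e^(C x)`
  -- absorbs it in an exponential constant.
  have h4 : ENNReal.ofReal (C / ν) * (E * ∫⁻ s in Set.Ioo 0 t, energy (wt 3) (u s)) ≤
      eb x (C + 1) * E := by
    rw [← ENNReal.ofReal_toReal H.fin, mul_left_comm, ← ENNReal.ofReal_mul (by positivity),
      mul_comm E]
    gcongr
    refine le_trans (ENNReal.ofReal_le_ofReal ?_) (ofReal_exp_le_eb hx C)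
    refine le_trans (le_of_eq ?_) ((Real.add_one_le_exp _).trans' (le_add_of_nonneg_right
      zero_le_one))
    rw [hxdef, expo]
    ring
  calc mass (wt (1 + 2 * d)) t u N ≤ energy (wt (1 + 2 * d)) (u 0) + (E + eb x (C + 1) * E) :=
        add_le_add le_rfl (h3.trans (add_le_add le_rfl h4))
    _ = (1 + (eb x c + eb x (C + 1) * eb x c)) * energy (wt (1 + 2 * d)) (u 0) := by
        rw [hE]; ring
    _ ≤ _ := by
        gcongr
        refine le_trans (add_le_add ?_ (add_le_add le_rfl (eb_mul_le hx _ _))) (le_trans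
          (add_le_add le_rfl (eb_add_le hx _ _)) (eb_add_le hx 1 _))
        unfold eb
        simp only [ENNReal.coe_one, one_mul, NNReal.coe_one, ENNReal.one_le_ofReal]
        exact Real.one_le_exp hx

theorem energy_indicator {ω : R3 → ℝ≥0∞} {B : Set R3} (hB : MeasurableSet B)
    (g : R3 → Fin 4 → ℂ) : energy (B.indicator ω) g = ∫⁻ ξ in B, ω ξ * nsq (g ξ) := by
  rw [energy, ← lintegral_indicator hB]
  refine lintegral_congr fun ξ => ?_
  by_cases h : ξ ∈ B <;> simp [h]

theorem pairing_indicator {ω : R3 → ℝ≥0∞} {B : Set R3} (hB : MeasurableSet B)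
    (g g' : R3 → Fin 4 → ℂ) :
    pairing (B.indicator ω) g g' = ∫⁻ ξ in B, ω ξ * (amp (g ξ) * amp (g' ξ)) := by
  rw [pairing, ← lintegral_indicator hB]
  refine lintegral_congr fun ξ => ?_
  by_cases h : ξ ∈ B <;> simp [h]

/-- The energy densities of a dissipative evolution are dominated by a measure that does not
depend on time. -/
theorem DissEvol.exists_measure {ν t : ℝ} (hν : 0 ≤ ν) {u N : ℝ → R3 → Fin 4 → ℂ}
    (H : DissEvol ν t u N) {ω : R3 → ℝ≥0∞} (hω : LocBdd ω) :
    ∃ μ : Measure R3, μ Set.univ = mass ω t u N ∧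
      ∀ τ ∈ Set.Icc 0 t, volume.withDensity (fun ξ => ω ξ * nsq (u τ ξ)) ≤ μ := by
  -- The energy inequality may be cut off to any measurable set `B` of frequencies. Its right side,
  -- with the forcing integrated over the whole interval, is countably additive in `B` and
  -- independent of the time of observation.
  refine ⟨Measure.ofMeasurable (fun B _ => mass (B.indicator ω) t u N) ?_ ?_, ?_, fun τ hτ => ?_⟩
  · simp [mass, energy, pairing]
  · intro B hB hd
    have hmeas : ∀ i, AEMeasurable (fun s => 2 * pairing ((B i).indicator ω) (u s) (N s))
        (volume.restrict (Set.Ioo 0 t)) := fun i =>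
      (H.left.aemeasurable_pairing H.force (hω.indicator (hB i)) le_rfl).const_mul _
    simp only [mass]
    rw [ENNReal.tsum_add, ← lintegral_tsum hmeas]
    congr 1
    · rw [energy_indicator (MeasurableSet.iUnion hB), lintegral_iUnion hB hd]
      exact tsum_congr fun i => (energy_indicator (hB i) _).symm
    · refine lintegral_congr fun s => ?_
      rw [ENNReal.tsum_mul_left, pairing_indicator (MeasurableSet.iUnion hB),
        lintegral_iUnion hB hd]
      congr 1
      exact tsum_congr fun i => (pairing_indicator (hB i) _ _).symm
  · rw [Measure.ofMeasurable_apply _ MeasurableSet.univ, Set.indicator_univ]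
  · refine Measure.le_iff.2 fun B hB => ?_
    rw [Measure.ofMeasurable_apply _ hB, withDensity_apply _ hB, ← energy_indicator hB]
    have h := H.energy_le_rpow hν (hω.indicator hB) le_rfl hτ
    simp only [Real.rpow_zero, ENNReal.ofReal_one, one_mul, ENNReal.ofReal_zero, zero_mul,
      add_zero] at h
    refine (le_self_add.trans h).trans ?_
    rw [mass, lintegral_const_mul' _ _ (by norm_num)]
    gcongr
    exact hτ.2

theorem lintegral_Ioo_rpow {β L : ℝ} (hβ : 0 < β) (hL : 0 ≤ L) :
    ∫⁻ s in Set.Ioo 0 L, ENNReal.ofReal (s ^ (β - 1)) = ENNReal.ofReal (L ^ β / β) := by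
  rw [← ofReal_intervalIntegral hL (intervalIntegral.intervalIntegrable_rpow' (by linarith))
    fun s hs => Real.rpow_nonneg hs.1.le _, integral_rpow (Or.inl (by linarith))]
  congr 1
  rw [sub_add_cancel, Real.zero_rpow hβ.ne', sub_zero]

/-- Smoothing at low frequencies, relative to the time scale. -/
theorem DissEvol.low_estimate {ν t : ℝ} (hν : 0 < ν) {u N : ℝ → R3 → Fin 4 → ℂ}
    (H : DissEvol ν t u N) (hu : ∀ τ ∈ Set.Icc 0 t, CompMeas (u τ)) {p β : ℝ} (hβ : 0 < β)
    (hβ1 : β < 1) (hmass : mass (wt p) t u N ≠ ∞) :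
    ∫⁻ s in Set.Ioo 0 t, ENNReal.ofReal (s ^ (β - 1)) * energy (wt (p + 2 * β)) (u s) ≤
      ENNReal.ofReal (ν ^ (-β)) * (ENNReal.ofReal (1 / β) * mass (wt p) t u N +
        ENNReal.ofReal ν * ∫⁻ s in Set.Ioo 0 t, energy (wt (p + 2)) (u s)) := by
  obtain ⟨μ, hμ, hle⟩ := H.exists_measure hν.le (locBdd_wt p)
  have : IsFiniteMeasure μ := ⟨by rw [hμ]; exact hmass.lt_top⟩
  have hpi := Real.pi_pos
  -- The pairs of a time and a frequency on which the heat flow has not yet acted, namely `ν s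
  -- |2πξ|² < 1`.
  set S : Set (ℝ × R3) := {q | q.1 * (ν * (2 * Real.pi * ‖q.2‖) ^ 2) < 1} with hS
  have hSm : MeasurableSet S := by
    refine measurableSet_lt ?_ measurable_const
    fun_prop
  set k : ℝ × R3 → ℝ≥0∞ := S.indicator fun q =>
    ENNReal.ofReal (q.1 ^ (β - 1)) * wt (2 * β) q.2 with hk
  have hkm : Measurable k := by
    refine Measurable.indicator ?_ hSm
    exact (measurable_fst.pow_const (β - 1)).ennreal_ofReal.mul
      ((measurable_wt _).comp measurable_snd)
  -- Outside `S` and for `β < 1`, `s^(β-1) ≤ (ν |2πξ|²)^(1-β)`, so the weight is at most `ν^(1-β)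
  -- |2πξ|²` and is paid by the dissipation.
  have hpt : ∀ s, 0 < s → ∀ ξ : R3, ξ ≠ 0 → ENNReal.ofReal (s ^ (β - 1)) * wt (2 * β) ξ ≤
      k (s, ξ) + ENNReal.ofReal (ν ^ (1 - β)) * wt 2 ξ := by
    intro s hs ξ hξ
    by_cases h : (s, ξ) ∈ S
    · rw [hk, Set.indicator_of_mem h]
      exact le_self_add
    · refine le_add_of_nonneg_of_le zero_le ?_
      have hρ := two_pi_norm_pos hξ
      set ρ := 2 * Real.pi * ‖ξ‖ with hρd
      have h1 : 1 ≤ s * (ν * ρ ^ 2) := not_lt.1 h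
      rw [wt, wt, ← hρd, ← ENNReal.ofReal_mul (by positivity), ← ENNReal.ofReal_mul (by positivity)]
      refine ENNReal.ofReal_le_ofReal ?_
      have h2 : (s * (ν * ρ ^ 2)) ^ (β - 1) ≤ 1 :=
        Real.rpow_le_one_of_one_le_of_nonpos h1 (by linarith)
      rw [Real.mul_rpow hs.le (by positivity), Real.mul_rpow hν.le (by positivity),
        ← Real.rpow_natCast ρ 2, ← Real.rpow_mul hρ.le] at h2
      have e1 : ν ^ (1 - β) * ρ ^ (2 : ℝ) =
          (ν ^ (1 - β) * ρ ^ (2 - 2 * β)) * ρ ^ (2 * β) := by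
        rw [mul_assoc, ← Real.rpow_add hρ]; congr 2; ring
      rw [e1]
      refine mul_le_mul_of_nonneg_right ?_ (by positivity)
      have e2 : (ν ^ (1 - β) * ρ ^ (2 - 2 * β)) * (ν ^ (β - 1) *
          ρ ^ (((2 : ℕ) : ℝ) * (β - 1))) = 1 := by
        rw [mul_mul_mul_comm, ← Real.rpow_add hν, ← Real.rpow_add hρ]
        rw [show 1 - β + (β - 1) = 0 by ring,
          show 2 - 2 * β + ((2 : ℕ) : ℝ) * (β - 1) = 0 by push_cast; ring]
        simp
      calc s ^ (β - 1) = (ν ^ (1 - β) * ρ ^ (2 - 2 * β)) * (s ^ (β - 1) * (ν ^ (β - 1) *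
          ρ ^ (((2 : ℕ) : ℝ) * (β - 1)))) := by rw [mul_left_comm, e2, mul_one]
        _ ≤ (ν ^ (1 - β) * ρ ^ (2 - 2 * β)) * 1 := by gcongr
        _ = _ := mul_one _
  have hstep : ∀ s ∈ Set.Ioo 0 t, ENNReal.ofReal (s ^ (β - 1)) * energy (wt (p + 2 * β)) (u s) ≤
      (∫⁻ ξ, k (s, ξ) ∂μ) + ENNReal.ofReal (ν ^ (1 - β)) * energy (wt (p + 2)) (u s) := by
    intro s hs
    have hum := hu s (Set.Ioo_subset_Icc_self hs)
    have hfm : AEMeasurable fun ξ => wt p ξ * nsq (u s ξ) :=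
      (measurable_wt p).aemeasurable.mul hum.nsq
    have hks : Measurable fun ξ => k (s, ξ) := hkm.comp measurable_prodMk_left
    refine le_trans ?_ (add_le_add (lintegral_mono' (hle s (Set.Ioo_subset_Icc_self hs)) le_rfl)
      le_rfl)
    rw [lintegral_withDensity_eq_lintegral_mul₀ hfm hks.aemeasurable, energy, energy,
      ← lintegral_const_mul' _ _ ENNReal.ofReal_ne_top,
      ← lintegral_const_mul' _ _ ENNReal.ofReal_ne_top, ← lintegral_add_left'
        (hfm.mul hks.aemeasurable)]
    refine lintegral_mono_ae ?_
    filter_upwards [ae_ne_zero] with ξ hξ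
    simp only [Pi.mul_apply]
    calc ENNReal.ofReal (s ^ (β - 1)) * (wt (p + 2 * β) ξ * nsq (u s ξ))
        = (ENNReal.ofReal (s ^ (β - 1)) * wt (2 * β) ξ) * (wt p ξ * nsq (u s ξ)) := by
          rw [wt_add hξ]; ring
      _ ≤ (k (s, ξ) + ENNReal.ofReal (ν ^ (1 - β)) * wt 2 ξ) * (wt p ξ * nsq (u s ξ)) := by
          gcongr
          exact hpt s hs.1 ξ hξ
      _ = _ := by rw [wt_add hξ]; ring
  -- Because `μ` does not depend on time, Tonelli allows integrating in time first. With `ρ =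
  -- |2πξ|`, the integral of `s^(β-1) ρ^(2β)` over `0 < s < 1/(ν ρ²)` equals `ν^(-β) / β` at every
  -- nonzero frequency.
  have hkint : ∫⁻ s in Set.Ioo 0 t, ∫⁻ ξ, k (s, ξ) ∂μ ≤
      ENNReal.ofReal (ν ^ (-β)) * (ENNReal.ofReal (1 / β) * mass (wt p) t u N) := by
    rw [lintegral_lintegral_swap (f := fun s ξ => k (s, ξ)) hkm.aemeasurable, ← hμ, ← mul_assoc,
      ← lintegral_const]
    refine lintegral_mono fun ξ => ?_
    by_cases hξ : ξ = 0
    · have : ∀ s, k (s, ξ) = 0 := fun s => by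
        have h0 : wt (2 * β) ξ = 0 := by
          rw [wt, hξ, norm_zero, mul_zero, Real.zero_rpow (by linarith), ENNReal.ofReal_zero]
        simp only [hk, Set.indicator_apply, h0, mul_zero, ite_self]
      simp [this]
    have hρ := two_pi_norm_pos hξ
    set ρ := 2 * Real.pi * ‖ξ‖ with hρd
    set L := (ν * ρ ^ 2)⁻¹ with hL
    have hL0 : 0 < L := by positivity
    calc ∫⁻ s in Set.Ioo 0 t, k (s, ξ)
        ≤ ∫⁻ s in Set.Ioi 0, k (s, ξ) := lintegral_mono_set Set.Ioo_subset_Ioi_self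
      _ ≤ ∫⁻ s in Set.Ioi 0, (Set.Ioo 0 L).indicator
          (fun s => ENNReal.ofReal (s ^ (β - 1)) * wt (2 * β) ξ) s := by
          refine setLIntegral_mono' measurableSet_Ioi fun s hs => ?_
          by_cases h : (s, ξ) ∈ S
          · have hsL : s ∈ Set.Ioo 0 L := by
              refine ⟨hs, ?_⟩
              rw [hL, lt_inv_comm₀ hs (by positivity), ← one_div, lt_div_iff₀ hs, mul_comm]
              exact h
            rw [hk, Set.indicator_of_mem h, Set.indicator_of_mem hsL]
          · rw [hk, Set.indicator_of_notMem h]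
            exact zero_le
      _ ≤ ∫⁻ s, (Set.Ioo 0 L).indicator
          (fun s => ENNReal.ofReal (s ^ (β - 1)) * wt (2 * β) ξ) s :=
          setLIntegral_le_lintegral _ _
      _ = ENNReal.ofReal (L ^ β / β) * wt (2 * β) ξ := by
          rw [lintegral_indicator measurableSet_Ioo, lintegral_mul_const' _ _ (wt_ne_top _ _),
            lintegral_Ioo_rpow hβ hL0.le]
      _ = _ := by
          rw [wt, ← hρd, ← ENNReal.ofReal_mul (by positivity), ← ENNReal.ofReal_mul (by positivity)]
          congr 1
          rw [hL, Real.inv_rpow (by positivity), Real.mul_rpow hν.le (by positivity),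
            ← Real.rpow_natCast ρ 2, ← Real.rpow_mul hρ.le, Real.rpow_neg hν.le]
          push_cast
          have : ρ ^ (2 * β) ≠ 0 := (Real.rpow_pos_of_pos hρ _).ne'
          field_simp
  have hem : AEMeasurable (fun s => ENNReal.ofReal (ν ^ (1 - β)) * energy (wt (p + 2)) (u s))
      (volume.restrict (Set.Ioo 0 t)) :=
    (H.left.aemeasurable_energy (locBdd_wt _) le_rfl).const_mul _
  refine (setLIntegral_mono' measurableSet_Ioo hstep).trans ?_
  rw [lintegral_add_right' _ hem, lintegral_const_mul' _ _ ENNReal.ofReal_ne_top, mul_add]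
  refine add_le_add hkint (le_of_eq ?_)
  rw [← mul_assoc, ← ENNReal.ofReal_mul (by positivity)]
  congr 2
  rw [sub_eq_neg_add, Real.rpow_add hν, Real.rpow_one]

/-! ### Estimates of quadratic forcing terms -/

theorem exists_low_bound {d β : ℝ} (hd : 0 ≤ d) (hd1 : d < 1) (hβ : 0 < β) (hβ1 : β < 1) :
    ∃ c : ℝ≥0, ∀ {ν t : ℝ} {u N : ℝ → R3 → Fin 4 → ℂ}, QuadEvol ν t u N →
    energy (wt (1 + 2 * d)) (u 0) ≠ ∞ →
    ∫⁻ s in Set.Ioo 0 t, ENNReal.ofReal (s ^ (β - 1)) * energy (wt (1 + 2 * d + 2 * β)) (u s) ≤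
      ENNReal.ofReal (ν ^ (-β)) *
        (eb (expo ν t u) c * energy (wt (1 + 2 * d)) (u 0)) := by
  obtain ⟨c, hc⟩ := exists_level_bound hd hd1
  obtain ⟨c', hc'⟩ := exists_mass_le hd hd1
  refine ⟨((1 / β).toNNReal + 1) * (c' + 1) + c, fun {ν t u N} H hE => ?_⟩
  have hx := expo_nonneg (t := t) H.ν_pos u
  have hm := hc' H
  have hfin : mass (wt (1 + 2 * d)) t u N ≠ ∞ :=
    ne_top_of_le_ne_top (ENNReal.mul_ne_top (eb_ne_top _ _) hE) hm
  refine (H.diss.low_estimate H.ν_pos H.cont.meas hβ hβ1 hfin).trans ?_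
  gcongr
  have h2 := (hc H).2
  rw [show 1 + 2 * d + 2 = 3 + 2 * d by ring]
  calc _ ≤ ENNReal.ofReal (1 / β) * (eb (expo ν t u) c' * energy (wt (1 + 2 * d)) (u 0)) +
        eb (expo ν t u) c * energy (wt (1 + 2 * d)) (u 0) := by gcongr
    _ = (((1 / β).toNNReal : ℝ≥0∞) * eb (expo ν t u) c' + eb (expo ν t u) c) *
        energy (wt (1 + 2 * d)) (u 0) := by
        rw [ENNReal.ofReal]; ring
    _ ≤ _ := by
        gcongr
        exact (add_le_add (coe_mul_eb_le hx _ _) le_rfl).trans (eb_add_le hx _ _)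

/-- The energy inequality at level `1/2 + d + γ` is multiplied by `s^γ`: the initial value
disappears, and the remaining integral with `s^(γ-1)` is the low frequency bound with `β = γ`. The
choice `γ = (1 - d)/2` puts the dissipation at `Ḣ^{2+d/2}`. -/
theorem exists_high_bound {d : ℝ} (hd : 0 ≤ d) (hd1 : d < 1) :
    ∃ c : ℝ≥0, ∀ {ν t : ℝ} {u N : ℝ → R3 → Fin 4 → ℂ}, QuadEvol ν t u N →
    energy (wt (1 + 2 * d)) (u 0) ≠ ∞ →
    ∫⁻ s in Set.Ioo 0 t, ENNReal.ofReal (s ^ ((1 - d) / 2)) * energy (wt (4 + d)) (u s) ≤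
      ENNReal.ofReal (ν ^ (-(1 + (1 - d) / 2))) *
        (eb (expo ν t u) c * energy (wt (1 + 2 * d)) (u 0)) := by
  set γ := (1 - d) / 2 with hγ
  have hγ0 : 0 < γ := by rw [hγ]; linarith
  obtain ⟨c, hc⟩ := exists_low_bound hd hd1 hγ0 (by rw [hγ]; linarith)
  obtain ⟨c', hc'⟩ := exists_sobolev_bound (e := d + γ) (by linarith) (by rw [hγ]; linarith)
  refine ⟨((2 * γ.toNNReal) + 1) * ((c' + 1 + 1) * (c + 1) + 1), fun {ν t u N} H hE => ?_⟩
  have hν := H.ν_pos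
  set x := expo ν t u with hxd
  have hx : 0 ≤ x := expo_nonneg hν u
  have h1 := hc H hE
  have h2 := le_add_self.trans (hc' H hγ0.le t ⟨H.t_nonneg, le_rfl⟩)
  rw [Real.zero_rpow hγ0.ne', ENNReal.ofReal_zero, zero_mul, zero_add,
    show 1 + 2 * (d + γ) = 1 + 2 * d + 2 * γ by ring,
    show 3 + 2 * (d + γ) = 4 + d by rw [hγ]; ring] at h2
  set I := ∫⁻ s in Set.Ioo 0 t, ENNReal.ofReal (s ^ γ) * energy (wt (4 + d)) (u s) with hI
  set E := energy (wt (1 + 2 * d)) (u 0) with hEd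
  have h3 : ENNReal.ofReal ν * I ≤ ENNReal.ofReal (ν ^ (-γ)) *
      (eb x (((2 * γ.toNNReal) + 1) * ((c' + 1 + 1) * (c + 1) + 1)) * E) := by
    calc ENNReal.ofReal ν * I ≤ 2 * ENNReal.ofReal (Real.exp (c' * x)) * (ENNReal.ofReal γ *
          (ENNReal.ofReal (ν ^ (-γ)) * (eb x c * E))) := h2.trans (by gcongr)
      _ ≤ 2 * eb x (c' + 1) * (ENNReal.ofReal γ * (ENNReal.ofReal (ν ^ (-γ)) * (eb x c * E))) := by
          gcongr
          exact ofReal_exp_le_eb hx _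
      _ = ENNReal.ofReal (ν ^ (-γ)) * ((((2 * γ.toNNReal : ℝ≥0) : ℝ≥0∞) *
          (eb x (c' + 1) * eb x c)) * E) := by
          rw [ENNReal.ofReal, ENNReal.ofReal]; push_cast; ring
      _ ≤ _ := by
          gcongr
          exact (mul_le_mul_right (eb_mul_le hx _ _) _).trans (coe_mul_eb_le hx _ _)
  calc I = ENNReal.ofReal (ν⁻¹) * (ENNReal.ofReal ν * I) := by
        rw [← mul_assoc, ← ENNReal.ofReal_mul (by positivity), inv_mul_cancel₀ hν.ne',
          ENNReal.ofReal_one, one_mul]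
    _ ≤ ENNReal.ofReal (ν⁻¹) * (ENNReal.ofReal (ν ^ (-γ)) *
        (eb x (((2 * γ.toNNReal) + 1) * ((c' + 1 + 1) * (c + 1) + 1)) * E)) := by gcongr
    _ = _ := by
        rw [← mul_assoc, ← ENNReal.ofReal_mul (by positivity), neg_add, Real.rpow_add hν,
          Real.rpow_neg_one]

/-- Interpolation between homogeneous Sobolev norms. -/
theorem energy_interp {g : R3 → Fin 4 → ℂ} (hg : CompMeas g) {a b θ : ℝ} (h0 : 0 ≤ θ)
    (h1 : θ ≤ 1) : energy (wt (θ * a + (1 - θ) * b)) g ≤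
      energy (wt a) g ^ θ * energy (wt b) g ^ (1 - θ) := by
  refine le_trans (le_of_eq ?_) (ENNReal.lintegral_mul_norm_pow_le
    ((measurable_wt a).aemeasurable.mul hg.nsq) ((measurable_wt b).aemeasurable.mul hg.nsq) h0
    (sub_nonneg.2 h1) (by ring))
  refine lintegral_congr_ae ?_
  filter_upwards [ae_ne_zero] with ξ hξ
  have h2 : 0 ≤ 1 - θ := sub_nonneg.2 h1
  simp only [Pi.mul_apply]
  rw [ENNReal.mul_rpow_of_nonneg _ _ h0, ENNReal.mul_rpow_of_nonneg _ _ h2, wt_rpow _ h0,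
    wt_rpow _ h2, mul_mul_mul_comm, ← ENNReal.rpow_add_of_nonneg _ _ h0 h2, ← wt_add hξ,
    mul_comm a, mul_comm b]
  simp

/-- The forcing `G` is quadratic in `u`. -/
def QuadBound (t : ℝ) (u G : ℝ → R3 → Fin 4 → ℂ) : Prop :=
  ∀ τ ∈ Set.Icc 0 t, ∀ᵐ ξ, nsq (G τ ξ) ≤
    36 * (wt 1 ξ * convE (fun ξ => amp (u τ ξ)) (fun ξ => amp (u τ ξ)) ξ) ^ 2

/-- The index is `s + s' - 3/2` for the product, minus one for the derivative. -/
theorem exists_quadBound_energy_le {s s' : ℝ} (hs0 : 0 ≤ s) (hs : s < 3 / 2) (hs' : 0 < s') :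
    ∃ C : ℝ≥0, ∀ {t : ℝ} {u G : ℝ → R3 → Fin 4 → ℂ}, QuadBound t u G →
    ∀ τ ∈ Set.Icc 0 t, CompMeas (u τ) → energy (wt (2 * (s + s' - 5 / 2))) (G τ) ≤
      C * (energy (wt (2 * s)) (u τ) * energy (wt (2 * s')) (u τ)) := by
  obtain ⟨C, hC⟩ := exists_convE_power (c := s + s' - 3 / 2) hs0 hs hs' (by ring)
  refine ⟨36 * (2 * C), fun {t u G} hG τ hτ hu => ?_⟩
  have h1 := energy_wt_eq_of_le (c := s + s' - 5 / 2) (hG τ hτ)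
  rw [show s + s' - 5 / 2 + 1 = s + s' - 3 / 2 by ring] at h1
  refine h1.trans ?_
  have h2 := hC _ _ hu.amp hu.amp
  rw [lintegral_wt_mul_amp_sq, lintegral_wt_mul_amp_sq] at h2
  refine (mul_le_mul_right h2 _).trans (le_of_eq ?_)
  push_cast
  ring

/-- The bound is proved at `r = ∞` and at `r₀ = 1 / (1 - d/2)`, then interpolated. At `r₀` the
target index `-3/2 + 2/r₀ + 2d` is `1/2 + d`. -/
theorem exists_force_bound {d : ℝ} (hd : 0 ≤ d) (hd1 : d < 1) :
    ∃ c : ℝ≥0, ∀ {ν t : ℝ} {u N G : ℝ → R3 → Fin 4 → ℂ}, QuadEvol ν t u N →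
    energy (wt (1 + 2 * d)) (u 0) ≠ ∞ → QuadBound t u G → (∀ τ ∈ Set.Icc 0 t, CompMeas (G τ)) →
    ∀ r : ℝ≥0∞, ENNReal.ofReal (1 / (1 - d / 2)) < r →
    eLpNorm (fun τ => hNormHat (-3 / 2 + 2 * (r⁻¹).toReal + 2 * d) (G τ)) r
        (volume.restrict (Set.Ioo 0 t)) ≤
      ENNReal.ofReal (ν ^ (-(r⁻¹).toReal)) *
        (eb (expo ν t u) c * energy (wt (1 + 2 * d)) (u 0)) := by
  obtain ⟨c₁, hc₁⟩ := exists_level_bound hd hd1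
  obtain ⟨c₂, hc₂⟩ := exists_low_bound hd hd1 (β := 1 / 2) (by norm_num) (by norm_num)
  obtain ⟨c₃, hc₃⟩ := exists_high_bound hd hd1
  obtain ⟨C₁, hC₁⟩ := exists_quadBound_energy_le (s := 1 / 2 + d) (s' := 1 / 2 + d)
    (by linarith) (by linarith) (by linarith)
  -- These indices put the forcing in `Ḣ^{1/2+d}`. The second is the level of the high bound; the
  -- first is below `3/2` because `d < 1`, and is reached by interpolating `Ḣ^{1/2+d}` with
  -- `Ḣ^{1+d}`.
  obtain ⟨C₂, hC₂⟩ := exists_quadBound_energy_le (s := 1 + d / 2) (s' := 2 + d / 2)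
    (by linarith) (by linarith) (by linarith)
  set K : ℝ≥0 := C₁ + C₂ + 1 with hK
  have hK1 : 1 ≤ K := le_add_self
  have hKsq : K ≤ K ^ 2 := le_self_pow hK1 two_ne_zero
  have hCK₁ : C₁ ≤ K ^ 2 := le_trans (by rw [hK, add_assoc]; exact le_self_add) hKsq
  have hCK₂ : C₂ ≤ K ^ 2 :=
    le_trans (by rw [hK, add_comm C₁, add_assoc]; exact le_self_add) hKsq
  set c := c₁ + c₂ + c₃ with hcd
  refine ⟨(K + 1) * (c + 1), fun {ν t u N G} H hE hG hGm r hr => ?_⟩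
  have hν := H.ν_pos
  set x := expo ν t u with hxd
  have hx : 0 ≤ x := expo_nonneg hν u
  set E := energy (wt (1 + 2 * d)) (u 0) with hEd
  set Y := eb x c * E with hY
  have hYle : ∀ c', c' ≤ c → eb x c' * E ≤ Y := fun c' h => mul_le_mul_left (eb_mono hx h) _
  have hsub : ∀ s ∈ Set.Ioo 0 t, s ∈ Set.Icc 0 t := fun s hs => Set.Ioo_subset_Icc_self hs
  have b₁ : ∀ s ∈ Set.Icc 0 t, energy (wt (1 + 2 * d)) (u s) ≤ Y := fun s hs =>
    ((hc₁ H).1 s hs).trans (hYle c₁ (by rw [hcd, add_assoc]; exact le_self_add))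
  have b₂ := (hc₂ H hE).trans (mul_le_mul_right (hYle c₂ (by
    rw [hcd, add_comm c₁, add_assoc]; exact le_self_add)) _)
  have b₃ := (hc₃ H hE).trans (mul_le_mul_right (hYle c₃ (by rw [hcd]; exact le_add_self)) _)
  have hsup : ∀ s ∈ Set.Icc 0 t, energy (wt (2 * (-3 / 2 + 2 * d))) (G s) ≤ (K * Y) ^ 2 := by
    intro s hs
    have h := hC₁ hG s hs (H.cont.meas s hs)
    rw [show 1 / 2 + d + (1 / 2 + d) - 5 / 2 = -3 / 2 + 2 * d by ring,
      show 2 * (1 / 2 + d) = 1 + 2 * d by ring] at h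
    calc _ ≤ (C₁ : ℝ≥0∞) * (energy (wt (1 + 2 * d)) (u s) * energy (wt (1 + 2 * d)) (u s)) := h
      _ ≤ ((K ^ 2 : ℝ≥0) : ℝ≥0∞) * (Y * Y) := by gcongr <;> exact b₁ s hs
      _ = (K * Y) ^ 2 := by push_cast; ring
  have hfinal : ENNReal.ofReal (ν ^ (-(r⁻¹).toReal)) * (K * Y) ≤
      ENNReal.ofReal (ν ^ (-(r⁻¹).toReal)) * (eb x ((K + 1) * (c + 1)) * E) := by
    refine mul_le_mul_right ?_ _
    rw [hY, ← mul_assoc]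
    exact mul_le_mul_left (coe_mul_eb_le hx _ _) _
  refine le_trans ?_ hfinal
  rcases eq_or_ne r ∞ with rfl | hrt
  · simp only [ENNReal.inv_top, ENNReal.toReal_zero, mul_zero, add_zero, neg_zero, Real.rpow_zero,
      ENNReal.ofReal_one, one_mul, eLpNorm_exponent_top]
    refine eLpNormEssSup_le_of_ae_enorm_bound ?_
    refine (ae_restrict_mem measurableSet_Ioo).mono fun s hs => ?_
    rw [enorm_eq_self, hNormHat_eq]
    refine (ENNReal.rpow_le_rpow (hsup s (hsub s hs)) (by norm_num)).trans (le_of_eq ?_)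
    rw [← ENNReal.rpow_natCast, ← ENNReal.rpow_mul]
    norm_num
  set r₀ := 1 / (1 - d / 2) with hr₀
  have hd2 : 0 < 1 - d / 2 := by linarith
  have hr₀0 : 0 < r₀ := by positivity
  set R := r.toReal with hR
  have hrR : r = ENNReal.ofReal R := (ENNReal.ofReal_toReal hrt).symm
  have hR0 : r₀ < R := by
    rw [hrR] at hr
    exact (ENNReal.ofReal_lt_ofReal_iff_of_nonneg hr₀0.le).1 hr
  have hRpos : 0 < R := hr₀0.trans hR0
  have hrinv : (r⁻¹).toReal = R⁻¹ := ENNReal.toReal_inv r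
  have hr0 : r ≠ 0 := (zero_le.trans_lt hr).ne'
  rw [hrinv, eLpNorm_eq_lintegral_rpow_enorm_toReal hr0 hrt, ← hR]
  simp only [enorm_eq_self]
  have hVm : AEMeasurable (fun s => ENNReal.ofReal (s ^ ((1 / 2 : ℝ) - 1)) *
      energy (wt (1 + 2 * d + 2 * (1 / 2))) (u s)) (volume.restrict (Set.Ioo 0 t)) :=
    AEMeasurable.mul (by fun_prop) (H.cont.vCont.aemeasurable_energy (locBdd_wt _) le_rfl)
  have hQm : AEMeasurable (fun s => ENNReal.ofReal (s ^ ((1 - d) / 2)) *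
      energy (wt (4 + d)) (u s)) (volume.restrict (Set.Ioo 0 t)) :=
    AEMeasurable.mul (by fun_prop) (H.cont.vCont.aemeasurable_energy (locBdd_wt _) le_rfl)
  -- Hölder exponents in time for the low and the high bound. Their sum is `r₀ (1 - d/2)`, so the
  -- requirement that it be one determines `r₀`.
  set θ₁ := (1 - d) * r₀ / 2 with hθ₁
  set θ₂ := r₀ / 2 with hθ₂
  have hr₀d : r₀ * (1 - d / 2) = 1 := one_div_mul_cancel hd2.ne'
  have hθ₁0 : 0 ≤ θ₁ := by
    have : 0 ≤ 1 - d := by linarith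
    positivity
  have hθ₂0 : 0 ≤ θ₂ := by positivity
  have hθ : θ₁ + θ₂ = 1 := by rw [hθ₁, hθ₂]; linarith
  have hX : ∀ s ∈ Set.Ioo 0 t, energy (wt (1 + 2 * d)) (G s) ^ (r₀ / 2) ≤
      ((K : ℝ≥0∞) ^ r₀ * Y ^ (d * r₀ / 2)) *
        ((ENNReal.ofReal (s ^ ((1 / 2 : ℝ) - 1)) *
          energy (wt (1 + 2 * d + 2 * (1 / 2))) (u s)) ^ θ₁ *
        (ENNReal.ofReal (s ^ ((1 - d) / 2)) * energy (wt (4 + d)) (u s)) ^ θ₂) := by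
    intro s hs
    have hum := H.cont.meas s (hsub s hs)
    have h := hC₂ hG s (hsub s hs) hum
    rw [show 2 * (1 + d / 2 + (2 + d / 2) - 5 / 2) = 1 + 2 * d by ring,
      show 2 * (1 + d / 2) = d * (1 + 2 * d) + (1 - d) * (1 + 2 * d + 2 * (1 / 2)) by ring,
      show 2 * (2 + d / 2) = 4 + d by ring] at h
    have h2 := energy_interp hum (a := 1 + 2 * d) (b := 1 + 2 * d + 2 * (1 / 2)) hd hd1.le
    set V := energy (wt (1 + 2 * d + 2 * (1 / 2))) (u s)
    set Q := energy (wt (4 + d)) (u s)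
    have h3 : energy (wt (1 + 2 * d)) (G s) ≤
        ((K : ℝ≥0∞) ^ 2 * Y ^ d) * (V ^ (1 - d) * Q) := by
      calc _ ≤ _ := h
        _ ≤ ((K ^ 2 : ℝ≥0) : ℝ≥0∞) * ((Y ^ d * V ^ (1 - d)) * Q) := by
            gcongr
            refine h2.trans ?_
            gcongr
            exact b₁ s (hsub s hs)
        _ = _ := by push_cast; ring
    refine (ENNReal.rpow_le_rpow h3 hθ₂0).trans (le_of_eq ?_)
    rw [ENNReal.mul_rpow_of_nonneg _ _ hθ₂0, ENNReal.mul_rpow_of_nonneg _ _ hθ₂0,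
      ENNReal.mul_rpow_of_nonneg _ _ hθ₂0, ENNReal.mul_rpow_of_nonneg _ _ hθ₁0,
      ENNReal.mul_rpow_of_nonneg _ _ hθ₂0, ← ENNReal.rpow_natCast, ← ENNReal.rpow_mul,
      ← ENNReal.rpow_mul, ← ENNReal.rpow_mul]
    -- The negative power of time in the low bound and the positive one in the high bound cancel
    -- exactly.
    have e1 : ENNReal.ofReal (s ^ ((1 / 2 : ℝ) - 1)) ^ θ₁ *
        ENNReal.ofReal (s ^ ((1 - d) / 2)) ^ θ₂ = 1 := by
      have hs0 := hs.1
      rw [ENNReal.ofReal_rpow_of_nonneg (by positivity) hθ₁0,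
        ENNReal.ofReal_rpow_of_nonneg (by positivity) hθ₂0, ← ENNReal.ofReal_mul (by positivity),
        ← Real.rpow_mul hs0.le, ← Real.rpow_mul hs0.le, ← Real.rpow_add hs0,
        show ((1 / 2 : ℝ) - 1) * θ₁ + (1 - d) / 2 * θ₂ = 0 by rw [hθ₁, hθ₂]; ring]
      simp
    rw [show ((2 : ℕ) : ℝ) * θ₂ = r₀ by rw [hθ₂]; push_cast; ring,
      show d * θ₂ = d * r₀ / 2 by rw [hθ₂]; ring,
      show (1 - d) * θ₂ = θ₁ by rw [hθ₁, hθ₂]; ring, mul_mul_mul_comm (ENNReal.ofReal _ ^ θ₁), e1,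
      one_mul]
  have hXint : ∫⁻ s in Set.Ioo 0 t, energy (wt (1 + 2 * d)) (G s) ^ (r₀ / 2) ≤
      (K * Y) ^ r₀ * ENNReal.ofReal (ν⁻¹) := by
    refine (setLIntegral_mono' measurableSet_Ioo hX).trans ?_
    have hKY : (K : ℝ≥0∞) ^ r₀ * Y ^ (d * r₀ / 2) ≠ ∞ := by
      refine ENNReal.mul_ne_top (ENNReal.rpow_ne_top_of_nonneg hr₀0.le ENNReal.coe_ne_top)
        (ENNReal.rpow_ne_top_of_nonneg (by positivity)
          (ENNReal.mul_ne_top (eb_ne_top _ _) hE))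
    rw [lintegral_const_mul' _ _ hKY]
    refine (mul_le_mul_right ((ENNReal.lintegral_mul_norm_pow_le hVm hQm hθ₁0 hθ₂0 hθ).trans
      (mul_le_mul' (ENNReal.rpow_le_rpow b₂ hθ₁0) (ENNReal.rpow_le_rpow b₃ hθ₂0))) _).trans
      (le_of_eq ?_)
    rw [ENNReal.mul_rpow_of_nonneg _ _ hθ₁0, ENNReal.mul_rpow_of_nonneg _ _ hθ₂0,
      ENNReal.mul_rpow_of_nonneg _ _ hr₀0.le, mul_mul_mul_comm (ENNReal.ofReal _ ^ θ₁),
      ← ENNReal.rpow_add_of_nonneg _ _ hθ₁0 hθ₂0, hθ,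
      ENNReal.ofReal_rpow_of_nonneg (by positivity) hθ₁0,
      ENNReal.ofReal_rpow_of_nonneg (by positivity) hθ₂0, ← ENNReal.ofReal_mul (by positivity),
      ← Real.rpow_mul hν.le, ← Real.rpow_mul hν.le, ← Real.rpow_add hν,
      show -(1 / 2) * θ₁ + -(1 + (1 - d) / 2) * θ₂ = -1 by
        rw [hθ₁, hθ₂]; linear_combination (-1 : ℝ) * hr₀d, Real.rpow_neg_one]
    have e2 : Y ^ r₀ = Y ^ (d * r₀ / 2) * Y ^ (1 : ℝ) := by
      rw [← ENNReal.rpow_add_of_nonneg _ _ (by positivity) zero_le_one]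
      congr 1
      linear_combination hr₀d
    rw [e2]
    ring
  -- Interpolation with parameter `r₀ / R` between the two ends; the supremum in time takes the
  -- remaining power `R - r₀`.
  have hpt : ∀ s ∈ Set.Ioo 0 t, hNormHat (-3 / 2 + 2 * R⁻¹ + 2 * d) (G s) ^ R ≤
      (K * Y) ^ (R - r₀) * energy (wt (1 + 2 * d)) (G s) ^ (r₀ / 2) := by
    intro s hs
    set θ := r₀ / R with hθd
    have hθ0 : 0 ≤ θ := by positivity
    have hθ1 : θ ≤ 1 := (div_le_one hRpos).2 hR0.le
    have h := energy_interp (hGm s (hsub s hs)) (a := 1 + 2 * d) (b := 2 * (-3 / 2 + 2 * d)) hθ0 hθ1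
    have e1 : θ * (1 + 2 * d) + (1 - θ) * (2 * (-3 / 2 + 2 * d)) =
        2 * (-3 / 2 + 2 * R⁻¹ + 2 * d) := by
      rw [hθd]
      field_simp
      linear_combination 4 * hr₀d
    rw [e1] at h
    rw [hNormHat_eq, ← ENNReal.rpow_mul]
    refine (ENNReal.rpow_le_rpow (h.trans (mul_le_mul_right (ENNReal.rpow_le_rpow
      (hsup s (hsub s hs)) (sub_nonneg.2 hθ1)) _)) (by positivity)).trans (le_of_eq ?_)
    rw [ENNReal.mul_rpow_of_nonneg _ _ (by positivity), ← ENNReal.rpow_mul, ← ENNReal.rpow_mul,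
      ← ENNReal.rpow_natCast, ← ENNReal.rpow_mul, mul_comm]
    congr 2
    · push_cast
      rw [hθd]
      field_simp
    · rw [hθd]
      field_simp
  have hKY' : ((K : ℝ≥0∞) * Y) ^ (R - r₀) ≠ ∞ :=
    ENNReal.rpow_ne_top_of_nonneg (by linarith) (ENNReal.mul_ne_top ENNReal.coe_ne_top
      (ENNReal.mul_ne_top (eb_ne_top _ _) hE))
  have hlimInt : ∫⁻ s in Set.Ioo 0 t, hNormHat (-3 / 2 + 2 * R⁻¹ + 2 * d) (G s) ^ R ≤
      (K * Y) ^ R * ENNReal.ofReal (ν⁻¹) := by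
    refine (setLIntegral_mono' measurableSet_Ioo hpt).trans ?_
    rw [lintegral_const_mul' _ _ hKY']
    refine (mul_le_mul_right hXint _).trans (le_of_eq ?_)
    rw [← mul_assoc, ← ENNReal.rpow_add_of_nonneg _ _ (by linarith) hr₀0.le, sub_add_cancel]
  refine (ENNReal.rpow_le_rpow hlimInt (by positivity)).trans (le_of_eq ?_)
  rw [ENNReal.mul_rpow_of_nonneg _ _ (by positivity), ← ENNReal.rpow_mul,
    ENNReal.ofReal_rpow_of_nonneg (by positivity) (by positivity), mul_one_div_cancel hRpos.ne',
    ENNReal.rpow_one, Real.rpow_neg hν.le, Real.inv_rpow hν.le, one_div, mul_comm]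

/-! ### The linear system -/

theorem VCont.add {T : ℝ} {g h : ℝ → R3 → Fin 4 → ℂ} (hg : VCont T g) (hh : VCont T h) :
    VCont T fun t ξ => g t ξ + h t ξ := by
  simpa using hg.sub (hh.smul (-1))

theorem lineProj_add (q : Fin 4 → ℝ) (a b : Fin 4 → ℂ) :
    lineProj q (a + b) = lineProj q a + lineProj q b := by
  ext k
  simp only [lineProj, Pi.add_apply, mul_add, Finset.sum_add_distrib]
  ring

theorem lineProj_smul (q : Fin 4 → ℝ) (c : ℂ) (a : Fin 4 → ℂ) :
    lineProj q (c • a) = c • lineProj q a := by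
  ext k
  simp only [lineProj, Pi.smul_apply, smul_eq_mul, Finset.mul_sum, Finset.sum_mul]
  exact Finset.sum_congr rfl fun j _ => by ring

theorem lineProj_leray (ξ : R3) (a : Fin 4 → ℂ) : lineProj (gradDir ξ) (leray ξ a) = 0 := by
  have h := leray_leray ξ a
  rwa [leray_eq ξ (leray ξ a), sub_eq_self] at h

theorem amp_zero : amp 0 = 0 := by simp [amp, nsq]

theorem nsq_zero : nsq 0 = 0 := by simp [nsq]

theorem eq_zero_of_nsq {a : Fin 4 → ℂ} (h : nsq a = 0) : a = 0 := by
  ext k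
  have h1 := (Finset.sum_eq_zero_iff.1 h) k (Finset.mem_univ k)
  simpa using h1

theorem energy_eq_zero_of_ae {ω : R3 → ℝ≥0∞} {g : R3 → Fin 4 → ℂ} (h : ∀ᵐ ξ, g ξ = 0) :
    energy ω g = 0 := by
  rw [energy_congr (g' := fun _ => 0) h]
  simp [energy, nsq_zero]

/-- An unforced dissipative evolution starting from zero vanishes. -/
theorem DissEvol.ae_eq_zero {ν T : ℝ} (hν : 0 ≤ ν) {u : ℝ → R3 → Fin 4 → ℂ}
    (H : DissEvol ν T u fun _ _ => 0) (h0 : ∀ᵐ ξ, u 0 ξ = 0) {t : ℝ} (ht : t ∈ Set.Icc 0 T)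
    (hm : CompMeas (u t)) : ∀ᵐ ξ, u t ξ = 0 := by
  have h := H.energy_le_rpow hν (locBdd_wt 1) le_rfl ht
  simp only [Real.rpow_zero, ENNReal.ofReal_one, one_mul, ENNReal.ofReal_zero, zero_mul,
    add_zero, energy_eq_zero_of_ae h0, pairing, amp_zero, mul_zero, lintegral_zero] at h
  have h1 : energy (wt 1) (u t) = 0 := le_antisymm (le_self_add.trans h) zero_le
  rw [energy, lintegral_eq_zero_iff' (f := fun ξ => wt 1 ξ * nsq (u t ξ))
    ((measurable_wt 1).aemeasurable.mul hm.nsq)] at h1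
  filter_upwards [h1, ae_ne_zero] with ξ hξ hne
  simp only [Pi.zero_apply, mul_eq_zero, wt_ne_zero 1 hne, false_or] at hξ
  exact eq_zero_of_nsq hξ

/-- Energy estimate for a forced dissipative evolution starting from zero. -/
theorem DissEvol.energy_le_force {ν t : ℝ} (hν : 0 < ν) (ht : 0 ≤ t)
    {w G : ℝ → R3 → Fin 4 → ℂ} (H : DissEvol ν t w G) (hw : EnCont 1 t w)
    (hG : ∀ τ ∈ Set.Icc 0 t, CompMeas (G τ)) (h0 : ∀ᵐ ξ, w 0 ξ = 0) (s : ℝ) :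
    energy (wt (2 * s)) (w t) +
        ENNReal.ofReal ν * (∫⁻ τ in Set.Ioo 0 t, energy (wt (2 * (s + 1))) (w τ)) ≤
      ENNReal.ofReal (4 / ν) * ∫⁻ τ in Set.Ioo 0 t, energy (wt (2 * (s - 1))) (G τ) := by
  have htt : t ∈ Set.Icc 0 t := ⟨ht, le_rfl⟩
  have hlimInt := hw.vCont.tendsto_lintegral_annE (locBdd_wt (2 * (s + 1))) (le_refl t)
    (f := fun _ => 1) measurable_const fun _ => ENNReal.one_ne_top
  simp only [one_mul] at hlimInt
  refine le_of_tendsto ((tendsto_annE _ _).add (ENNReal.Tendsto.const_mul hlimInt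
    (Or.inr ENNReal.ofReal_ne_top))) (Eventually.of_forall fun n => ?_)
  have h1 := H.annulus_energy_le hν.le (locBdd_wt (2 * s)) n le_rfl htt
  have e1 : ∀ τ, annE (fun ξ => wt (2 * s) ξ * wt 2 ξ) n (w τ) =
      annE (wt (2 * (s + 1))) n (w τ) := fun τ => by
    refine setLIntegral_congr_fun (isOpen_annulus n).measurableSet fun ξ hξ => ?_
    simp only
    rw [← wt_add (ne_zero_of_mem_annulus hξ), mul_add, mul_one]
  have e0 : annE (wt (2 * s)) n (w 0) = 0 := by
    refine le_antisymm ((setLIntegral_le_lintegral _ _).trans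
      (energy_eq_zero_of_ae (ω := wt (2 * s)) h0).le) zero_le
  simp only [Real.rpow_zero, ENNReal.ofReal_one, one_mul, ENNReal.ofReal_zero, zero_mul,
    add_zero, e1, e0, zero_add] at h1
  set I := ∫⁻ τ in Set.Ioo 0 t, annE (wt (2 * (s + 1))) n (w τ) with hI
  -- The dissipation at level `s` is not known to be finite on the whole space. On an annulus it is
  -- bounded by the `Ḣ^{1/2}` norm, so it is absorbed there before the limit.
  have hIfin : ENNReal.ofReal ν * I ≠ ∞ := by
    refine ENNReal.mul_ne_top ENNReal.ofReal_ne_top ?_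
    obtain ⟨B, hB⟩ := hw.exists_bound
    obtain ⟨K, hK⟩ := (locBdd_wt (2 * s + 1)).bdd n
    have hb : ∀ τ ∈ Set.Ioo 0 t, annE (wt (2 * (s + 1))) n (w τ) ≤ K * B := fun τ hτ => by
      refine le_trans ?_ (mul_le_mul_right (hB τ (Set.Ioo_subset_Icc_self hτ)) _)
      rw [energy, ← lintegral_const_mul' _ _ ENNReal.coe_ne_top]
      refine le_trans ?_ (setLIntegral_le_lintegral (annulus n) _)
      refine setLIntegral_mono' (isOpen_annulus n).measurableSet fun ξ hξ => ?_
      rw [show 2 * (s + 1) = 2 * s + 1 + 1 by ring, wt_add (ne_zero_of_mem_annulus hξ), ← mul_assoc]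
      exact mul_le_mul_left (mul_le_mul_left (hK ξ hξ) _) _
    refine ne_top_of_le_ne_top ?_ (setLIntegral_mono' measurableSet_Ioo hb)
    rw [lintegral_const]
    exact ENNReal.mul_ne_top (ENNReal.mul_ne_top ENNReal.coe_ne_top ENNReal.coe_ne_top) (by simp)
  have hcs : ∀ τ ∈ Set.Ioo 0 t, 2 * annP (wt (2 * s)) n (w τ) (G τ) ≤
      ENNReal.ofReal ν * annE (wt (2 * (s + 1))) n (w τ) +
        ENNReal.ofReal (4 / ν) * energy (wt (2 * (s - 1))) (G τ) := by
    intro τ hτ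
    have hτ' := Set.Ioo_subset_Icc_self hτ
    refine (two_mul_le_of_sq_le hν ?_).trans (add_le_add le_rfl (mul_le_mul_right
      (setLIntegral_le_lintegral (annulus n) _) _))
    have h2 := lintegral_mul_sq_le (μ := volume.restrict (annulus n))
      (f := fun ξ => wt (s + 1) ξ * amp (w τ ξ)) (g := fun ξ => wt (s - 1) ξ * amp (G τ ξ))
      ((measurable_wt _).aemeasurable.mul (hw.meas τ hτ').amp.restrict)
      ((measurable_wt _).aemeasurable.mul (hG τ hτ').amp.restrict)
    refine le_trans (le_of_eq ?_) (h2.trans (le_of_eq ?_))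
    · congr 1
      refine setLIntegral_congr_fun (isOpen_annulus n).measurableSet fun ξ hξ => ?_
      rw [show 2 * s = (s + 1) + (s - 1) by ring, wt_add (ne_zero_of_mem_annulus hξ)]
      ring
    · simp only [mul_pow, wt_sq, amp_sq]
      rfl
  have hmE : AEMeasurable (fun τ => annE (wt (2 * (s + 1))) n (w τ))
      (volume.restrict (Set.Ioo 0 t)) :=
    ((hw.vCont.continuousOn_annE (locBdd_wt _) n).mono Set.Ioo_subset_Icc_self).aemeasurable
      measurableSet_Ioo
  have h3 : 2 * ∫⁻ τ in Set.Ioo 0 t, annP (wt (2 * s)) n (w τ) (G τ) ≤ ENNReal.ofReal ν * I +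
      ENNReal.ofReal (4 / ν) * ∫⁻ τ in Set.Ioo 0 t, energy (wt (2 * (s - 1))) (G τ) := by
    rw [← lintegral_const_mul' _ _ (by norm_num), hI,
      ← lintegral_const_mul' _ _ ENNReal.ofReal_ne_top,
      ← lintegral_const_mul' _ _ ENNReal.ofReal_ne_top, ← lintegral_add_left' (hmE.const_mul _)]
    exact setLIntegral_mono' measurableSet_Ioo hcs
  have h4 := h1.trans h3
  rw [two_mul ν, ENNReal.ofReal_add hν.le hν.le, add_mul, ← add_assoc,
    add_comm (ENNReal.ofReal ν * I) (_ * ∫⁻ τ in Set.Ioo 0 t, _)] at h4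
  exact (ENNReal.add_le_add_iff_right hIfin).1 h4

theorem fieldFt_zero_ae : ∀ᵐ ξ, fieldFt (0 : Field) ξ = 0 := by
  have hp : IsFourierPair (fun _ => ((0 : ℝ) : ℂ)) 0 := by
    refine ⟨fun φ => ?_, fun φ => ?_, fun φ => ?_⟩ <;> simp
  filter_upwards [hp.ft_ae_eq] with ξ hξ
  ext k
  exact hξ

section linear

variable {F ν ε : ℝ} {T : EReal} {U₀ : Field} {U W : ℝ → Field}

theorem IsInhSolution.hasFt (H : IsInhSolution F ν ε T U W) {t : ℝ} (ht : t ∈ timeInterval T) :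
    HasFt (W t) := hasFt_of_hNorm (H.cont.1 t ht)

theorem IsInhSolution.enCont (H : IsInhSolution F ν ε T U W) {t : ℝ} (ht : t ∈ timeInterval T) :
    EnCont 1 t fun τ => fieldFt (W τ) := EnCont.of_continuousInH H.cont ht

theorem IsInhSolution.fieldFt_init (H : IsInhSolution F ν ε T U W)
    (h0 : 0 ∈ timeInterval T) : ∀ᵐ ξ, fieldFt (W 0) ξ = 0 := by
  filter_upwards [((H.hasFt h0).congr H.init).2, fieldFt_zero_ae] with ξ h1 h2
  rw [← h1, h2]

/-- That `W` is divergence free is not assumed but deduced from the equation: both source terms lie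
in the range of `ℙ`. Only then does the skewness of `𝒜` remove the term in `ε⁻¹`. -/
theorem IsInhSolution.dissEvol (H : IsInhSolution F ν ε T U W) (hν : 0 ≤ ν)
    (hU : IsQGSolution F ν T U₀ U) {t : ℝ} (ht : t ∈ timeInterval T) :
    DissEvol ν t (fun τ => fieldFt (W τ)) fun τ => forceHat F (U τ) := by
  have h0 : 0 ∈ timeInterval T := Icc_subset_timeInterval ht ⟨le_rfl, ht.1⟩
  set w : ℝ → R3 → Fin 4 → ℂ := fun τ => fieldFt (W τ) with hw
  set M : ℝ → R3 → Fin 4 → ℂ := fun τ ξ =>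
    ((ε⁻¹ : ℝ) : ℂ) • leray ξ ((matA F).mulVec (w τ ξ)) + forceHat F (U τ) ξ with hM
  have hwc : VCont t w := (H.enCont ht).vCont
  have hGc := hU.vCont_force ht
  have hMc : VCont t M := ((hwc.mulVec _).leray.smul _).add hGc
  have hev := hwc.evol (ν := ν) hMc fun φ k τ hτ => by
    have e0 : ∫ ξ, φ ξ * w 0 ξ k = 0 := by
      have := H.eqn 0 h0 φ k
      rwa [intervalIntegral.integral_same] at this
    rw [e0, zero_add]
    refine (H.eqn τ (Icc_subset_timeInterval ht hτ) φ k).trans ?_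
    simp only [hM, Pi.add_apply, Pi.smul_apply, smul_eq_mul, Complex.ofReal_inv, sub_sub]
    rfl
  have hlin : ∀ (τ : ℝ) ξ k, ∑ j, lineMat gradDir k j ξ * (ν * lapSymb ξ * w τ ξ j - M τ ξ j) =
      ν * lapSymb ξ * lineProj (gradDir ξ) (w τ ξ) k - (0 : Fin 4 → ℂ) k := fun τ ξ k => by
    have e1 := sum_lineMat gradDir ξ ((ν * lapSymb ξ) • w τ ξ - M τ ξ) k
    have e2 : lineProj (gradDir ξ) (M τ ξ) = 0 := by
      simp only [hM]
      rw [lineProj_add, lineProj_smul, lineProj_leray, forceHat, lineProj_leray, smul_zero,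
        add_zero]
    rw [lineProj_sub, e2, lineProj_smul] at e1
    exact e1
  -- The gradient part of `W` obeys the heat equation without source, and it starts from zero, so it
  -- vanishes.
  have hV : DissEvol ν t (fun τ ξ => lineProj (gradDir ξ) (w τ ξ)) fun _ _ => 0 := by
    refine DissEvol.of_evol (M := fun _ _ => 0) (fun n k => ⟨fun _ _ => ?_, fun _ _ => ?_⟩)
      (fun n k => ?_) fun _ _ => ae_of_all _ fun _ => rfl
    · exact MemLp.zero
    · simpa using tendsto_const_nhds
    · have hb := bddSymb_lineMat measurable_gradDir
      have := L2Evol.sum fun j => (hev n j).bdd_mul (hb.meas k j).aestronglyMeasurable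
        (ae_of_all _ fun ξ => hb.bdd k j ξ)
      simp only [hlin, sum_lineMat] at this
      exact this
  have hdiv : ∀ τ ∈ Set.Icc 0 t, ∀ᵐ ξ, leray ξ (w τ ξ) = w τ ξ := by
    intro τ hτ
    have hz := hV.ae_eq_zero hν ?_ hτ
      (((H.enCont ht).meas τ hτ).lineProj measurable_gradDir)
    · filter_upwards [hz] with ξ hξ
      rw [leray_eq, hξ, sub_zero]
    · filter_upwards [H.fieldFt_init h0] with ξ hξ
      simp only [hw, hξ]
      ext k
      simp [lineProj]
  refine DissEvol.of_evol hGc hev fun τ hτ => ?_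
  filter_upwards [hdiv τ hτ] with ξ hξ
  have h1 := re_sum_conj_mul_leray_matA F ξ (w τ ξ) hξ
  have e : ∑ k, (starRingEnd ℂ) (w τ ξ k) * M τ ξ k =
      ((ε⁻¹ : ℝ) : ℂ) * (∑ k, (starRingEnd ℂ) (w τ ξ k) *
        leray ξ ((matA F).mulVec (w τ ξ)) k) +
      ∑ k, (starRingEnd ℂ) (w τ ξ k) * forceHat F (U τ) ξ k := by
    simp only [hM, Pi.add_apply, Pi.smul_apply, smul_eq_mul, mul_add, Finset.sum_add_distrib,
      Finset.mul_sum]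
    congr 1
    exact Finset.sum_congr rfl fun k _ => by ring
  rw [e, Complex.add_re, Complex.re_ofReal_mul, h1, mul_zero, zero_add]

theorem IsQGSolution.compMeas_adv (H : IsQGSolution F ν T U₀ U) {t : ℝ}
    (ht : t ∈ timeInterval T) {τ : ℝ} (hτ : τ ∈ Set.Icc 0 t) : CompMeas (advHat (U τ)) :=
  (H.hasFt (Icc_subset_timeInterval ht hτ)).advHat_compMeas ((H.enCont ht).fin τ hτ)

theorem IsQGSolution.compMeas_force (H : IsQGSolution F ν T U₀ U) {t : ℝ}
    (ht : t ∈ timeInterval T) {τ : ℝ} (hτ : τ ∈ Set.Icc 0 t) : CompMeas (forceHat F (U τ)) :=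
  ((H.compMeas_adv ht hτ).sub ((H.compMeas_adv ht hτ).projQG F)).leray

theorem IsQGSolution.lintegral_energy (H : IsQGSolution F ν T U₀ U) {t : ℝ}
    (ht : t ∈ timeInterval T) : ∫⁻ τ in Set.Ioo 0 t, energy (wt 3) (fieldFt (U τ)) =
      ∫⁻ τ in Set.Ioo 0 t, hNorm (3 / 2) (U τ) ^ 2 := by
  refine setLIntegral_congr_fun measurableSet_Ioo fun τ hτ => ?_
  rw [(H.hasFt (Icc_subset_timeInterval ht (Set.Ioo_subset_Icc_self hτ))).hNorm_sq]
  norm_num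

theorem IsQGSolution.quadEvol (H : IsQGSolution F ν T U₀ U) (hν : 0 < ν) {t : ℝ}
    (ht : t ∈ timeInterval T) :
    QuadEvol ν t (fun τ => fieldFt (U τ)) fun τ ξ => projQG F ξ (advHat (U τ) ξ) where
  ν_pos := hν
  t_nonneg := ht.1
  diss := H.dissEvol ht
  cont := H.enCont ht
  meas _ hτ := (H.compMeas_adv ht hτ).projQG F
  quad τ hτ := ((H.hasFt (Icc_subset_timeInterval ht hτ)).nsq_advHat_le
    ((H.enCont ht).fin τ hτ)).mono fun ξ hξ => (nsq_projQG_le F ξ _).trans hξ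
  fin := by rw [H.lintegral_energy ht]; exact (H.sq_int t ht).ne

theorem IsQGSolution.quadBound (H : IsQGSolution F ν T U₀ U) {t : ℝ} (ht : t ∈ timeInterval T) :
    QuadBound t (fun τ => fieldFt (U τ)) fun τ => forceHat F (U τ) := fun τ hτ =>
  ((H.hasFt (Icc_subset_timeInterval ht hτ)).nsq_advHat_le
    ((H.enCont ht).fin τ hτ)).mono fun ξ hξ => (nsq_leray_projOsc_le F ξ _).trans hξ

theorem IsQGSolution.expo_eq (H : IsQGSolution F ν T U₀ U) {t : ℝ} (ht : t ∈ timeInterval T) :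
    expo ν t (fun τ => fieldFt (U τ)) = bigC U t / ν := by
  rw [expo, H.lintegral_energy ht, bigC]

theorem IsQGSolution.energy_init (H : IsQGSolution F ν T U₀ U) (h0 : 0 ∈ timeInterval T)
    (d : ℝ) : energy (wt (1 + 2 * d)) (fieldFt (U 0)) = hNorm (1 / 2 + d) U₀ ^ 2 := by
  obtain ⟨h1, h2⟩ := (H.hasFt h0).congr H.init
  rw [h1.hNorm_sq, energy_congr h2, show 2 * (1 / 2 + d) = 1 + 2 * d by ring]

/-- The estimates of the forcing. -/
theorem exists_qg_force_bound {d : ℝ} (hd : 0 ≤ d) (hd1 : d < 1) :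
    ∃ c : ℝ≥0, ∀ {F ν : ℝ} {T : EReal} {U₀ : Field} {U : ℝ → Field}, 0 < ν →
    IsQGSolution F ν T U₀ U → hNorm (1 / 2 + d) U₀ < ∞ → ∀ {t : ℝ}, t ∈ timeInterval T →
    ∀ r : ℝ≥0∞, ENNReal.ofReal (1 / (1 - d / 2)) < r →
    AEMeasurable (fun τ => hNormHat (-3 / 2 + 2 * (r⁻¹).toReal + 2 * d) (forceHat F (U τ)))
      (volume.restrict (Set.Ioo 0 t)) ∧
    eLpNorm (fun τ => hNormHat (-3 / 2 + 2 * (r⁻¹).toReal + 2 * d) (forceHat F (U τ))) r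
        (volume.restrict (Set.Ioo 0 t)) ≤
      ENNReal.ofReal (ν ^ (-(r⁻¹).toReal)) *
        (eb (bigC U t / ν) c * hNorm (1 / 2 + d) U₀ ^ 2) := by
  obtain ⟨c, hc⟩ := exists_force_bound hd hd1
  refine ⟨c, fun {F ν T U₀ U} hν H hE t ht r hr => ⟨?_, ?_⟩⟩
  · simp only [hNormHat_eq]
    exact ((H.vCont_force ht).aemeasurable_energy (locBdd_wt _) le_rfl).pow_const _
  · have h0 : 0 ∈ timeInterval T := Icc_subset_timeInterval ht ⟨le_rfl, ht.1⟩
    have h := hc (H.quadEvol hν ht) (by rw [H.energy_init h0]; exact (ENNReal.pow_lt_top hE).ne)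
      (H.quadBound ht) (fun τ hτ => H.compMeas_force ht hτ) r hr
    rwa [H.expo_eq ht, H.energy_init h0] at h

theorem lintegral_energy_le_of_eLpNorm {g : ℝ → R3 → Fin 4 → ℂ} {σ : ℝ} {μ : Measure ℝ}
    {B : ℝ≥0∞} (h : eLpNorm (fun τ => hNormHat σ (g τ)) 2 μ ≤ B) :
    ∫⁻ τ, energy (wt (2 * σ)) (g τ) ∂μ ≤ B ^ 2 := by
  rw [eLpNorm_eq_lintegral_rpow_enorm_toReal two_ne_zero ENNReal.ofNat_ne_top] at h
  simp only [enorm_eq_self, ENNReal.toReal_ofNat, ENNReal.rpow_ofNat, hNormHat_sq] at h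
  have h1 := pow_le_pow_left₀ zero_le h 2
  rwa [← ENNReal.rpow_natCast, ← ENNReal.rpow_mul, show (1 / 2 : ℝ) * ((2 : ℕ) : ℝ) = 1 by norm_num,
    ENNReal.rpow_one] at h1

/-- An intermediate power is dominated by the lower one when its base is at most one and by the
higher one otherwise. Hence the two endpoint bounds on the forcing suffice for every `s`. -/
theorem wt_le_add {a b s : ℝ} (ha : a ≤ s) (hb : s ≤ b) {ξ : R3} (hξ : ξ ≠ 0) :
    wt s ξ ≤ wt a ξ + wt b ξ := by
  have hρ := two_pi_norm_pos hξ
  unfold wt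
  rcases le_total (2 * Real.pi * ‖ξ‖) 1 with h | h
  · exact le_add_of_le_of_nonneg
      (ENNReal.ofReal_le_ofReal (Real.rpow_le_rpow_of_exponent_ge hρ h ha)) zero_le
  · exact le_add_of_nonneg_of_le zero_le
      (ENNReal.ofReal_le_ofReal (Real.rpow_le_rpow_of_exponent_le h hb))

theorem energy_wt_le_add {a b s : ℝ} (ha : a ≤ s) (hb : s ≤ b) {g : R3 → Fin 4 → ℂ}
    (hg : CompMeas g) : energy (wt s) g ≤ energy (wt a) g + energy (wt b) g := by
  rw [energy, energy, energy, ← lintegral_add_left' (f := fun ξ => wt a ξ * nsq (g ξ))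
    ((measurable_wt a).aemeasurable.mul hg.nsq)]
  refine lintegral_mono_ae ?_
  filter_upwards [ae_ne_zero] with ξ hξ
  rw [← add_mul]
  exact mul_le_mul_left (wt_le_add ha hb hξ) _

theorem ofReal_rpow_neg_mul_eb_le {ν A ρ : ℝ} (hν : 0 < ν) (hA : 0 ≤ A) {c : ℝ≥0} {C : ℝ}
    (hc : c ≤ C) (E : ℝ≥0∞) : ENNReal.ofReal (ν ^ (-ρ)) * (eb (A / ν) c * E) ≤
      ENNReal.ofReal (C / ν ^ ρ) * E * ENNReal.ofReal (Real.exp (C / ν * A)) := by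
  have h1 : ENNReal.ofReal (Real.exp (c * (A / ν))) ≤ ENNReal.ofReal (Real.exp (C / ν * A)) := by
    refine ENNReal.ofReal_le_ofReal (Real.exp_le_exp.2 ?_)
    rw [div_mul_eq_mul_div, mul_div_assoc]
    gcongr
  have h2 : ENNReal.ofReal (ν ^ (-ρ)) * c ≤ ENNReal.ofReal (C / ν ^ ρ) := by
    rw [← ENNReal.ofReal_coe_nnreal, ← ENNReal.ofReal_mul (by positivity), Real.rpow_neg hν.le,
      inv_mul_eq_div]
    refine ENNReal.ofReal_le_ofReal ?_
    gcongr
  calc _ = (ENNReal.ofReal (ν ^ (-ρ)) * c) * E * ENNReal.ofReal (Real.exp (c * (A / ν))) := by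
        rw [eb]; ring
    _ ≤ _ := by gcongr

end linear

end QG

end

/-! ### Assembly of the estimates and choice of the constant. -/

theorem mainTheorem9 (δ : ℝ) (hδ : 0 < δ) (hδ1 : δ < 1) :
    ∃ C : ℝ, 0 < C ∧
      ∀ (F ν : ℝ) (T : EReal) (U₀ : QG.Field) (U : ℝ → QG.Field),
        0 < F → 0 < ν → 0 < T →
        QG.hNorm (1 / 2) U₀ < ∞ → QG.hNorm (1 / 2 + δ) U₀ < ∞ →
        QG.IsQGSolution F ν T U₀ U →
        ∀ t : ℝ, 0 ≤ t → (t : EReal) < T →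
          -- first estimate of the forcing
          (∀ r : ℝ≥0∞, 1 < r →
            AEMeasurable
              (fun τ => QG.hNormHat (-3 / 2 + 2 * (r⁻¹).toReal) (QG.forceHat F (U τ)))
              (volume.restrict (Set.Ioo 0 t)) ∧
            eLpNorm
              (fun τ => QG.hNormHat (-3 / 2 + 2 * (r⁻¹).toReal) (QG.forceHat F (U τ)))
              r (volume.restrict (Set.Ioo 0 t))
            ≤ ENNReal.ofReal (C / ν ^ (r⁻¹).toReal) * QG.hNorm (1 / 2) U₀ ^ 2 *
                ENNReal.ofReal (Real.exp (C / ν * QG.bigC U t))) ∧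
          -- second estimate of the forcing
          (∀ r : ℝ≥0∞, ENNReal.ofReal (1 / (1 - δ / 2)) < r →
            AEMeasurable
              (fun τ => QG.hNormHat (-3 / 2 + 2 * (r⁻¹).toReal + 2 * δ) (QG.forceHat F (U τ)))
              (volume.restrict (Set.Ioo 0 t)) ∧
            eLpNorm
              (fun τ => QG.hNormHat (-3 / 2 + 2 * (r⁻¹).toReal + 2 * δ) (QG.forceHat F (U τ)))
              r (volume.restrict (Set.Ioo 0 t))
            ≤ ENNReal.ofReal (C / ν ^ (r⁻¹).toReal) * QG.hNorm (1 / 2 + δ) U₀ ^ 2 *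
                ENNReal.ofReal (Real.exp (C / ν * QG.bigC U t))) ∧
          -- energy estimate for the solution of the linear system
          (∀ (ε : ℝ) (W : ℝ → QG.Field), 0 < ε → QG.IsInhSolution F ν ε T U W →
            ∀ s ∈ Set.Icc (1 / 2) (1 / 2 + 2 * δ),
              AEMeasurable (fun τ => QG.hNorm (s + 1) (W τ)) (volume.restrict (Set.Ioo 0 t)) ∧
              QG.hNorm s (W t) ^ 2 +
                  ENNReal.ofReal ν * ∫⁻ τ in Set.Ioo 0 t, QG.hNorm (s + 1) (W τ) ^ 2
              ≤ ENNReal.ofReal (C / ν ^ 2) *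
                  (max (QG.hNorm (1 / 2) U₀) (QG.hNorm (1 / 2 + δ) U₀)) ^ 4 *
                  ENNReal.ofReal (Real.exp (2 * C / ν * QG.bigC U t))) := by
  obtain ⟨c₀, h₀⟩ := QG.exists_qg_force_bound (d := 0) le_rfl zero_lt_one
  obtain ⟨c₁, h₁⟩ := QG.exists_qg_force_bound hδ.le hδ1
  set c : NNReal := c₀ + c₁ with hc
  have hc₀ : c₀ ≤ c := le_self_add
  have hc₁ : c₁ ≤ c := le_add_self
  have hcc : (0 : ℝ) ≤ c := c.2
  -- The forcing bounds need `c`. The energy estimate needs `8 c²`: the factor `4` of Young, two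
  -- endpoint forcing norms, and the square of the forcing constant. The `1` ensures positivity.
  set C : ℝ := 8 * (c : ℝ) ^ 2 + c + 1 with hC
  have hcC : (c : ℝ) ≤ C := by nlinarith
  have hc₀C : (c₀ : ℝ) ≤ C := le_trans (by exact_mod_cast hc₀) hcC
  have hc₁C : (c₁ : ℝ) ≤ C := le_trans (by exact_mod_cast hc₁) hcC
  have hcC2 : 8 * (c : ℝ) ^ 2 ≤ C := by linarith
  refine ⟨C, by positivity, fun F ν T U₀ U _ hν hT hU₀ hU₁ H t ht0 htT => ?_⟩
  have ht : t ∈ QG.timeInterval T := ⟨ht0, htT⟩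
  have h0 : 0 ∈ QG.timeInterval T := ⟨le_rfl, by exact_mod_cast hT⟩
  have hA : 0 ≤ QG.bigC U t := ENNReal.toReal_nonneg
  have f₀ := h₀ hν H (by simpa using hU₀) ht
  have f₁ := h₁ hν H hU₁ ht
  simp only [mul_zero, add_zero, zero_div, sub_zero, div_one, ENNReal.ofReal_one] at f₀
  refine ⟨fun r hr => ⟨(f₀ r hr).1, (f₀ r hr).2.trans
    (QG.ofReal_rpow_neg_mul_eb_le hν hA hc₀C _)⟩, fun r hr => ⟨(f₁ r hr).1, (f₁ r hr).2.trans
    (QG.ofReal_rpow_neg_mul_eb_le hν hA hc₁C _)⟩, fun ε W _ HW s hs => ?_⟩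
  have hft : ∀ τ ∈ Set.Icc 0 t, QG.HasFt (W τ) := fun τ hτ =>
    HW.hasFt (QG.Icc_subset_timeInterval ht hτ)
  have hm : AEMeasurable (fun τ => QG.hNorm (s + 1) (W τ)) (volume.restrict (Set.Ioo 0 t)) := by
    refine AEMeasurable.congr (f := fun τ => QG.hNormHat (s + 1) (QG.fieldFt (W τ))) ?_ ?_
    · simp only [QG.hNormHat_eq]
      exact ((HW.enCont ht).vCont.aemeasurable_energy (QG.locBdd_wt _) le_rfl).pow_const _
    · refine (ae_restrict_mem measurableSet_Ioo).mono fun τ hτ => ?_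
      exact ((hft τ (Set.Ioo_subset_Icc_self hτ)).hNorm_eq _).symm
  refine ⟨hm, ?_⟩
  have hen := (HW.dissEvol hν.le H ht).energy_le_force hν ht0 (HW.enCont ht)
    (fun τ hτ => H.compMeas_force ht hτ) (HW.fieldFt_init h0) s
  have e1 : ∫⁻ τ in Set.Ioo 0 t, QG.hNorm (s + 1) (W τ) ^ 2 =
      ∫⁻ τ in Set.Ioo 0 t, QG.energy (QG.wt (2 * (s + 1))) (QG.fieldFt (W τ)) :=
    setLIntegral_congr_fun measurableSet_Ioo fun τ hτ =>
      (hft τ (Set.Ioo_subset_Icc_self hτ)).hNorm_sq _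
  rw [(hft t ⟨ht0, le_rfl⟩).hNorm_sq, e1]
  refine hen.trans ?_
  set m := max (QG.hNorm (1 / 2) U₀) (QG.hNorm (1 / 2 + δ) U₀) with hmdef
  set Z := ENNReal.ofReal (ν ^ (-(1 / 2 : ℝ))) * (QG.eb (QG.bigC U t / ν) c * m ^ 2) with hZ
  have hx : 0 ≤ QG.bigC U t / ν := by positivity
  have hinv : ((2 : ℝ≥0∞)⁻¹).toReal = 1 / 2 := by simp
  -- The exponent `r = 2` is admissible in the second forcing bound precisely because `δ < 1`.
  have h2δ : ENNReal.ofReal (1 / (1 - δ / 2)) < 2 := by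
    rw [show (2 : ℝ≥0∞) = ENNReal.ofReal 2 by simp, ENNReal.ofReal_lt_ofReal_iff (by norm_num),
      div_lt_iff₀ (by linarith)]
    linarith
  have g₀ := QG.lintegral_energy_le_of_eLpNorm (f₀ 2 (by norm_num)).2
  have g₁ := QG.lintegral_energy_le_of_eLpNorm (f₁ 2 h2δ).2
  rw [hinv] at g₀ g₁
  have k₀ := g₀.trans (pow_le_pow_left₀ zero_le (b := Z) (mul_le_mul_right (mul_le_mul'
    (QG.eb_mono hx hc₀) (pow_le_pow_left₀ zero_le (le_max_left _ _) 2)) _) 2)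
  have k₁ := g₁.trans (pow_le_pow_left₀ zero_le (b := Z) (mul_le_mul_right (mul_le_mul'
    (QG.eb_mono hx hc₁) (pow_le_pow_left₀ zero_le (le_max_right _ _) 2)) _) 2)
  -- At `r = 2` the two forcing indices are `-1/2` and `-1/2 + 2δ`, and `s - 1` lies between them.
  have hsum : ∫⁻ τ in Set.Ioo 0 t, QG.energy (QG.wt (2 * (s - 1))) (QG.forceHat F (U τ)) ≤
      Z ^ 2 + Z ^ 2 := by
    refine le_trans ?_ (add_le_add k₀ k₁)
    rw [← lintegral_add_left' ((H.vCont_force ht).aemeasurable_energy (QG.locBdd_wt _) le_rfl)]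
    refine setLIntegral_mono' measurableSet_Ioo fun τ hτ => ?_
    exact QG.energy_wt_le_add (by linarith [hs.1]) (by linarith [hs.2])
      (H.compMeas_force ht (Set.Ioo_subset_Icc_self hτ))
  have hZ2 : Z ^ 2 = ENNReal.ofReal (ν⁻¹ * c ^ 2 * Real.exp (2 * (c * (QG.bigC U t / ν)))) *
      m ^ 4 := by
    have e2 : Real.exp (2 * (c * (QG.bigC U t / ν))) = Real.exp (c * (QG.bigC U t / ν)) ^ 2 := by
      rw [← Real.exp_nat_mul]; norm_num
    have e3 : ν⁻¹ = (ν ^ (-(1 / 2 : ℝ))) ^ 2 := by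
      rw [← Real.rpow_natCast, ← Real.rpow_mul hν.le, ← Real.rpow_neg_one]; norm_num
    rw [e2, e3, ENNReal.ofReal_mul (by positivity), ENNReal.ofReal_mul (by positivity),
      ENNReal.ofReal_pow (by positivity), ENNReal.ofReal_pow (by positivity),
      ENNReal.ofReal_pow (by positivity), ENNReal.ofReal_coe_nnreal, hZ, QG.eb]
    ring
  calc ENNReal.ofReal (4 / ν) *
        ∫⁻ τ in Set.Ioo 0 t, QG.energy (QG.wt (2 * (s - 1))) (QG.forceHat F (U τ))
      ≤ ENNReal.ofReal (4 / ν) * (Z ^ 2 + Z ^ 2) := by gcongr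
    _ = ENNReal.ofReal (8 * c ^ 2 / ν ^ 2 * Real.exp (2 * (c * (QG.bigC U t / ν)))) * m ^ 4 := by
        rw [hZ2, ← two_mul, ← mul_assoc, ← mul_assoc, show (2 : ℝ≥0∞) = ENNReal.ofReal 2 by simp,
          ← ENNReal.ofReal_mul (by positivity), ← ENNReal.ofReal_mul (by positivity)]
        congr 2
        field_simp
        ring
    _ ≤ ENNReal.ofReal (C / ν ^ 2 * Real.exp (2 * C / ν * QG.bigC U t)) * m ^ 4 := by
        refine mul_le_mul_left (ENNReal.ofReal_le_ofReal ?_) _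
        have e4 : 2 * C / ν * QG.bigC U t = 2 * (C * (QG.bigC U t / ν)) := by ring
        rw [e4]
        gcongr
    _ = _ := by rw [ENNReal.ofReal_mul (by positivity)]; ring
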